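/- Let $N>1$, let $p_1,\dots,p_N$ be real numbers, and put $\bar p=N\big(\sum_{i=1}^N 1/p_i\big)^{-1}$. Assume $\bar p<N$ and $2<p_i<\bar p^*:=\frac{N\bar p}{N-\bar p}$ for all $i$. Let $\Omega\subset\mathbb{R}^N$ be a bounded open set, $T>0$, and $\Omega_T=\Omega\times(-T,T)$. A function $u:\Omega_T\to\mathbb{R}$ is a *local weak super-solution* of $$\partial_t u=\sum_{i=1}^N\partial_i\big(|\partial_i u|^{p_i-2}\partial_i u\big)\quad\text{in }\Omega_T$$ if the following hold. 1. $u\in C^0_{loc}(-T,T;L^2_{loc}(\Omega))$, i.e. for every compact $K\subset\Omega$ the map $t\mapsto u(\cdot,t)$ is continuous from $(-T,T)$ to $L^2(K)$. 2. $u\in L^1_{loc}(\Omega_T)$, and $u$ has weak spatial derivatives $\partial_iu\in L^{p_i}_{loc}(\Omega_T)$: for a.e. $t\in(-T,T)$, $\partial_iu(\cdot,t)\in L^1_{loc}(\Omega)$ is the $i$-th weak partial derivative of $u(\cdot,t)\in L^1_{loc}(\Omega)$. 3. For all $-T<t_1<t_2<T$, all compact $K\subset\Omega$, and all nonnegative $\varphi\in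 C^\infty(\mathbb{R}^N\times\mathbb{R})$ with $\varphi(x,t)=0$ whenever $x\notin K$, $$\int_K u\varphi\,dx\,\Big|_{t_1}^{t_2}+\int_{t_1}^{t_2}\!\!\int_K\Big(-u\,\partial_t\varphi+\sum_{i=1}^N|\partial_iu|^{p_i-2}\partial_iu\,\partial_i\varphi\Big)dx\,dt\;\ge\;0.$$ Let $u$ be a local weak super-solution in $\Omega_T$ that is locally bounded from below, i.e. on each compact subset of $\Omega_T$ it is a.e. bounded below by a constant. For $\rho>0$ let $$\mathcal{Q}_\rho=\prod_{i=1}^N\big\{|x_i|<\rho^{\bar p/p_i}\big\}\times\big(-\rho^{\bar p},\rho^{\bar p}\big].$$ Then for every $(x,t)\in\Omega_T$ the limit $$u_*(x,t)=\lim_{\rho\to0^+}\ \operatorname*{ess\,inf}_{(x,t)+\mathcal{Q}_\rho}u$$ exists in $(-\infty,+\infty]$. The function $u_*:\Omega_T\to(-\infty,+\infty]$ is lower semicontinuous, and $u=u_*$ almost everywhere in $\Omega_T$. In particular, $u$ has a lower semicontinuous representative. -/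

import Mathlib

open MeasureTheory Filter Topology
open scoped ContDiff

noncomputable section

namespace Anisotropic

/-- Points `(x, t)` of space-time. Only the topology and the Lebesgue measure of `ℝ^N` matter
below, so `ℝ^N` is taken to be `Fin N → ℝ`. -/
abbrev SpaceTime (N : ℕ) : Type := (Fin N → ℝ) × ℝ

/-- The space-time cylinder `Ω_T = Ω × (-T, T)`. -/
def omegaT {N : ℕ} (Ω : Set (Fin N → ℝ)) (T : ℝ) : Set (SpaceTime N) :=
  Ω ×ˢ Set.Ioo (-T) T

/-- The harmonic mean `p̄ = N (∑ 1 / p_i)⁻¹`. -/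
def pBar {N : ℕ} (p : Fin N → ℝ) : ℝ := (N : ℝ) * (∑ i, 1 / p i)⁻¹

/-- The Sobolev exponent `p̄^* = N p̄ / (N - p̄)` of the harmonic mean (meaningful for `p̄ < N`). -/
def pBarStar {N : ℕ} (p : Fin N → ℝ) : ℝ := (N : ℝ) * pBar p / ((N : ℝ) - pBar p)

/-- The classical spatial derivative `∂_i φ` of a function on space-time. -/
def partialSpace {N : ℕ} (i : Fin N) (φ : SpaceTime N → ℝ) (z : SpaceTime N) : ℝ :=
  fderiv ℝ φ z (Pi.single i 1, 0)

/-- The classical time derivative `∂_t φ` of a function on space-time. -/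
def partialTime {N : ℕ} (φ : SpaceTime N → ℝ) (z : SpaceTime N) : ℝ :=
  fderiv ℝ φ z (0, 1)

/-- `g` is the `i`-th weak partial derivative of `f` in the open set `Ω`
(both `f` and `g` being in `L^1_loc(Ω)`). -/
structure IsWeakPartialDeriv {N : ℕ} (Ω : Set (Fin N → ℝ)) (i : Fin N)
    (f g : (Fin N → ℝ) → ℝ) : Prop where
  locallyIntegrableOn_fun : LocallyIntegrableOn f Ω
  locallyIntegrableOn_deriv : LocallyIntegrableOn g Ω
  integral_eq : ∀ ψ : (Fin N → ℝ) → ℝ, ContDiff ℝ ∞ ψ → HasCompactSupport ψ → tsupport ψ ⊆ Ω →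
    ∫ x in Ω, f x * fderiv ℝ ψ x (Pi.single i 1) = - ∫ x in Ω, g x * ψ x

/-- `u ∈ C^0_loc(-T, T; L^2_loc(Ω))`: for every compact `K ⊆ Ω` the map `t ↦ u(·, t)` is
continuous from `(-T, T)` to `L^2(K)`. -/
def MemContL2Loc {N : ℕ} (Ω : Set (Fin N → ℝ)) (T : ℝ) (u : SpaceTime N → ℝ) : Prop :=
  ∀ K : Set (Fin N → ℝ), IsCompact K → K ⊆ Ω → ∀ t ∈ Set.Ioo (-T) T,
    MemLp (fun x => u (x, t)) 2 (volume.restrict K) ∧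
    Tendsto (fun s => eLpNorm (fun x => u (x, s) - u (x, t)) 2 (volume.restrict K)) (𝓝 t) (𝓝 0)

/-- `u ∈ L^p_loc(-T, T; W^{1,p}_loc(Ω))` with weak spatial gradient `v = (∂_1 u, …, ∂_N u)`:
`u` is locally integrable in `Ω_T`, for almost every time `v i` is the `i`-th weak partial
derivative of `u` on `Ω`, and `v i` belongs to `L^{p_i}` on compact subsets of `Ω_T`. -/
structure HasParabolicWeakGradient {N : ℕ} (p : Fin N → ℝ) (Ω : Set (Fin N → ℝ)) (T : ℝ)
    (u : SpaceTime N → ℝ) (v : Fin N → SpaceTime N → ℝ) : Prop where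
  locallyIntegrableOn : LocallyIntegrableOn u (omegaT Ω T)
  weakDeriv : ∀ᵐ t ∂(volume.restrict (Set.Ioo (-T) T)), ∀ i,
    IsWeakPartialDeriv Ω i (fun x => u (x, t)) (fun x => v i (x, t))
  memLp : ∀ i, ∀ C : Set (SpaceTime N), IsCompact C → C ⊆ omegaT Ω T →
    MemLp (v i) (ENNReal.ofReal (p i)) (volume.restrict C)

/-- Local weak super-solutions of `∂_t u = ∑ ∂_i (|∂_i u|^{p_i - 2} ∂_i u)` in `Ω_T`.
The test functions are smooth, nonnegative, and vanish for `x` outside a compact set `K ⊆ Ω`. -/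
def IsLocalWeakSuperSolution {N : ℕ} (p : Fin N → ℝ) (Ω : Set (Fin N → ℝ)) (T : ℝ)
    (u : SpaceTime N → ℝ) : Prop :=
  MemContL2Loc Ω T u ∧
  ∃ v : Fin N → SpaceTime N → ℝ, HasParabolicWeakGradient p Ω T u v ∧
    ∀ t₁ t₂ : ℝ, -T < t₁ → t₁ < t₂ → t₂ < T →
    ∀ K : Set (Fin N → ℝ), IsCompact K → K ⊆ Ω →
    ∀ φ : SpaceTime N → ℝ, ContDiff ℝ ∞ φ → (∀ z, 0 ≤ φ z) →
      (∀ x t, x ∉ K → φ (x, t) = 0) →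
      0 ≤ ((∫ x in K, u (x, t₂) * φ (x, t₂)) - ∫ x in K, u (x, t₁) * φ (x, t₁)) +
        ∫ z in K ×ˢ Set.Ioc t₁ t₂,
          (- u z * partialTime φ z +
            ∑ i, |v i z| ^ (p i - 2) * v i z * partialSpace i φ z)

/-- `u` is locally (essentially) bounded from below in `Ω_T`. -/
def LocallyBoundedBelow {N : ℕ} (Ω : Set (Fin N → ℝ)) (T : ℝ) (u : SpaceTime N → ℝ) : Prop :=
  ∀ C : Set (SpaceTime N), IsCompact C → C ⊆ omegaT Ω T →
    ∃ m : ℝ, ∀ᵐ z ∂(volume.restrict C), m ≤ u z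

/-- The full intrinsic cylinder
`Q_ρ(M) = ∏ {|x_i| < M^{(p_i - 2)/p_i} ρ^{p̄/p_i}} × (-ρ^{p̄}, ρ^{p̄}]`. -/
def intrinsicCylinder {N : ℕ} (p : Fin N → ℝ) (ρ M : ℝ) : Set (SpaceTime N) :=
  {y | (∀ i, |y.1 i| < M ^ ((p i - 2) / p i) * ρ ^ (pBar p / p i)) ∧
    y.2 ∈ Set.Ioc (-(ρ ^ pBar p)) (ρ ^ pBar p)}

/-- The essential infimum of `u` over the translated cylinder `z + Q_ρ(1)`, in `[-∞, ∞]`. -/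
def cylinderEssInf {N : ℕ} (p : Fin N → ℝ) (u : SpaceTime N → ℝ) (z : SpaceTime N) (ρ : ℝ) :
    EReal :=
  essInf (fun w => (u w : EReal)) (volume.restrict {w | w - z ∈ intrinsicCylinder p ρ 1})

/-- The lower semicontinuous regularization `u_*(z) = lim_{ρ → 0+} ess inf_{z + Q_ρ(1)} u`. -/
def lscRegularization {N : ℕ} (p : Fin N → ℝ) (u : SpaceTime N → ℝ) (z : SpaceTime N) : EReal :=
  limUnder (𝓝[>] (0 : ℝ)) (cylinderEssInf p u z)

end Anisotropic

end

/-! Only one inequality uses the equation. The essential infimum over cylinders is monotone in the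
radius, so the limit exists. `u_*` exceeds a level at a point exactly when `u` essentially exceeds a
larger level near it. Hence `u_*` is lower semicontinuous, and `u_* ≤ u` almost everywhere because a
locally null set is null (`lscRegularization_le_ae`). This holds for any function.

The inequality `u ≤ u_*` rests on a De Giorgi lemma at unit scale (`exists_deGiorgi`). If a
super-solution is at least `l - L` in the unit ball and at least `l` there outside a set of measure
at most `ν`, then it is at least `l - η` near the centre, with `ν` independent of the solution. The
equation is invariant under `(y, s) ↦ (τ^{1/p_i} y_i, τ s)` with no change in the values of `u`
(`isUnitSuperSolution_rescaling`). So at a density point of `{u ≥ l}` the lemma applies for a small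
`τ`, while the local lower bound keeps `L` fixed. Thus `u ≥ l - η` near the point for every `η > 0`
(`ae_exists_nhds_ae_le`), and rational levels suffice.

For the De Giorgi lemma, test with `(k - u)₊² ζ`. This bounds `∫ (k - u)₊³ ζ` on almost every time
slice and `∫∫ (k - u)₊ ζ |∂_i u|^{p_i}` in space-time, both by the measure of `{u < k}` in the
support of `ζ` (`caccioppoli`). The second bound controls the spatial translates of `W = (k - u)₊²
ζ` in `L¹`. The first shows that `W` has small mean on spatial cubes of a suitable side, so where
`W` is large it oscillates on the cube. Comparing the two bounds a lower level set by a power `1 +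
1/N` of the previous one (`volume_le_of_cutoff`), and the usual iteration closes. This comparison
takes the place of a parabolic Sobolev inequality.

The test function is made legitimate by mollifying `u`, its gradient and its flux separately. The
mollified functions satisfy a linear differential inequality, and the nonlinear relation between
gradient and flux returns in the limit (`exists_isSmoothApproximation`). -/

namespace Anisotropic

/-! ### The regularization of an arbitrary function -/

section Regularization

variable {N : ℕ} {p : Fin N → ℝ}

theorem pBar_pos (hN : 0 < N) (hp : ∀ i, 0 < p i) : 0 < pBar p := by
  have : Nonempty (Fin N) := ⟨⟨0, hN⟩⟩
  unfold pBar
  have : 0 < ∑ i, 1 / p i := Finset.sum_pos (fun i _ => by have := hp i; positivity)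
    Finset.univ_nonempty
  have hN' : (0 : ℝ) < N := by exact_mod_cast hN
  positivity

/-- The translated cylinder `z + Q_ρ(1)`. -/
def translatedCylinder (p : Fin N → ℝ) (z : SpaceTime N) (ρ : ℝ) : Set (SpaceTime N) :=
  {w | w - z ∈ intrinsicCylinder p ρ 1}

theorem mem_translatedCylinder {z w : SpaceTime N} {ρ : ℝ} :
    w ∈ translatedCylinder p z ρ ↔ (∀ i, |w.1 i - z.1 i| < ρ ^ (pBar p / p i)) ∧
      -(ρ ^ pBar p) < w.2 - z.2 ∧ w.2 - z.2 ≤ ρ ^ pBar p := by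
  simp [translatedCylinder, intrinsicCylinder]

theorem translatedCylinder_mono (hp : ∀ i, 0 < p i) (hP : 0 < pBar p) (z : SpaceTime N)
    {ρ σ : ℝ} (hρ : 0 < ρ) (h : ρ ≤ σ) :
    translatedCylinder p z ρ ⊆ translatedCylinder p z σ := by
  intro w hw
  rw [mem_translatedCylinder] at hw ⊢
  have h1 : ρ ^ pBar p ≤ σ ^ pBar p := Real.rpow_le_rpow hρ.le h hP.le
  refine ⟨fun i => (hw.1 i).trans_le (Real.rpow_le_rpow hρ.le h ?_), ?_, ?_⟩
  · have := hp i; positivity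
  · linarith [hw.2.1]
  · linarith [hw.2.2]

theorem translatedCylinder_mem_nhds (z : SpaceTime N) {ρ : ℝ} (hρ : 0 < ρ) :
    translatedCylinder p z ρ ∈ 𝓝 z := by
  -- The cylinder is half-open in time, so it is compared with its open core.
  have hopen : IsOpen {w : SpaceTime N | (∀ i, |w.1 i - z.1 i| < ρ ^ (pBar p / p i)) ∧
      |w.2 - z.2| < ρ ^ pBar p} := by
    refine IsOpen.and ?_ (isOpen_lt (by fun_prop) continuous_const)
    rw [Set.ofPred_forall]
    exact isOpen_iInter_of_finite fun i => isOpen_lt (by fun_prop) continuous_const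
  refine mem_of_superset (hopen.mem_nhds ?_) ?_
  · simp only [Set.mem_ofPred_eq, sub_self, abs_zero]
    exact ⟨fun i => by positivity, by positivity⟩
  · intro w hw
    rw [mem_translatedCylinder]
    have := abs_lt.1 hw.2
    exact ⟨hw.1, this.1, this.2.le⟩

theorem exists_translatedCylinder_subset_closedBall (hp : ∀ i, 0 < p i) (hP : 0 < pBar p)
    {r : ℝ} (hr : 0 < r) : ∀ᶠ ρ in 𝓝[>] (0 : ℝ), ∀ z,
      translatedCylinder p z ρ ⊆ Metric.closedBall z r := by
  have key : ∀ a : ℝ, 0 < a → ∀ᶠ ρ in 𝓝[>] (0 : ℝ), ρ ^ a < r := by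
    intro a ha
    have : Tendsto (fun ρ : ℝ => ρ ^ a) (𝓝 0) (𝓝 (0 ^ a)) :=
      (Real.continuousAt_rpow_const 0 a (Or.inr ha.le)).tendsto
    rw [Real.zero_rpow ha.ne'] at this
    exact (this.mono_left nhdsWithin_le_nhds).eventually (gt_mem_nhds hr)
  have h1 : ∀ᶠ ρ in 𝓝[>] (0 : ℝ), ∀ i, ρ ^ (pBar p / p i) < r :=
    eventually_all.2 fun i => key _ (by have := hp i; positivity)
  filter_upwards [h1, key _ hP] with ρ h1 h2 z w hw
  rw [mem_translatedCylinder] at hw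
  rw [Metric.mem_closedBall, Prod.dist_eq, max_le_iff]
  refine ⟨(dist_pi_le_iff hr.le).2 fun i => ?_, ?_⟩
  · rw [Real.dist_eq]
    exact ((hw.1 i).trans (h1 i)).le
  · rw [Real.dist_eq, abs_le]
    constructor <;> linarith [hw.2.1, hw.2.2]

variable {u : SpaceTime N → ℝ}

/-- The essential infimum increases as the cylinder shrinks, so the limit exists in `EReal`. The
value of `limUnder` is meaningful only because of this existence. -/
theorem tendsto_cylinderEssInf (hp : ∀ i, 0 < p i) (hP : 0 < pBar p) (z : SpaceTime N) :
    Tendsto (cylinderEssInf p u z) (𝓝[>] (0 : ℝ)) (𝓝 (lscRegularization p u z)) := by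
  have hanti : AntitoneOn (cylinderEssInf p u z) (Set.Ioi 0) := by
    intro ρ hρ σ _ h
    exact essInf_antitone_measure
      (Measure.restrict_mono (translatedCylinder_mono hp hP z hρ h) le_rfl).absolutelyContinuous
  exact tendsto_nhds_limUnder ⟨_, AntitoneOn.tendsto_nhdsGT hanti (OrderTop.bddAbove _)⟩

/-- With its converse `le_lscRegularization_of_nhds`, this replaces cylinders by arbitrary
neighbourhoods. The anisotropic geometry plays no further role in the regularization. -/
theorem exists_nhds_ae_lt_of_lt_lscRegularization (hp : ∀ i, 0 < p i) (hP : 0 < pBar p)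
    {z : SpaceTime N} {y : EReal} (hy : y < lscRegularization p u z) :
    ∃ U ∈ 𝓝 z, ∀ᵐ w, w ∈ U → y < (u w : EReal) := by
  have h := (tendsto_cylinderEssInf (u := u) hp hP z).eventually (lt_mem_nhds hy)
  obtain ⟨ρ, hρ, hρ0⟩ := (h.and self_mem_nhdsWithin).exists
  obtain ⟨U, hU, hUo, hzU⟩ := mem_nhds_iff.1 (translatedCylinder_mem_nhds (p := p) z hρ0)
  refine ⟨U, hUo.mem_nhds hzU, ?_⟩
  have h2 := ae_lt_of_lt_essInf hρ
  rw [← ae_restrict_iff' hUo.measurableSet]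
  exact ae_mono (Measure.restrict_mono hU le_rfl) h2

theorem le_lscRegularization_of_nhds (hp : ∀ i, 0 < p i) (hP : 0 < pBar p)
    {z : SpaceTime N} {c : EReal} {U : Set (SpaceTime N)} (hU : U ∈ 𝓝 z)
    (h : ∀ᵐ w, w ∈ U → c ≤ (u w : EReal)) : c ≤ lscRegularization p u z := by
  obtain ⟨r, hr, hrU⟩ := Metric.nhds_basis_closedBall.mem_iff.1 hU
  refine ge_of_tendsto (tendsto_cylinderEssInf (u := u) hp hP z) ?_
  filter_upwards [exists_translatedCylinder_subset_closedBall hp hP hr] with ρ hρ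
  refine le_essInf_of_ae_le _ (ae_mono
    (Measure.restrict_mono (hρ z) le_rfl) ?_)
  change ∀ᵐ w ∂(volume.restrict _), c ≤ (u w : EReal)
  rw [ae_restrict_iff' Metric.isClosed_closedBall.measurableSet]
  filter_upwards [h] with w hw hwr using hw (hrU hwr)

theorem lowerSemicontinuous_lscRegularization (hp : ∀ i, 0 < p i) (hP : 0 < pBar p) :
    LowerSemicontinuous (lscRegularization p u) := by
  intro z y hy
  obtain ⟨y', hyy', hy'⟩ := exists_between hy
  obtain ⟨U, hU, h⟩ := exists_nhds_ae_lt_of_lt_lscRegularization hp hP hy'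
  filter_upwards [eventually_mem_nhds_iff.2 hU] with w hw
  exact hyy'.trans_le (le_lscRegularization_of_nhds hp hP hw (h.mono fun _ h1 h2 => (h1 h2).le))

/-- For rational `q`, near a point with `q < u_*` one has `q < u` almost everywhere. So the set
where `u ≤ q < u_*` is locally null, hence null, and the union over `q` is countable. -/
theorem lscRegularization_le_ae (hp : ∀ i, 0 < p i) (hP : 0 < pBar p) :
    ∀ᵐ z, lscRegularization p u z ≤ (u z : EReal) := by
  have key : ∀ q : ℚ, ∀ᵐ z, ((q : ℝ) : EReal) < lscRegularization p u z →
      ((q : ℝ) : EReal) < u z := by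
    intro q
    rw [ae_iff]
    refine measure_null_of_locally_null _ fun z hz => ?_
    have hz' : ((q : ℝ) : EReal) < lscRegularization p u z := by
      by_contra h
      exact hz fun h' => absurd h' h
    obtain ⟨U, hU, h⟩ := exists_nhds_ae_lt_of_lt_lscRegularization hp hP hz'
    refine ⟨_, inter_mem_nhdsWithin _ hU, measure_mono_null ?_ (ae_iff.1 h)⟩
    rintro w ⟨hw, hwU⟩ h'
    exact hw fun _ => h' hwU
  filter_upwards [ae_all_iff.2 key] with z hz
  by_contra! h
  obtain ⟨q, hq1, hq2⟩ := EReal.lt_iff_exists_rat_btwn.1 h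
  exact absurd (hz q hq2) (not_lt.2 hq1.le)

/-- If the superlevel sets of `u` have the interior property up to an arbitrarily small loss,
then `u` agrees with its lower semicontinuous regularization. -/
theorem ae_le_lscRegularization (hp : ∀ i, 0 < p i) (hP : 0 < pBar p) {O : Set (SpaceTime N)}
    (h : ∀ l : ℚ, ∀ᵐ z, z ∈ O → (l : ℝ) ≤ u z → ∀ ε : ℝ, 0 < ε →
      ∃ U ∈ 𝓝 z, ∀ᵐ w, w ∈ U → (l : ℝ) - ε ≤ u w) :
    ∀ᵐ z, z ∈ O → (u z : EReal) ≤ lscRegularization p u z := by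
  filter_upwards [ae_all_iff.2 h] with z hz hzO
  by_contra! hcon
  obtain ⟨q, hq1, hq2⟩ := EReal.lt_iff_exists_rat_btwn.1 hcon
  obtain ⟨l, hl1, hl2⟩ := EReal.lt_iff_exists_rat_btwn.1 hq2
  have hql : (q : ℝ) < l := EReal.coe_lt_coe_iff.1 hl1
  -- Two rationals are placed as `u_* < q < l < u`; the permitted loss is spent on the gap `l - q`.
  obtain ⟨U, hU, hw⟩ := hz l hzO (EReal.coe_lt_coe_iff.1 hl2).le (l - q) (by linarith)
  refine absurd (le_lscRegularization_of_nhds (c := ((q : ℝ) : EReal)) hp hP hU ?_) (not_le.2 hq1)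
  filter_upwards [hw] with w hw hwU
  have := hw hwU
  exact EReal.coe_le_coe_iff.2 (by linarith)

end Regularization

instance isAddHaarMeasure_volume_spaceTime (N : ℕ) :
    (volume : Measure (SpaceTime N)).IsAddHaarMeasure :=
  inferInstanceAs
    (((volume : Measure (Fin N → ℝ)).prod (volume : Measure ℝ)).IsAddHaarMeasure)

/-! ### Averages: convergence in `L¹` and almost everywhere -/

section ApproximateIdentity

variable {N : ℕ}

/-- Averaging kernels: nonnegative integrable functions of integral one supported in a
ball of radius `δ`. -/
structure IsAveragingKernel (η : SpaceTime N → ℝ) (δ : ℝ) : Prop where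
  nonneg : ∀ z, 0 ≤ η z
  integrable : Integrable η
  integral_eq_one : ∫ z, η z = 1
  eq_zero : ∀ z, δ ≤ ‖z‖ → η z = 0

/-- The convolution of `f` with the kernel `η`. -/
noncomputable def average (η f : SpaceTime N → ℝ) : SpaceTime N → ℝ :=
  convolution f η (ContinuousLinearMap.mul ℝ ℝ) volume

theorem average_apply (η f : SpaceTime N → ℝ) (z : SpaceTime N) :
    average η f z = ∫ y, f y * η (z - y) := rfl

theorem average_apply' (η f : SpaceTime N → ℝ) (z : SpaceTime N) :
    average η f z = ∫ h, f (z - h) * η h := by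
  rw [average_apply, ← integral_sub_left_eq_self (fun y => f y * η (z - y)) volume z]
  simp

theorem integrable_average {η f : SpaceTime N → ℝ} (hη : Integrable η) (hf : Integrable f) :
    Integrable (average η f) :=
  hf.integrable_convolution _ hη

/-- For continuous compactly supported functions this is dominated convergence. The general case
follows by density, since translation is an isometry of `L¹`. -/
theorem tendsto_integral_abs_translate_sub {f : SpaceTime N → ℝ} (hf : Integrable f) :
    Tendsto (fun h => ∫ z, |f (z - h) - f z|) (𝓝 0) (𝓝 0) := by
  rw [Metric.tendsto_nhds]
  intro ε hε
  obtain ⟨g, hgc, hgf, hg, hgi⟩ := hf.exists_hasCompactSupport_integral_sub_le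
    (show 0 < ε / 4 by positivity)
  obtain ⟨M, hM⟩ := hgc.exists_bound_of_continuous hg
  obtain ⟨R, hR⟩ := hgc.isCompact.isBounded.subset_closedBall 0
  have hg0 : Tendsto (fun h => ∫ z, |g (z - h) - g z|) (𝓝 0) (𝓝 (∫ z : SpaceTime N, (0 : ℝ))) := by
    refine tendsto_integral_filter_of_dominated_convergence
      -- This ball contains the supports of all translates by `‖h‖ ≤ 1`.
      (Set.indicator (Metric.closedBall 0 (R + 1)) fun _ => 2 * M) ?_ ?_ ?_ ?_
    · exact Eventually.of_forall fun h => by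
        refine Continuous.aestronglyMeasurable ?_
        fun_prop
    · filter_upwards [Metric.closedBall_mem_nhds (0 : SpaceTime N) one_pos] with h hh
      refine ae_of_all _ fun z => ?_
      rw [Real.norm_eq_abs, abs_abs]
      by_cases hz : z ∈ Metric.closedBall (0 : SpaceTime N) (R + 1)
      · rw [Set.indicator_of_mem hz]
        have h1 := hM (z - h)
        have h2 := hM z
        rw [Real.norm_eq_abs] at h1 h2
        calc |g (z - h) - g z| ≤ |g (z - h)| + |g z| := abs_sub _ _
          _ ≤ 2 * M := by linarith
      · rw [Set.indicator_of_notMem hz]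
        rw [mem_closedBall_zero_iff] at hz hh
        have h1 : g z = 0 := by
          refine image_eq_zero_of_notMem_tsupport fun h' => hz ?_
          have := mem_closedBall_zero_iff.1 (hR h')
          linarith
        have h2 : g (z - h) = 0 := by
          refine image_eq_zero_of_notMem_tsupport fun h' => hz ?_
          have h3 := mem_closedBall_zero_iff.1 (hR h')
          have h4 := norm_sub_norm_le z h
          linarith
        simp [h1, h2]
    · exact (integrable_indicator_iff Metric.isClosed_closedBall.measurableSet).2
        (integrableOn_const (isCompact_closedBall _ _).measure_ne_top)
    · refine ae_of_all _ fun z => ?_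
      have : Continuous fun h => |g (z - h) - g z| := by fun_prop
      simpa using this.tendsto 0
  rw [integral_zero] at hg0
  filter_upwards [hg0.eventually (gt_mem_nhds (show 0 < ε / 4 by positivity))] with h hh
  have i1 : Integrable fun z => |f (z - h) - g (z - h)| :=
    ((hf.sub hgi).comp_sub_right h).abs
  have i2 : Integrable fun z => |g (z - h) - g z| := ((hgi.comp_sub_right h).sub hgi).abs
  have i3 : Integrable fun z => |f z - g z| := (hf.sub hgi).abs
  have e1 : ∫ z, |f (z - h) - g (z - h)| = ∫ z, |f z - g z| :=
    integral_sub_right_eq_self (fun z => |f z - g z|) h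
  have i4 : Integrable fun z => |f (z - h) - f z| := ((hf.comp_sub_right h).sub hf).abs
  have hle : ∫ z, |f (z - h) - f z| ≤
      ∫ z, (|f (z - h) - g (z - h)| + |g (z - h) - g z| + |f z - g z|) := by
    refine integral_mono i4 ((i1.add i2).add i3) fun z => ?_
    have e : f (z - h) - f z = (f (z - h) - g (z - h)) + (g (z - h) - g z) + -(f z - g z) := by
      ring
    change |f (z - h) - f z| ≤ _
    rw [e]
    refine (abs_add_three _ _ _).trans ?_
    rw [abs_neg]
  have i12 : Integrable fun z => |f (z - h) - g (z - h)| + |g (z - h) - g z| := i1.add i2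
  rw [integral_add i12 i3, integral_add i1 i2, e1] at hle
  have hgf' : ∫ z, |f z - g z| ≤ ε / 4 := hgf
  rw [Real.dist_eq, sub_zero, abs_of_nonneg (integral_nonneg fun z => abs_nonneg _)]
  linarith

/-- The error is a mean, with weight `η`, of the differences `f (z - h) - f z` over `‖h‖ < δ`.
Fubini then moves the `z`-integral inside. -/
theorem integral_abs_average_sub_le {f η : SpaceTime N → ℝ} {δ ε : ℝ}
    (hη : IsAveragingKernel η δ) (hf : Integrable f)
    (h : ∀ h : SpaceTime N, ‖h‖ < δ → ∫ z, |f (z - h) - f z| ≤ ε) :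
    ∫ z, |average η f z - f z| ≤ ε := by
  have hprod : Integrable (fun q : SpaceTime N × SpaceTime N =>
      η q.2 * f (q.1 - q.2)) (volume.prod volume) :=
    hη.integrable.convolution_integrand (ContinuousLinearMap.mul ℝ ℝ) hf
  have hprod2 : Integrable (fun q : SpaceTime N × SpaceTime N => f q.1 * η q.2)
      (volume.prod volume) := hf.mul_prod hη.integrable
  have hdiff : Integrable (Function.uncurry fun z h : SpaceTime N => |f (z - h) - f z| * η h)
      (volume.prod volume) := by
    refine (hprod.sub hprod2).abs.congr (ae_of_all _ fun q => ?_)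
    simp only [Function.uncurry, Pi.sub_apply]
    rw [← abs_of_nonneg (hη.nonneg q.2), ← abs_mul, abs_of_nonneg (hη.nonneg q.2)]
    congr 1; ring
  have hpt : ∀ᵐ z, |average η f z - f z| ≤ ∫ h, |f (z - h) - f z| * η h := by
    filter_upwards [hprod.prod_right_ae] with z hz
    have e : average η f z - f z = ∫ h, (f (z - h) - f z) * η h := by
      have : f z = ∫ h, f z * η h := by rw [integral_const_mul, hη.integral_eq_one, mul_one]
      rw [average_apply']
      conv_lhs => rw [this]
      rw [← integral_sub (by simpa only [mul_comm] using hz) (hη.integrable.const_mul _)]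
      simp only [sub_mul]
    rw [e]
    refine (abs_integral_le_integral_abs).trans_eq ?_
    refine integral_congr_ae (ae_of_all _ fun h => ?_)
    simp only [abs_mul, abs_of_nonneg (hη.nonneg h)]
  calc ∫ z, |average η f z - f z| ≤ ∫ z, ∫ h, |f (z - h) - f z| * η h :=
        integral_mono_ae ((integrable_average hη.integrable hf).sub hf).abs
          hdiff.integral_prod_left hpt
    _ = ∫ h, ∫ z, |f (z - h) - f z| * η h := integral_integral_swap hdiff
    _ ≤ ∫ h, ε * η h := by
        refine integral_mono hdiff.integral_prod_right (hη.integrable.const_mul _) fun h' => ?_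
        simp only [integral_mul_const]
        by_cases hh : ‖h'‖ < δ
        · exact mul_le_mul_of_nonneg_right (h h' hh) (hη.nonneg _)
        · simp [hη.eq_zero h' (not_lt.1 hh)]
    _ = ε := by rw [integral_const_mul, hη.integral_eq_one, mul_one]

/-- The kernels need be neither smooth nor comparable to balls. The result serves both smooth
mollifiers and normalised indicators of anisotropic dilates of the unit ball. -/
theorem tendsto_integral_abs_average_sub {f : SpaceTime N → ℝ} (hf : Integrable f)
    {η : ℕ → SpaceTime N → ℝ} {δ : ℕ → ℝ} (hη : ∀ n, IsAveragingKernel (η n) (δ n))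
    (hδ : Tendsto δ atTop (𝓝 0)) :
    Tendsto (fun n => ∫ z, |average (η n) f z - f z|) atTop (𝓝 0) := by
  rw [Metric.tendsto_nhds]
  intro ε hε
  have h1 := (tendsto_integral_abs_translate_sub hf).eventually (gt_mem_nhds (half_pos hε))
  obtain ⟨r, hr, hr'⟩ := Metric.eventually_nhds_iff_ball.1 h1
  filter_upwards [hδ.eventually (gt_mem_nhds hr)] with n hn
  have := integral_abs_average_sub_le (hη n) hf (ε := ε / 2) fun h hh =>
    (hr' h (mem_ball_zero_iff.2 (hh.trans hn))).le
  rw [Real.dist_eq, sub_zero, abs_of_nonneg (integral_nonneg fun z => abs_nonneg _)]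
  linarith

/-- The errors are summable in `L¹`, so their sum is integrable and finite almost everywhere. The
terms therefore tend to zero, and `|f|` plus the sum dominates. -/
theorem ae_tendsto_and_dominated_of_integral_abs_sub_le {g : ℕ → SpaceTime N → ℝ}
    {f : SpaceTime N → ℝ} (hf : Integrable f) (hg : ∀ n, Integrable (g n))
    (h : ∀ n, ∫ z, |g n z - f z| ≤ (1 / 2) ^ n) :
    (∀ᵐ z, Tendsto (fun n => g n z) atTop (𝓝 (f z))) ∧
      ∃ G : SpaceTime N → ℝ, Integrable G ∧ ∀ᵐ z, ∀ n, |g n z| ≤ G z := by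
  have hmeas : ∀ n, AEMeasurable (fun z => ‖g n z - f z‖ₑ) volume := fun n =>
    ((hg n).sub hf).aestronglyMeasurable.enorm
  have hsum : ∫⁻ z, ∑' n, ‖g n z - f z‖ₑ ≠ ⊤ := by
    rw [lintegral_tsum hmeas]
    refine ne_top_of_le_ne_top (b := ∑' n : ℕ, ENNReal.ofReal ((1 / 2) ^ n)) ?_
      (ENNReal.tsum_le_tsum fun n => ?_)
    · rw [← ENNReal.ofReal_tsum_of_nonneg (fun n => by positivity) summable_geometric_two]
      exact ENNReal.ofReal_ne_top
    · exact (ofReal_integral_norm_eq_lintegral_enorm ((hg n).sub hf)).symm.trans_le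
        (ENNReal.ofReal_le_ofReal (h n))
  have hsm : AEMeasurable (fun z => ∑' n, ‖g n z - f z‖ₑ) volume := AEMeasurable.tsum hmeas
  have hfin : ∀ᵐ z, ∑' n, ‖g n z - f z‖ₑ ≠ ⊤ :=
    (ae_lt_top' hsm hsum).mono fun _ hz => hz.ne
  constructor
  · filter_upwards [hfin] with z hz
    have h0 := ENNReal.tendsto_cofinite_zero_of_tsum_ne_top hz
    rw [Nat.cofinite_eq_atTop] at h0
    rw [tendsto_iff_edist_tendsto_0]
    simpa only [edist_eq_enorm_sub] using h0
  · refine ⟨fun z => |f z| + (∑' n, ‖g n z - f z‖ₑ).toReal,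
      hf.abs.add (integrable_toReal_of_lintegral_ne_top hsm hsum), ?_⟩
    filter_upwards [hfin] with z hz n
    have h1 : |g n z - f z| ≤ (∑' n, ‖g n z - f z‖ₑ).toReal := by
      have := ENNReal.toReal_mono hz (ENNReal.le_tsum (f := fun n => ‖g n z - f z‖ₑ) n)
      simpa using this
    have h2 : |g n z| ≤ |f z| + |g n z - f z| := by
      have := abs_add_le (f z) (g n z - f z)
      simpa using this
    linarith

/-- Along a subsequence, averages of finitely many integrable functions converge almost
everywhere with integrable domination. -/
theorem exists_subseq_average_tendsto {ι : Type*} [Finite ι] {f : ι → SpaceTime N → ℝ}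
    (hf : ∀ j, Integrable (f j)) {η : ℕ → SpaceTime N → ℝ} {δ : ℕ → ℝ}
    (hη : ∀ n, IsAveragingKernel (η n) (δ n)) (hδ : Tendsto δ atTop (𝓝 0)) :
    ∃ φ : ℕ → ℕ, StrictMono φ ∧ ∀ j,
      (∀ᵐ z, Tendsto (fun n => average (η (φ n)) (f j) z) atTop (𝓝 (f j z))) ∧
      ∃ G : SpaceTime N → ℝ, Integrable G ∧ ∀ᵐ z, ∀ n, |average (η (φ n)) (f j) z| ≤ G z := by
  obtain ⟨φ, hφ, h⟩ := extraction_forall_of_eventually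
    (P := fun n k => ∀ j, ∫ z, |average (η k) (f j) z - f j z| ≤ (1 / 2) ^ n) fun n =>
      eventually_all.2 fun j => ((tendsto_integral_abs_average_sub (hf j) hη hδ).eventually
        (gt_mem_nhds (show (0 : ℝ) < (1 / 2) ^ n by positivity))).mono fun _ h => h.le
  exact ⟨φ, hφ, fun j => ae_tendsto_and_dominated_of_integral_abs_sub_le (hf j)
    (fun n => integrable_average (hη _).integrable (hf j)) fun n => h n j⟩

end ApproximateIdentity

/-! ### Mollified super-solutions -/

section Smoothing

variable {N : ℕ} {p : Fin N → ℝ}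

/-- The `i`-th component `|v_i|^{p_i - 2} v_i` of the flux. -/
noncomputable def flux (p : Fin N → ℝ) (v : Fin N → SpaceTime N → ℝ) (i : Fin N)
    (z : SpaceTime N) : ℝ :=
  |v i z| ^ (p i - 2) * v i z

theorem abs_flux (v : Fin N → SpaceTime N → ℝ) {i : Fin N} (hp : 2 < p i) (z : SpaceTime N) :
    |flux p v i z| = |v i z| ^ (p i - 1) := by
  rw [flux, abs_mul, abs_of_nonneg (by positivity)]
  rcases (abs_nonneg (v i z)).eq_or_lt with h | h
  · rw [← h, Real.zero_rpow (by linarith), Real.zero_rpow (by linarith), zero_mul]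
  · rw [← Real.rpow_add_one h.ne']
    congr 1; ring

theorem flux_mul_self (v : Fin N → SpaceTime N → ℝ) {i : Fin N} (hp : 2 < p i)
    (z : SpaceTime N) : flux p v i z * v i z = |v i z| ^ p i := by
  rw [flux, mul_assoc, ← abs_mul_abs_self, ← mul_assoc]
  rcases (abs_nonneg (v i z)).eq_or_lt with h | h
  · rw [← h, Real.zero_rpow (by linarith), Real.zero_rpow (by linarith)]; ring
  · rw [← Real.rpow_add_one h.ne', ← Real.rpow_add_one h.ne']
    congr 1; ring

theorem rpow_le_one_add_rpow {a q r : ℝ} (ha : 0 ≤ a) (hq : 0 ≤ q) (hqr : q ≤ r) :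
    a ^ q ≤ 1 + a ^ r := by
  rcases le_total a 1 with h | h
  · have := Real.rpow_le_one ha h hq
    have := Real.rpow_nonneg ha r
    linarith
  · have := Real.rpow_le_rpow_of_exponent_le h hqr
    linarith

/-- Young's inequality with crude constants: replace the smaller of `a` and `b` by the larger. -/
theorem rpow_sub_one_mul_le {a b q : ℝ} (ha : 0 ≤ a) (hb : 0 ≤ b) (hq : 1 < q) :
    a ^ (q - 1) * b ≤ a ^ q + b ^ q := by
  have e : ∀ c : ℝ, 0 ≤ c → c ^ (q - 1) * c = c ^ q := fun c hc => by
    rcases hc.eq_or_lt with h | h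
    · rw [← h, Real.zero_rpow (by linarith : q ≠ 0), mul_zero]
    · rw [← Real.rpow_add_one h.ne']; congr 1; ring
  rcases le_total a b with h | h
  · have : a ^ (q - 1) * b ≤ b ^ (q - 1) * b :=
      mul_le_mul_of_nonneg_right (Real.rpow_le_rpow ha h (by linarith)) hb
    rw [e b hb] at this
    have := Real.rpow_nonneg ha q
    linarith
  · have : a ^ (q - 1) * b ≤ a ^ (q - 1) * a :=
      mul_le_mul_of_nonneg_left h (by positivity)
    rw [e a ha] at this
    have := Real.rpow_nonneg hb q
    linarith

/-- Distributional super-solutions in the unit ball of space-time (a product of intervals),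
extended by zero. -/
structure IsUnitSuperSolution (p : Fin N → ℝ) (u : SpaceTime N → ℝ)
    (v : Fin N → SpaceTime N → ℝ) : Prop where
  integrable_fun : Integrable u
  aestronglyMeasurable : ∀ i, AEStronglyMeasurable (v i) volume
  integrable_rpow : ∀ i, Integrable fun z => |v i z| ^ p i
  eq_zero : ∀ i, ∀ z ∉ Metric.ball (0 : SpaceTime N) 1, v i z = 0
  weakDeriv : ∀ φ : SpaceTime N → ℝ, ContDiff ℝ ∞ φ → tsupport φ ⊆ Metric.ball 0 1 →
    ∀ i, ∫ z, u z * partialSpace i φ z = -∫ z, v i z * φ z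
  superSolution : ∀ φ : SpaceTime N → ℝ, ContDiff ℝ ∞ φ → (∀ z, 0 ≤ φ z) →
    tsupport φ ⊆ Metric.ball 0 1 →
    0 ≤ ∫ z, (-u z * partialTime φ z + ∑ i, flux p v i z * partialSpace i φ z)

namespace IsUnitSuperSolution

variable {u : SpaceTime N → ℝ} {v : Fin N → SpaceTime N → ℝ}

/-- The unit ball has finite measure and `v i` vanishes outside it, so lower powers are dominated by
`1 + |v i| ^ p i` there. -/
theorem integrable_rpow_of_le (h : IsUnitSuperSolution p u v) (i : Fin N) {q : ℝ}
    (hq : 0 < q) (hqp : q ≤ p i) : Integrable fun z => |v i z| ^ q := by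
  have h1 : Integrable ((Metric.ball (0 : SpaceTime N) 1).indicator fun _ => (1 : ℝ)) :=
    (integrable_indicator_iff measurableSet_ball).2
      (integrableOn_const measure_ball_lt_top.ne)
  refine (h1.add (h.integrable_rpow i)).mono'
    ((h.aestronglyMeasurable i).norm.aemeasurable.pow_const q).aestronglyMeasurable
    (ae_of_all _ fun z => ?_)
  rw [Real.norm_of_nonneg (by positivity), Pi.add_apply]
  by_cases hz : z ∈ Metric.ball (0 : SpaceTime N) 1
  · rw [Set.indicator_of_mem hz]
    exact rpow_le_one_add_rpow (abs_nonneg _) hq.le hqp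
  · rw [Set.indicator_of_notMem hz, h.eq_zero i z hz, abs_zero, Real.zero_rpow hq.ne',
      Real.zero_rpow (by linarith)]
    norm_num

theorem integrable_grad (h : IsUnitSuperSolution p u v) {i : Fin N} (hp : 2 < p i) :
    Integrable (v i) := by
  have := h.integrable_rpow_of_le i one_pos (by linarith)
  simp only [Real.rpow_one] at this
  exact (integrable_norm_iff (h.aestronglyMeasurable i)).1 this

theorem integrable_flux (h : IsUnitSuperSolution p u v) {i : Fin N} (hp : 2 < p i) :
    Integrable (flux p v i) := by
  have := h.integrable_rpow_of_le i (q := p i - 1) (by linarith) (by linarith)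
  have hm : AEStronglyMeasurable (flux p v i) volume :=
    (((h.aestronglyMeasurable i).norm.aemeasurable.pow_const _).mul
      (h.aestronglyMeasurable i).aemeasurable).aestronglyMeasurable
  refine (integrable_norm_iff hm).1 (this.congr (ae_of_all _ fun z => ?_))
  exact (abs_flux v hp z).symm

end IsUnitSuperSolution

namespace IsAveragingKernel

variable {η : SpaceTime N → ℝ} {δ : ℝ}

theorem tsupport_subset (hη : IsAveragingKernel η δ) : tsupport η ⊆ Metric.closedBall 0 δ := by
  refine closure_minimal (fun z hz => ?_) Metric.isClosed_closedBall
  rw [mem_closedBall_zero_iff]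
  by_contra h
  exact hz (hη.eq_zero z (not_le.1 h).le)

theorem hasCompactSupport (hη : IsAveragingKernel η δ) : HasCompactSupport η :=
  (isCompact_closedBall _ _).of_isClosed_subset (isClosed_tsupport η) hη.tsupport_subset

theorem tsupport_comp_sub_subset (hη : IsAveragingKernel η δ) (z : SpaceTime N) :
    tsupport (fun y => η (z - y)) ⊆ Metric.closedBall z δ := by
  refine closure_minimal (fun y hy => ?_) Metric.isClosed_closedBall
  rw [mem_closedBall_iff_norm']
  by_contra h
  exact hy (hη.eq_zero _ (not_le.1 h).le)

theorem tsupport_comp_sub_subset_ball (hη : IsAveragingKernel η δ) {z : SpaceTime N}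
    (hz : ‖z‖ + δ < 1) : tsupport (fun y => η (z - y)) ⊆ Metric.ball 0 1 := by
  refine (hη.tsupport_comp_sub_subset z).trans fun y hy => ?_
  rw [mem_closedBall_iff_norm'] at hy
  rw [mem_ball_zero_iff]
  have := norm_le_norm_add_norm_sub z y
  linarith

theorem contDiff_average (hη : IsAveragingKernel η δ) (hs : ContDiff ℝ ∞ η)
    {f : SpaceTime N → ℝ} (hf : Integrable f) : ContDiff ℝ ∞ (average η f) :=
  hη.hasCompactSupport.contDiff_convolution_right (n := ⊤) _ hf.locallyIntegrable hs

theorem fderiv_average (hη : IsAveragingKernel η δ) (hs : ContDiff ℝ ∞ η)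
    {f : SpaceTime N → ℝ} (hf : Integrable f) (z e : SpaceTime N) :
    fderiv ℝ (average η f) z e = ∫ y, f y * fderiv ℝ η (z - y) e := by
  have h1 : ContDiff ℝ 1 η := hs.of_le (by exact_mod_cast le_top)
  rw [average, (hη.hasCompactSupport.hasFDerivAt_convolution_right
    (ContinuousLinearMap.mul ℝ ℝ) hf.locallyIntegrable h1 z).fderiv,
    convolution_precompR_apply _ hf.locallyIntegrable (hη.hasCompactSupport.fderiv ℝ)
      (h1.continuous_fderiv one_ne_zero)]
  rfl

theorem fderiv_comp_sub (hs : ContDiff ℝ ∞ η) (z y e : SpaceTime N) :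
    fderiv ℝ (fun y => η (z - y)) y e = -fderiv ℝ η (z - y) e := by
  have h1 : HasFDerivAt (fun y => z - y) (-ContinuousLinearMap.id ℝ (SpaceTime N)) y := by
    simpa using (hasFDerivAt_id y).const_sub z
  have h2 := ((hs.differentiable (by simp)) (z - y)).hasFDerivAt.comp y h1
  rw [show (fun y => η (z - y)) = η ∘ fun y => z - y from rfl, h2.fderiv]
  simp

/-- This form has `y ↦ η (z - y)` as the differentiated function, so that the weak formulations can
be tested with it. -/
theorem fderiv_average' (hη : IsAveragingKernel η δ) (hs : ContDiff ℝ ∞ η)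
    {f : SpaceTime N → ℝ} (hf : Integrable f) (z e : SpaceTime N) :
    fderiv ℝ (average η f) z e = -∫ y, f y * fderiv ℝ (fun y => η (z - y)) y e := by
  simp only [hη.fderiv_average hs hf, fderiv_comp_sub hs, mul_neg, integral_neg, neg_neg]

theorem integrable_mul_comp_sub (hη : IsAveragingKernel η δ) (hc : Continuous η)
    {f : SpaceTime N → ℝ} (hf : Integrable f) (z : SpaceTime N) :
    Integrable fun y => f y * η (z - y) := by
  obtain ⟨C, hC⟩ := hη.hasCompactSupport.exists_bound_of_continuous hc
  exact hf.mul_bdd (c := C) (by fun_prop) (ae_of_all _ fun y => hC _)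

theorem integral_comp_sub (hη : IsAveragingKernel η δ) (z : SpaceTime N) :
    ∫ y, η (z - y) = 1 := by
  rw [integral_sub_left_eq_self, hη.integral_eq_one]

theorem le_average (hη : IsAveragingKernel η δ) (hc : Continuous η)
    {f : SpaceTime N → ℝ} (hf : Integrable f) {c : ℝ}
    (hcf : ∀ᵐ z, z ∈ Metric.ball (0 : SpaceTime N) 1 → c ≤ f z) {z : SpaceTime N}
    (hz : ‖z‖ + δ < 1) : c ≤ average η f z := by
  calc c = ∫ y, c * η (z - y) := by rw [integral_const_mul, hη.integral_comp_sub, mul_one]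
    _ ≤ average η f z := by
      refine integral_mono_ae ((hη.integrable.comp_sub_left z).const_mul c)
        (hη.integrable_mul_comp_sub hc hf z) ?_
      filter_upwards [hcf] with y hy
      by_cases hyz : y ∈ Metric.ball (0 : SpaceTime N) 1
      · exact mul_le_mul_of_nonneg_right (hy hyz) (hη.nonneg _)
      · have : η (z - y) = 0 := image_eq_zero_of_notMem_tsupport
          (f := fun y => η (z - y)) fun h => hyz (hη.tsupport_comp_sub_subset_ball hz h)
        simp [this]

/-- Integrate the hypothesis against `η (z - x) η (z - y)`. It is needed because separate integrable
majorants for mollified flux and mollified gradient give none for their product; here Young's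
inequality supplies one through the mollified `|v|^p`. -/
theorem abs_average_mul_average_le (hη : IsAveragingKernel η δ) (hc : Continuous η)
    {f g F : SpaceTime N → ℝ} (hf : Integrable f) (hg : Integrable g) (hF : Integrable F)
    (h : ∀ x y, |f x| * |g y| ≤ F x + F y) (z : SpaceTime N) :
    |average η f z * average η g z| ≤ 2 * average η F z := by
  have hav : ∀ f : SpaceTime N → ℝ, |average η f z| ≤ average η (fun z => |f z|) z := by
    intro f
    refine abs_integral_le_integral_abs.trans_eq (integral_congr_ae (ae_of_all _ fun y => ?_))
    simp [abs_mul, abs_of_nonneg (hη.nonneg _)]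
  have hint : ∀ c : ℝ, Integrable fun y => c * η (z - y) := fun c =>
    (hη.integrable.comp_sub_left z).const_mul c
  have hone : ∀ c : ℝ, ∫ y, c * η (z - y) = c := fun c => by
    rw [integral_const_mul, hη.integral_comp_sub, mul_one]
  have h1 : ∀ y, average η (fun z => |f z|) z * |g y| ≤ average η F z + F y := by
    intro y
    calc average η (fun z => |f z|) z * |g y| = ∫ x, |f x| * η (z - x) * |g y| := by
          rw [integral_mul_const]; rfl
      _ ≤ ∫ x, (F x * η (z - x) + F y * η (z - x)) := by
          refine integral_mono ((hη.integrable_mul_comp_sub hc hf.abs z).mul_const _)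
            ((hη.integrable_mul_comp_sub hc hF z).add (hint _)) fun x => ?_
          have := mul_le_mul_of_nonneg_right (h x y) (hη.nonneg (z - x))
          simp only
          linarith
      _ = average η F z + F y := by
          rw [integral_add (hη.integrable_mul_comp_sub hc hF z) (hint _), hone]; rfl
  have h2 : average η (fun z => |f z|) z * average η (fun z => |g z|) z ≤
      2 * average η F z := by
    calc average η (fun z => |f z|) z * average η (fun z => |g z|) z
        = ∫ y, average η (fun z => |f z|) z * (|g y| * η (z - y)) := by
          rw [integral_const_mul]; rfl
      _ ≤ ∫ y, (average η F z * η (z - y) + F y * η (z - y)) := by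
          refine integral_mono ((hη.integrable_mul_comp_sub hc hg.abs z).const_mul _)
            ((hint _).add (hη.integrable_mul_comp_sub hc hF z)) fun y => ?_
          have := mul_le_mul_of_nonneg_right (h1 y) (hη.nonneg (z - y))
          simp only
          linarith
      _ = 2 * average η F z := by
          rw [integral_add (hint _) (hη.integrable_mul_comp_sub hc hF z), hone]
          change _ + average η F z = _
          ring
  rw [abs_mul]
  refine (mul_le_mul (hav f) (hav g) (abs_nonneg _) ?_).trans h2
  exact (abs_nonneg _).trans (hav f)

end IsAveragingKernel

theorem exists_smooth_averagingKernel (N : ℕ) :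
    ∃ (η : ℕ → SpaceTime N → ℝ) (δ : ℕ → ℝ), (∀ n, IsAveragingKernel (η n) (δ n)) ∧
      (∀ n, ContDiff ℝ ∞ (η n)) ∧ Tendsto δ atTop (𝓝 0) := by
  let b : ℕ → ContDiffBump (0 : SpaceTime N) := fun n =>
    ⟨1 / (n + 1) / 2, 1 / (n + 1), by positivity, half_lt_self (by positivity)⟩
  refine ⟨fun n => (b n).normed volume, fun n => 1 / (n + 1), fun n => ⟨(b n).nonneg_normed,
    (b n).integrable_normed, (b n).integral_normed, fun z hz => ?_⟩,
    fun n => (b n).contDiff_normed (n := ⊤), tendsto_one_div_add_atTop_nhds_zero_nat⟩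
  have := (b n).support_normed_eq (μ := volume)
  by_contra h
  have h1 : z ∈ Function.support ((b n).normed volume) := h
  rw [this, mem_ball_zero_iff] at h1
  exact absurd h1 (not_lt.2 hz)

/-- Smooth approximations of a super-solution: the `U n` are classical super-solutions of a
linear inequality with flux `F n`, and converge with domination. -/
structure IsSmoothApproximation (p : Fin N → ℝ) (u : SpaceTime N → ℝ)
    (v : Fin N → SpaceTime N → ℝ) (c : ℝ) (U : ℕ → SpaceTime N → ℝ)
    (V F : ℕ → Fin N → SpaceTime N → ℝ) (G : SpaceTime N → ℝ) : Prop where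
  contDiff_fun : ∀ n, ContDiff ℝ ∞ (U n)
  contDiff_grad : ∀ n i, ContDiff ℝ ∞ (V n i)
  contDiff_flux : ∀ n i, ContDiff ℝ ∞ (F n i)
  pointwise : ∀ r < 1, ∀ᶠ n in atTop, ∀ z : SpaceTime N, ‖z‖ ≤ r →
    c ≤ U n z ∧ (∀ i, partialSpace i (U n) z = V n i z) ∧
    ∑ i, partialSpace i (F n i) z ≤ partialTime (U n) z
  tendsto_fun : ∀ᵐ z, Tendsto (fun n => U n z) atTop (𝓝 (u z))
  tendsto_grad : ∀ i, ∀ᵐ z, Tendsto (fun n => V n i z) atTop (𝓝 (v i z))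
  tendsto_flux : ∀ i, ∀ᵐ z, Tendsto (fun n => F n i z) atTop (𝓝 (flux p v i z))
  integrable_bound : Integrable G
  bound : ∀ᵐ z, ∀ n i, |V n i z| ≤ G z ∧ |F n i z| ≤ G z ∧ |F n i z * V n i z| ≤ G z

/-- The weak derivative identity and the differential inequality are linear in `u`, `v` and the
flux. They become pointwise after convolution, wherever the translated kernel stays inside the unit
ball. -/
theorem IsUnitSuperSolution.exists_isSmoothApproximation {u : SpaceTime N → ℝ}
    {v : Fin N → SpaceTime N → ℝ} (h : IsUnitSuperSolution p u v) (hp : ∀ i, 2 < p i)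
    {c : ℝ} (hc : ∀ᵐ z, z ∈ Metric.ball (0 : SpaceTime N) 1 → c ≤ u z) :
    ∃ U V F G, IsSmoothApproximation p u v c U V F G := by
  obtain ⟨η, δ, hη, hs, hδ⟩ := exists_smooth_averagingKernel N
  -- All functions share one subsequence. The powers `|v i| ^ p i` are included only to dominate the
  -- products of flux and gradient, whence also the factor `2` in the majorant below.
  let f : Unit ⊕ (Fin N ⊕ Fin N ⊕ Fin N) → SpaceTime N → ℝ :=
    Sum.elim (fun _ => u) (Sum.elim v (Sum.elim (flux p v) fun i z => |v i z| ^ p i))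
  have hf : ∀ j, Integrable (f j) := by
    rintro (_ | i | i | i)
    exacts [h.integrable_fun, h.integrable_grad (hp i), h.integrable_flux (hp i),
      h.integrable_rpow i]
  obtain ⟨φ, hφ, hconv⟩ := exists_subseq_average_tendsto hf hη hδ
  choose hlim G hGi hG using hconv
  have hδφ : Tendsto (fun n => δ (φ n)) atTop (𝓝 0) := hδ.comp hφ.tendsto_atTop
  refine ⟨fun n => average (η (φ n)) u, fun n i => average (η (φ n)) (v i),
    fun n i => average (η (φ n)) (flux p v i), fun z => 2 * ∑ j, |G j z|, ?_, ?_, ?_, ?_, ?_, ?_,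
    ?_, ?_, ?_⟩
  · exact fun n => (hη _).contDiff_average (hs _) h.integrable_fun
  · exact fun n i => (hη _).contDiff_average (hs _) (h.integrable_grad (hp i))
  · exact fun n i => (hη _).contDiff_average (hs _) (h.integrable_flux (hp i))
  · intro r hr
    filter_upwards [hδφ.eventually (gt_mem_nhds (show 0 < 1 - r by linarith))] with n hn z hz
    have hz1 : ‖z‖ + δ (φ n) < 1 := by linarith
    have ht : ContDiff ℝ ∞ fun y => η (φ n) (z - y) :=
      (hs (φ n)).comp (contDiff_const.sub contDiff_id)
    have hts := (hη (φ n)).tsupport_comp_sub_subset_ball hz1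
    refine ⟨(hη _).le_average (hs _).continuous h.integrable_fun hc hz1, fun i => ?_, ?_⟩
    · rw [partialSpace, (hη _).fderiv_average' (hs _) h.integrable_fun]
      have := h.weakDeriv _ ht hts i
      simp only [partialSpace] at this
      rw [this, neg_neg]; rfl
    · have := h.superSolution _ ht (fun y => (hη _).nonneg _) hts
      have hd : ∀ (g : SpaceTime N → ℝ), Integrable g → ∀ e, Integrable fun y =>
          g y * fderiv ℝ (fun y => η (φ n) (z - y)) y e := by
        intro g hg e
        have hcomp : HasCompactSupport fun y => η (φ n) (z - y) :=
          (isCompact_closedBall _ _).of_isClosed_subset (isClosed_tsupport _)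
            ((hη (φ n)).tsupport_comp_sub_subset z)
        obtain ⟨C, hC⟩ := (hcomp.fderiv_apply ℝ e).exists_bound_of_continuous
          ((ht.continuous_fderiv (by simp)).clm_apply continuous_const)
        exact hg.mul_bdd (c := C) ((ht.continuous_fderiv (by simp)).clm_apply
          continuous_const).aestronglyMeasurable (ae_of_all _ hC)
      simp only [partialSpace, partialTime] at this ⊢
      rw [integral_add (by simpa using (hd u h.integrable_fun _).neg)
        (integrable_finsetSum _ fun i _ => hd _ (h.integrable_flux (hp i)) _),
        integral_finsetSum _ fun i _ => hd _ (h.integrable_flux (hp i)) _] at this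
      simp only [neg_mul, integral_neg] at this
      rw [(hη _).fderiv_average' (hs _) h.integrable_fun,
        Finset.sum_congr rfl fun i _ =>
          (hη _).fderiv_average' (hs _) (h.integrable_flux (hp i)) _ _, Finset.sum_neg_distrib]
      linarith
  · exact hlim (Sum.inl ())
  · exact fun i => hlim (Sum.inr (Sum.inl i))
  · exact fun i => hlim (Sum.inr (Sum.inr (Sum.inl i)))
  · exact (integrable_finsetSum _ fun j _ => (hGi j).abs).const_mul 2
  · filter_upwards [ae_all_iff.2 hG] with z hz n i
    have hle : ∀ j, |G j z| ≤ ∑ j, |G j z| := fun j =>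
      Finset.single_le_sum (f := fun j => |G j z|) (fun j _ => abs_nonneg _) (Finset.mem_univ j)
    have hle2 : ∀ j, |average (η (φ n)) (f j) z| ≤ ∑ j, |G j z| := fun j =>
      ((hz j n).trans (le_abs_self _)).trans (hle j)
    have h0 : 0 ≤ ∑ j, |G j z| := Finset.sum_nonneg fun j _ => abs_nonneg _
    refine ⟨?_, ?_, ?_⟩
    · have : |average (η (φ n)) (v i) z| ≤ _ := hle2 (Sum.inr (Sum.inl i))
      linarith
    · have : |average (η (φ n)) (flux p v i) z| ≤ _ := hle2 (Sum.inr (Sum.inr (Sum.inl i)))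
      linarith
    · refine ((hη _).abs_average_mul_average_le (hs _).continuous (h.integrable_flux (hp i))
        (h.integrable_grad (hp i)) (h.integrable_rpow i) (fun x y => ?_) z).trans ?_
      · rw [abs_flux v (hp i)]
        exact rpow_sub_one_mul_le (abs_nonneg _) (abs_nonneg _) (by linarith [hp i])
      · have : |average (η (φ n)) (fun z => |v i z| ^ p i) z| ≤ _ :=
          hle2 (Sum.inr (Sum.inr (Sum.inr i)))
        have := (le_abs_self _).trans this
        linarith

end Smoothing

/-! ### Powers of the positive part -/

section PositivePart

/-- From the second power on, the kink at zero is smoothed out to `C¹`: there the function is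
`O(|s|^{n+2})`. This is why squares and cubes of `(k - u)₊` are used, for which the chain rule is
classical. -/
theorem hasDerivAt_max_zero_pow (n : ℕ) (s : ℝ) :
    HasDerivAt (fun s : ℝ => max s 0 ^ (n + 2)) ((n + 2) * max s 0 ^ (n + 1)) s := by
  rcases lt_trichotomy s 0 with h | h | h
  · rw [max_eq_right h.le, zero_pow (by omega), mul_zero]
    refine (hasDerivAt_const s (0 : ℝ)).congr_of_eventuallyEq ?_
    filter_upwards [gt_mem_nhds h] with t ht
    rw [max_eq_right ht.le, zero_pow (by omega)]
  · subst h
    rw [max_self, zero_pow (by omega), mul_zero]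
    have : (fun s : ℝ => max s 0 ^ (n + 2)) =O[𝓝 0] fun s => ‖s - 0‖ ^ (n + 2) := by
      refine Asymptotics.IsBigO.of_bound 1 (Eventually.of_forall fun t => ?_)
      rw [sub_zero, one_mul, norm_pow, norm_pow, norm_norm]
      refine pow_le_pow_left₀ (norm_nonneg _) ?_ _
      rw [Real.norm_of_nonneg (le_max_right _ _), Real.norm_eq_abs]
      exact max_le (le_abs_self t) (abs_nonneg t)
    simpa using (this.hasFDerivAt (𝕜 := ℝ) (by omega)).hasDerivAt
  · rw [max_eq_left h.le]
    have h1 := hasDerivAt_pow (n + 2) s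
    simp only [Nat.cast_add, Nat.cast_ofNat, Nat.add_succ_sub_one] at h1
    refine h1.congr_of_eventuallyEq ?_
    filter_upwards [lt_mem_nhds h] with t ht
    rw [max_eq_left ht.le]

theorem contDiff_max_zero_pow (n : ℕ) : ContDiff ℝ 1 fun s : ℝ => max s 0 ^ (n + 2) := by
  rw [contDiff_one_iff_deriv]
  refine ⟨fun s => (hasDerivAt_max_zero_pow n s).differentiableAt, ?_⟩
  rw [funext fun s => (hasDerivAt_max_zero_pow n s).deriv]
  fun_prop

end PositivePart

/-! ### The energy inequality for smooth functions -/

section Slab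

variable {N : ℕ}

theorem integral_slab_partialTime {Φ : SpaceTime N → ℝ} (h : ContDiff ℝ 1 Φ)
    (hc : HasCompactSupport Φ) (τ : ℝ) :
    ∫ z in {z : SpaceTime N | z.2 ≤ τ}, partialTime Φ z = ∫ x, Φ (x, τ) := by
  have hcont : Continuous (partialTime Φ) :=
    (h.continuous_fderiv one_ne_zero).clm_apply continuous_const
  have hint : Integrable (partialTime Φ) :=
    hcont.integrable_of_hasCompactSupport (hc.fderiv_apply ℝ _)
  have hset : {z : SpaceTime N | z.2 ≤ τ} = Set.univ ×ˢ Set.Iic τ := by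
    ext z; simp
  rw [hset, Measure.volume_eq_prod, setIntegral_prod _ (by
    rw [← Measure.volume_eq_prod]; exact hint.integrableOn), Measure.restrict_univ]
  refine integral_congr_ae ?_
  have hae := Integrable.prod_right_ae (μ := (volume : Measure (Fin N → ℝ)))
    (ν := (volume : Measure ℝ)) hint
  filter_upwards [hae] with x hx
  obtain ⟨R, hR⟩ := hc.isCompact.isBounded.subset_closedBall 0
  have hlim : Tendsto (fun t => Φ (x, t)) atBot (𝓝 0) := by
    refine tendsto_const_nhds.congr' ?_
    filter_upwards [eventually_lt_atBot (-R), eventually_lt_atBot 0] with t ht ht0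
    refine (image_eq_zero_of_notMem_tsupport fun h' => ?_).symm
    have := mem_closedBall_zero_iff.1 (hR h')
    have h2 : ‖t‖ ≤ ‖((x, t) : SpaceTime N)‖ := norm_snd_le ((x, t) : SpaceTime N)
    rw [Real.norm_eq_abs, abs_of_neg ht0] at h2
    linarith
  have := integral_Iic_of_hasDerivAt_of_tendsto' (a := τ) (f := fun t => Φ (x, t))
    (f' := fun t => partialTime Φ (x, t)) (m := 0) (fun t _ => ?_) hx.integrableOn hlim
  · rw [this, sub_zero]
  · have h1 := ((h.differentiable one_ne_zero) (x, t)).hasFDerivAt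
    have h2 : HasDerivAt (fun t : ℝ => ((x, t) : SpaceTime N)) (0, 1) t :=
      (hasDerivAt_const t x).prodMk (hasDerivAt_id t)
    exact h1.comp_hasDerivAt t h2

theorem integral_slab_partialSpace {Φ : SpaceTime N → ℝ} (h : ContDiff ℝ 1 Φ)
    (hc : HasCompactSupport Φ) (τ : ℝ) (i : Fin N) :
    ∫ z in {z : SpaceTime N | z.2 ≤ τ}, partialSpace i Φ z = 0 := by
  have hcont : Continuous (partialSpace i Φ) :=
    (h.continuous_fderiv one_ne_zero).clm_apply continuous_const
  have hint : Integrable (partialSpace i Φ) :=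
    hcont.integrable_of_hasCompactSupport (hc.fderiv_apply ℝ _)
  have hset : {z : SpaceTime N | z.2 ≤ τ} = Set.univ ×ˢ Set.Iic τ := by
    ext z; simp
  rw [hset, Measure.volume_eq_prod, ← setIntegral_prod_swap, setIntegral_prod]
  swap
  · rw [← Measure.volume_eq_prod] at *
    exact hint.swap.integrableOn
  refine setIntegral_eq_zero_of_forall_eq_zero fun t _ => ?_
  rw [Measure.restrict_univ]
  have hcl : Topology.IsClosedEmbedding fun x : Fin N → ℝ => ((x, t) : SpaceTime N) := by
    refine ⟨Topology.IsEmbedding.of_leftInverse (f := Prod.fst) (fun _ => rfl) continuous_fst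
      (by fun_prop), ?_⟩
    have : Set.range (fun x : Fin N → ℝ => ((x, t) : SpaceTime N)) = {z | z.2 = t} := by
      ext z
      exact ⟨fun ⟨x, hx⟩ => by rw [← hx]; rfl, fun hz => ⟨z.1, Prod.ext rfl hz.symm⟩⟩
    rw [this]
    exact isClosed_eq continuous_snd continuous_const
  have hg : ContDiff ℝ 1 fun x => Φ (x, t) := h.comp (contDiff_id.prodMk contDiff_const)
  have hgc : HasCompactSupport fun x => Φ (x, t) := hc.comp_isClosedEmbedding hcl
  have hfd : ∀ x, partialSpace i Φ (x, t) = fderiv ℝ (fun x => Φ (x, t)) x (Pi.single i 1) := by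
    intro x
    have h1 := ((h.differentiable one_ne_zero) (x, t)).hasFDerivAt
    have h2 : HasFDerivAt (fun x : Fin N → ℝ => ((x, t) : SpaceTime N))
        ((ContinuousLinearMap.id ℝ _).prod 0) x := (hasFDerivAt_id x).prodMk (hasFDerivAt_const t x)
    have h3 := (h1.comp x h2).fderiv
    rw [show (fun x => Φ (x, t)) = Φ ∘ fun x => (x, t) from rfl, h3]
    rfl
  -- Integration by parts against the constant function `1`.
  have key := integral_mul_fderiv_eq_neg_fderiv_mul_of_integrable (μ := volume)
    (f := fun _ : Fin N → ℝ => (1 : ℝ)) (g := fun x => Φ (x, t)) (v := Pi.single i 1)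
    (by simp) (by
      simpa using ((hg.continuous_fderiv one_ne_zero).clm_apply
        continuous_const).integrable_of_hasCompactSupport (hgc.fderiv_apply ℝ _))
    (by simpa using hg.continuous.integrable_of_hasCompactSupport hgc)
    (by simp) (fun x _ => (hg.differentiable one_ne_zero) x)
  simp only [Prod.swap_prod_mk, hfd]
  simpa using key

theorem partialSpace_mul {f g : SpaceTime N → ℝ} {z : SpaceTime N} (i : Fin N)
    (hf : DifferentiableAt ℝ f z) (hg : DifferentiableAt ℝ g z) :
    partialSpace i (fun z => f z * g z) z =
      partialSpace i f z * g z + f z * partialSpace i g z := by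
  simp only [partialSpace, fderiv_fun_mul hf hg]
  simp
  ring

theorem partialTime_mul {f g : SpaceTime N → ℝ} {z : SpaceTime N}
    (hf : DifferentiableAt ℝ f z) (hg : DifferentiableAt ℝ g z) :
    partialTime (fun z => f z * g z) z = partialTime f z * g z + f z * partialTime g z := by
  simp only [partialTime, fderiv_fun_mul hf hg]
  simp
  ring

theorem hasFDerivAt_max_sub_pow {U : SpaceTime N → ℝ} {z : SpaceTime N}
    (hU : DifferentiableAt ℝ U z) (k : ℝ) (n : ℕ) :
    HasFDerivAt (fun z => max (k - U z) 0 ^ (n + 2))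
      (((n + 2) * max (k - U z) 0 ^ (n + 1)) • -fderiv ℝ U z) z := by
  have h1 := hasDerivAt_max_zero_pow n (k - U z)
  exact h1.comp_hasFDerivAt (f := fun z => k - U z) z (hU.hasFDerivAt.const_sub k)

theorem contDiff_max_sub_pow {U : SpaceTime N → ℝ} (hU : ContDiff ℝ 1 U) (k : ℝ) (n : ℕ) :
    ContDiff ℝ 1 fun z => max (k - U z) 0 ^ (n + 2) :=
  (contDiff_max_zero_pow n).comp (contDiff_const.sub hU)

/-- The energy inequality on `{t ≤ τ}` for a smooth super-solution of a linear inequality. -/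
theorem integral_slice_le_integral_slab {U ζ : SpaceTime N → ℝ} {F V : Fin N → SpaceTime N → ℝ}
    (hU : ContDiff ℝ 1 U) (hF : ∀ i, ContDiff ℝ 1 (F i)) (hV : ∀ i, Continuous (V i))
    (hζ : ContDiff ℝ 1 ζ) (hζc : HasCompactSupport ζ) (hζ0 : ∀ z, 0 ≤ ζ z)
    (h : ∀ z ∈ tsupport ζ, (∀ i, partialSpace i U z = V i z) ∧
      ∑ i, partialSpace i (F i) z ≤ partialTime U z) (k τ : ℝ) :
    1 / 3 * ∫ x, max (k - U (x, τ)) 0 ^ 3 * ζ (x, τ) ≤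
      ∫ z in {z : SpaceTime N | z.2 ≤ τ}, (1 / 3 * max (k - U z) 0 ^ 3 * partialTime ζ z +
        ∑ i, F i z * (max (k - U z) 0 ^ 2 * partialSpace i ζ z -
          2 * max (k - U z) 0 * ζ z * V i z)) := by
  have hd : ∀ {f : SpaceTime N → ℝ}, ContDiff ℝ 1 f → ∀ z, DifferentiableAt ℝ f z :=
    fun hf z => (hf.differentiable one_ne_zero) z
  have hθ2 := contDiff_max_sub_pow hU k 0
  have hθ3 := contDiff_max_sub_pow hU k 1
  simp only [zero_add, Nat.reduceAdd] at hθ2 hθ3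
  -- Multiplying the inequality by `(k - U)₊² ζ`, the time term is `-1/3` of the time derivative of
  -- `Φ` up to `∂_t ζ`, and the flux term is the divergence of `Ψ` up to lower derivatives.
  set Φ : SpaceTime N → ℝ := fun z => max (k - U z) 0 ^ 3 * ζ z with hΦ
  set Ψ : Fin N → SpaceTime N → ℝ := fun i z => F i z * (max (k - U z) 0 ^ 2 * ζ z) with hΨ
  have hΦs : ContDiff ℝ 1 Φ := hθ3.mul hζ
  have hΦc : HasCompactSupport Φ := hζc.mul_left
  have hΨs : ∀ i, ContDiff ℝ 1 (Ψ i) := fun i => (hF i).mul (hθ2.mul hζ)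
  have hΨc : ∀ i, HasCompactSupport (Ψ i) := fun i => (hζc.mul_left).mul_left
  have hζx : ∀ i, HasCompactSupport (partialSpace i ζ) := fun i => hζc.fderiv_apply ℝ _
  have hζt : HasCompactSupport (partialTime ζ) := hζc.fderiv_apply ℝ _
  have hζxc : ∀ i, Continuous (partialSpace i ζ) := fun i =>
    (hζ.continuous_fderiv one_ne_zero).clm_apply continuous_const
  have hζtc : Continuous (partialTime ζ) :=
    (hζ.continuous_fderiv one_ne_zero).clm_apply continuous_const
  have hUc := hU.continuous
  have hζcont := hζ.continuous
  have hint1 : Integrable fun z => 1 / 3 * max (k - U z) 0 ^ 3 * partialTime ζ z :=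
    Continuous.integrable_of_hasCompactSupport (by fun_prop) hζt.mul_left
  have hint2 : ∀ i, Integrable fun z => F i z * (max (k - U z) 0 ^ 2 * partialSpace i ζ z -
      2 * max (k - U z) 0 * ζ z * V i z) := fun i => by
    have h1 := (hF i).continuous
    have h2 := hV i
    have h3 := hζxc i
    have i1 : Integrable fun z => F i z * (max (k - U z) 0 ^ 2 * partialSpace i ζ z) :=
      Continuous.integrable_of_hasCompactSupport (by fun_prop) ((hζx i).mul_left).mul_left
    have i2 : Integrable fun z => F i z * V i z * 2 * max (k - U z) 0 * ζ z :=
      Continuous.integrable_of_hasCompactSupport (by fun_prop) hζc.mul_left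
    exact (i1.sub i2).congr (ae_of_all _ fun z => by simp only [Pi.sub_apply]; ring)
  have hΦi : Integrable (partialTime Φ) :=
    ((hΦs.continuous_fderiv one_ne_zero).clm_apply
      continuous_const).integrable_of_hasCompactSupport (hΦc.fderiv_apply ℝ _)
  have hΨi : ∀ i, Integrable (partialSpace i (Ψ i)) := fun i =>
    (((hΨs i).continuous_fderiv one_ne_zero).clm_apply
      continuous_const).integrable_of_hasCompactSupport ((hΨc i).fderiv_apply ℝ _)
  rw [show ∫ x, max (k - U (x, τ)) 0 ^ 3 * ζ (x, τ) = ∫ x, Φ (x, τ) from rfl,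
    ← integral_slab_partialTime hΦs hΦc τ]
  have hsum : ∫ z in {z : SpaceTime N | z.2 ≤ τ}, ∑ i, partialSpace i (Ψ i) z = 0 := by
    rw [integral_finsetSum _ fun i _ => (hΨi i).integrableOn]
    exact Finset.sum_eq_zero fun i _ => integral_slab_partialSpace (hΨs i) (hΨc i) τ i
  -- The divergence integrates to zero, so adding it is free and leaves a pointwise inequality to
  -- prove.
  have hL : 1 / 3 * ∫ z in {z : SpaceTime N | z.2 ≤ τ}, partialTime Φ z =
      ∫ z in {z : SpaceTime N | z.2 ≤ τ},
        (1 / 3 * partialTime Φ z + ∑ i, partialSpace i (Ψ i) z) := by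
    rw [integral_add (hΦi.integrableOn.const_mul _)
      (integrable_finsetSum _ fun i _ => (hΨi i).integrableOn), hsum, add_zero,
      integral_const_mul]
  rw [hL]
  refine integral_mono ((hΦi.integrableOn.const_mul _).add
      (integrable_finsetSum _ fun i _ => (hΨi i).integrableOn))
    (hint1.add (integrable_finsetSum _ fun i _ => hint2 i)).integrableOn fun z => ?_
  have e1 : partialTime Φ z = -3 * max (k - U z) 0 ^ 2 * partialTime U z * ζ z +
      max (k - U z) 0 ^ 3 * partialTime ζ z := by
    rw [hΦ, partialTime_mul (hd hθ3 z) (hd hζ z)]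
    have := (hasFDerivAt_max_sub_pow (hd hU z) k 1).fderiv
    simp only [Nat.reduceAdd] at this
    simp only [partialTime, this, FunLike.coe_smul, FunLike.coe_neg, Pi.smul_apply,
      Pi.neg_apply, smul_eq_mul]
    push_cast
    ring
  have e2 : ∀ i, partialSpace i (Ψ i) z = partialSpace i (F i) z * (max (k - U z) 0 ^ 2 * ζ z) +
      F i z * (-2 * max (k - U z) 0 * partialSpace i U z * ζ z +
        max (k - U z) 0 ^ 2 * partialSpace i ζ z) := fun i => by
    rw [hΨ]
    rw [partialSpace_mul i (hd (hF i) z) (hd (hθ2.mul hζ) z), partialSpace_mul i (hd hθ2 z) (hd hζ z)]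
    have := (hasFDerivAt_max_sub_pow (hd hU z) k 0).fderiv
    simp only [zero_add] at this
    simp only [partialSpace, this, FunLike.coe_smul, FunLike.coe_neg, Pi.smul_apply,
      Pi.neg_apply, smul_eq_mul]
    push_cast
    ring
  simp only [e1, e2]
  by_cases hz : z ∈ tsupport ζ
  · obtain ⟨h1, h2⟩ := h z hz
    simp only [h1]
    have h3 : 0 ≤ max (k - U z) 0 ^ 2 * ζ z := mul_nonneg (by positivity) (hζ0 z)
    have h4 := mul_le_mul_of_nonneg_right h2 h3
    rw [Finset.sum_mul] at h4
    have h5 : ∑ i, (partialSpace i (F i) z * (max (k - U z) 0 ^ 2 * ζ z) +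
        F i z * (-2 * max (k - U z) 0 * V i z * ζ z +
          max (k - U z) 0 ^ 2 * partialSpace i ζ z)) =
        ∑ i, partialSpace i (F i) z * (max (k - U z) 0 ^ 2 * ζ z) +
        ∑ i, F i z * (max (k - U z) 0 ^ 2 * partialSpace i ζ z -
          2 * max (k - U z) 0 * ζ z * V i z) := by
      rw [← Finset.sum_add_distrib]
      exact Finset.sum_congr rfl fun i _ => by ring
    rw [h5]
    linarith
  · have h1 : ζ z = 0 := image_eq_zero_of_notMem_tsupport hz
    simp only [h1]
    refine le_of_eq ?_
    congr 1
    · ring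
    · exact Finset.sum_congr rfl fun i _ => by ring

end Slab

/-! ### The energy estimate for super-solutions -/

section Energy

variable {N : ℕ} {p : Fin N → ℝ}

theorem ae_ae_slice {P : SpaceTime N → Prop} (h : ∀ᵐ z, P z) : ∀ᵐ t : ℝ, ∀ᵐ x, P (x, t) := by
  have h1 : ∀ᵐ q ∂((volume : Measure ℝ).prod (volume : Measure (Fin N → ℝ))), P q.swap :=
    Measure.measurePreserving_swap.quasiMeasurePreserving.ae h
  exact Measure.ae_ae_of_ae_prod h1

theorem partialTime_eq_zero_of_notMem_tsupport {ζ : SpaceTime N → ℝ} {z : SpaceTime N}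
    (hz : z ∉ tsupport ζ) : partialTime ζ z = 0 := by
  have := image_eq_zero_of_notMem_tsupport fun h => hz (tsupport_fderiv_subset ℝ h)
  rw [partialTime, this]; rfl

theorem partialSpace_eq_zero_of_notMem_tsupport {ζ : SpaceTime N → ℝ} {z : SpaceTime N}
    (hz : z ∉ tsupport ζ) (i : Fin N) : partialSpace i ζ z = 0 := by
  have := image_eq_zero_of_notMem_tsupport fun h => hz (tsupport_fderiv_subset ℝ h)
  rw [partialSpace, this]; rfl

/-- Spatial cutoff functions compatible with the exponents `p`. -/
structure IsCutoff (p : Fin N → ℝ) (ζ : SpaceTime N → ℝ) (r D : ℝ) : Prop where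
  lt_one : r < 1
  contDiff : ContDiff ℝ 1 ζ
  tsupport_subset : tsupport ζ ⊆ Metric.closedBall 0 r
  nonneg : ∀ z, 0 ≤ ζ z
  le_one : ∀ z, ζ z ≤ 1
  bound_nonneg : 0 ≤ D
  abs_partialTime_le : ∀ z, |partialTime ζ z| ≤ D
  abs_partialSpace_le : ∀ i z, |partialSpace i ζ z| ≤ D * ζ z ^ ((p i - 1) / p i)

namespace IsCutoff

variable {ζ : SpaceTime N → ℝ} {r D : ℝ}

theorem hasCompactSupport (h : IsCutoff p ζ r D) : HasCompactSupport ζ :=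
  (isCompact_closedBall _ _).of_isClosed_subset (isClosed_tsupport ζ) h.tsupport_subset

theorem continuous_partialTime (h : IsCutoff p ζ r D) : Continuous (partialTime ζ) :=
  (h.contDiff.continuous_fderiv one_ne_zero).clm_apply continuous_const

theorem continuous_partialSpace (h : IsCutoff p ζ r D) (i : Fin N) :
    Continuous (partialSpace i ζ) :=
  (h.contDiff.continuous_fderiv one_ne_zero).clm_apply continuous_const

theorem abs_partialSpace_le' (h : IsCutoff p ζ r D) (hp : ∀ i, 2 < p i) (i : Fin N)
    (z : SpaceTime N) : |partialSpace i ζ z| ≤ D := by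
  refine (h.abs_partialSpace_le i z).trans (mul_le_of_le_one_right h.bound_nonneg ?_)
  have := hp i
  exact Real.rpow_le_one (h.nonneg z) (h.le_one z) (div_nonneg (by linarith) (by linarith))

theorem norm_le_of_mem_tsupport (h : IsCutoff p ζ r D) {z : SpaceTime N} (hz : z ∈ tsupport ζ) :
    ‖z‖ ≤ r := mem_closedBall_zero_iff.1 (h.tsupport_subset hz)

end IsCutoff

variable {u ζ G : SpaceTime N → ℝ} {v : Fin N → SpaceTime N → ℝ} {c k r D : ℝ}
  {U : ℕ → SpaceTime N → ℝ} {V F : ℕ → Fin N → SpaceTime N → ℝ}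

theorem IsSmoothApproximation.eventually_max_le
    (h : IsSmoothApproximation p u v c U V F G) (hζ : IsCutoff p ζ r D) (hck : c ≤ k) :
    ∀ᶠ n in atTop, ∀ z ∈ tsupport ζ, max (k - U n z) 0 ≤ k - c := by
  filter_upwards [h.pointwise r hζ.lt_one] with n hn z hz
  have := (hn z (hζ.norm_le_of_mem_tsupport hz)).1
  exact max_le (by linarith) (by linarith)

theorem abs_mul_sub_le {f b θ ζ w L D : ℝ} (hθ : 0 ≤ θ) (hθL : θ ≤ L) (hζ : 0 ≤ ζ)
    (hζ1 : ζ ≤ 1) (hb : |b| ≤ D) :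
    |f * (θ ^ 2 * b - 2 * θ * ζ * w)| ≤ |f| * (L ^ 2 * D) + |f * w| * (2 * L) := by
  have hD : 0 ≤ D := (abs_nonneg b).trans hb
  have hL : 0 ≤ L := hθ.trans hθL
  rw [show f * (θ ^ 2 * b - 2 * θ * ζ * w) = f * (θ ^ 2 * b) - f * w * (2 * θ * ζ) by ring]
  refine (abs_sub _ _).trans (add_le_add ?_ ?_)
  · rw [abs_mul, abs_mul, abs_of_nonneg (by positivity : 0 ≤ θ ^ 2)]
    gcongr
  · rw [abs_mul, abs_of_nonneg (by positivity : 0 ≤ 2 * θ * ζ)]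
    refine mul_le_mul_of_nonneg_left ?_ (abs_nonneg _)
    calc 2 * θ * ζ ≤ 2 * L * 1 := by gcongr
      _ = 2 * L := mul_one _

/-- On the support of `ζ` the truncations are eventually at most `k - c`, and both the fluxes and
their products with gradients are dominated by `G`. Convergence on the slice `t = τ` comes from
Fubini, hence only almost every `τ`. -/
theorem IsSmoothApproximation.energy (h : IsSmoothApproximation p u v c U V F G)
    (hζ : IsCutoff p ζ r D) (hp : ∀ i, 2 < p i) (hck : c ≤ k) :
    ∀ᵐ τ : ℝ, 1 / 3 * ∫ x, max (k - u (x, τ)) 0 ^ 3 * ζ (x, τ) ≤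
      ∫ z in {z : SpaceTime N | z.2 ≤ τ}, (1 / 3 * max (k - u z) 0 ^ 3 * partialTime ζ z +
        ∑ i, flux p v i z * (max (k - u z) 0 ^ 2 * partialSpace i ζ z -
          2 * max (k - u z) 0 * ζ z * v i z)) := by
  have hL : 0 ≤ k - c := by linarith
  have hUc := fun n => (h.contDiff_fun n).continuous
  have hVc := fun n i => (h.contDiff_grad n i).continuous
  have hFc := fun n i => (h.contDiff_flux n i).continuous
  have hζc := hζ.contDiff.continuous
  have hζt := hζ.continuous_partialTime
  have hζx := hζ.continuous_partialSpace
  filter_upwards [ae_ae_slice h.tendsto_fun] with τ hτ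
  have hev := h.eventually_max_le hζ hck
  refine le_of_tendsto_of_tendsto (b := (atTop : Filter ℕ))
    (f := fun n => 1 / 3 * ∫ x, max (k - U n (x, τ)) 0 ^ 3 * ζ (x, τ))
    (g := fun n => ∫ z in {z : SpaceTime N | z.2 ≤ τ},
      (1 / 3 * max (k - U n z) 0 ^ 3 * partialTime ζ z +
        ∑ i, F n i z * (max (k - U n z) 0 ^ 2 * partialSpace i ζ z -
          2 * max (k - U n z) 0 * ζ z * V n i z))) ?_ ?_ ?_
  · refine Tendsto.const_mul _ ?_
    refine tendsto_integral_filter_of_dominated_convergence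
      (fun x => (k - c) ^ 3 * (Metric.closedBall (0 : Fin N → ℝ) r).indicator (fun _ => 1) x)
      ?_ ?_ ?_ ?_
    · refine Eventually.of_forall fun n => Continuous.aestronglyMeasurable ?_
      have := hUc n
      fun_prop
    · filter_upwards [hev] with n hn
      refine ae_of_all _ fun x => ?_
      by_cases hx : ((x, τ) : SpaceTime N) ∈ tsupport ζ
      · have hx1 : x ∈ Metric.closedBall (0 : Fin N → ℝ) r := by
          rw [mem_closedBall_zero_iff]
          exact (norm_fst_le ((x, τ) : SpaceTime N)).trans (hζ.norm_le_of_mem_tsupport hx)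
        rw [Set.indicator_of_mem hx1, Real.norm_of_nonneg (mul_nonneg (by positivity) (hζ.nonneg _))]
        exact mul_le_mul (pow_le_pow_left₀ (le_max_right _ _) (hn _ hx) 3) (hζ.le_one _)
          (hζ.nonneg _) (by positivity)
      · rw [image_eq_zero_of_notMem_tsupport hx, mul_zero, norm_zero]
        exact mul_nonneg (by positivity) (Set.indicator_nonneg (fun _ _ => zero_le_one) _)
    · exact ((integrable_indicator_iff Metric.isClosed_closedBall.measurableSet).2
        (integrableOn_const (isCompact_closedBall _ _).measure_ne_top)).const_mul _
    · filter_upwards [hτ] with x hx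
      exact (((tendsto_const_nhds.sub hx).max tendsto_const_nhds).pow 3).mul tendsto_const_nhds
  · refine tendsto_integral_filter_of_dominated_convergence
      (fun z => 1 / 3 * (k - c) ^ 3 * |partialTime ζ z| +
        ∑ _i : Fin N, |G z| * ((k - c) ^ 2 * D + 2 * (k - c))) ?_ ?_ ?_ ?_
    · refine Eventually.of_forall fun n => Continuous.aestronglyMeasurable ?_
      have := hUc n
      have := hVc n
      have := hFc n
      fun_prop
    · filter_upwards [hev] with n hn
      filter_upwards [ae_restrict_of_ae h.bound] with z hz
      have hnn : ∀ i : Fin N, 0 ≤ |G z| * ((k - c) ^ 2 * D + 2 * (k - c)) := fun i =>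
        mul_nonneg (abs_nonneg _) (add_nonneg (mul_nonneg (by positivity) hζ.bound_nonneg)
          (by linarith))
      by_cases hzs : z ∈ tsupport ζ
      · have hθ := hn z hzs
        have hθ0 : 0 ≤ max (k - U n z) 0 := le_max_right _ _
        rw [Real.norm_eq_abs]
        refine (abs_add_le _ _).trans (add_le_add ?_ ((Finset.abs_sum_le_sum_abs _ _).trans
          (Finset.sum_le_sum fun i _ => ?_)))
        · rw [abs_mul, abs_of_nonneg (by positivity : 0 ≤ 1 / 3 * max (k - U n z) 0 ^ 3)]
          gcongr
        · obtain ⟨h1, h2, h3⟩ := hz n i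
          have hD := hζ.bound_nonneg
          refine (abs_mul_sub_le hθ0 hθ (hζ.nonneg z) (hζ.le_one z)
            (hζ.abs_partialSpace_le' hp i z)).trans ?_
          rw [mul_add]
          exact add_le_add
            (mul_le_mul_of_nonneg_right (h2.trans (le_abs_self _)) (by positivity))
            (mul_le_mul_of_nonneg_right (h3.trans (le_abs_self _)) (by positivity))
      · simp only [image_eq_zero_of_notMem_tsupport hzs,
          partialTime_eq_zero_of_notMem_tsupport hzs, partialSpace_eq_zero_of_notMem_tsupport hzs]
        simp only [mul_zero, zero_mul, sub_zero, Finset.sum_const_zero, add_zero, norm_zero,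
          abs_zero, zero_add]
        exact Finset.sum_nonneg fun i _ => hnn i
    · refine Integrable.add ?_ ?_
      · exact ((hζt.integrable_of_hasCompactSupport
          (hζ.hasCompactSupport.fderiv_apply ℝ _)).abs.const_mul _).integrableOn
      · exact integrable_finsetSum _ fun i _ => (h.integrable_bound.abs.mul_const _).integrableOn
    · filter_upwards [ae_restrict_of_ae h.tendsto_fun,
        ae_restrict_of_ae (ae_all_iff.2 h.tendsto_grad),
        ae_restrict_of_ae (ae_all_iff.2 h.tendsto_flux)] with z h1 h2 h3
      have hθ := (tendsto_const_nhds (x := k)).sub h1 |>.max (tendsto_const_nhds (x := (0 : ℝ)))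
      exact ((hθ.pow 3).const_mul _ |>.mul_const _).add (tendsto_finsetSum _ fun i _ =>
        (h3 i).mul (((hθ.pow 2).mul_const _).sub (((hθ.const_mul 2).mul_const _).mul (h2 i))))
  · filter_upwards [h.pointwise r hζ.lt_one] with n hn
    exact integral_slice_le_integral_slab ((h.contDiff_fun n).of_le (by simp))
      (fun i => (h.contDiff_flux n i).of_le (by simp)) (hVc n) hζ.contDiff hζ.hasCompactSupport
      hζ.nonneg (fun z hz => (hn z (hζ.norm_le_of_mem_tsupport hz)).2) k τ

/-- Young's inequality for `a ζ^{1/q}` and `θ D`. The exponent `(q - 1) / q` in the cutoff bound is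
what makes the first term carry exactly `ζ`, so that it can be absorbed by the coercive term. -/
theorem flux_mul_le {a b q θ ζ D : ℝ} (hq : 2 < q) (hθ : 0 ≤ θ) (hζ : 0 ≤ ζ)
    (hD : 0 ≤ D) (ha : 0 ≤ a) (hb : |b| ≤ D * ζ ^ ((q - 1) / q)) :
    a ^ (q - 1) * (θ ^ 2 * |b|) ≤ θ * ζ * a ^ q + θ * (θ * D) ^ q := by
  have h1 := rpow_sub_one_mul_le (a := a * ζ ^ (1 / q)) (b := θ * D) (q := q) (by positivity)
    (by positivity) (by linarith)
  rw [Real.mul_rpow ha (by positivity), Real.mul_rpow ha (by positivity), ← Real.rpow_mul hζ,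
    ← Real.rpow_mul hζ, one_div_mul_cancel (by linarith), Real.rpow_one,
    one_div_mul_eq_div] at h1
  calc a ^ (q - 1) * (θ ^ 2 * |b|) ≤ a ^ (q - 1) * (θ ^ 2 * (D * ζ ^ ((q - 1) / q))) := by gcongr
    _ = θ * (a ^ (q - 1) * ζ ^ ((q - 1) / q) * (θ * D)) := by ring
    _ ≤ θ * (a ^ q * ζ + (θ * D) ^ q) := by gcongr
    _ = _ := by ring

/-- The constant in the energy estimate for `0 ≤ (k - u)₊ ≤ L` and cutoffs of slope `D`. -/
noncomputable def energyConst (p : Fin N → ℝ) (L D : ℝ) : ℝ :=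
  1 / 3 * L ^ 3 * D + ∑ i, L * (L * D) ^ p i

theorem energyConst_nonneg {L D : ℝ} (hL : 0 ≤ L) (hD : 0 ≤ D) : 0 ≤ energyConst p L D :=
  add_nonneg (by positivity) (Finset.sum_nonneg fun i _ => by positivity)

/-- The energy inequality contains `2 (k - u)₊ ζ |v i| ^ p i` with the good sign. One copy absorbs
the term from Young's inequality, the other remains on the left, and the rest is a constant
supported in `A`. -/
theorem IsSmoothApproximation.caccioppoli (h : IsSmoothApproximation p u v c U V F G)
    (hsup : IsUnitSuperSolution p u v)
    (hc : ∀ᵐ z, z ∈ Metric.ball (0 : SpaceTime N) 1 → c ≤ u z)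
    (hζ : IsCutoff p ζ r D) (hp : ∀ i, 2 < p i) (hck : c ≤ k)
    {A : Set (SpaceTime N)} (hA : NullMeasurableSet A) (hAfin : volume A ≠ ⊤)
    (hζA : ∀ z ∈ tsupport ζ, u z < k → z ∈ A) :
    (∀ᵐ τ : ℝ, ∫ x, max (k - u (x, τ)) 0 ^ 3 * ζ (x, τ) ≤
      3 * energyConst p (k - c) D * volume.real A) ∧
    Integrable (fun z => ∑ i, max (k - u z) 0 * ζ z * |v i z| ^ p i) ∧
    ∫ z, ∑ i, max (k - u z) 0 * ζ z * |v i z| ^ p i ≤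
      energyConst p (k - c) D * volume.real A := by
  set K := energyConst p (k - c) D with hK
  have hL : 0 ≤ k - c := by linarith
  have hK0 : 0 ≤ K := energyConst_nonneg hL hζ.bound_nonneg
  have hum : AEStronglyMeasurable u volume := hsup.integrable_fun.aestronglyMeasurable
  have hθm : AEStronglyMeasurable (fun z => max (k - u z) 0) volume :=
    ((aemeasurable_const.sub hum.aemeasurable).max aemeasurable_const).aestronglyMeasurable
  have hA' : NullMeasurableSet A := hA
  have hbd : ∀ᵐ z, z ∈ tsupport ζ → max (k - u z) 0 ≤ k - c := by
    filter_upwards [hc] with z hz hzs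
    have := hz (mem_ball_zero_iff.2 ((hζ.norm_le_of_mem_tsupport hzs).trans_lt hζ.lt_one))
    exact max_le (by linarith) hL
  have hg : Integrable fun z => ∑ i, max (k - u z) 0 * ζ z * |v i z| ^ p i := by
    refine integrable_finsetSum _ fun i _ => ?_
    refine ((hsup.integrable_rpow i).bdd_mul (c := k - c)
      (hθm.mul hζ.contDiff.continuous.aestronglyMeasurable) ?_)
    filter_upwards [hbd] with z hz
    change ‖max (k - u z) 0 * ζ z‖ ≤ _
    by_cases hzs : z ∈ tsupport ζ
    · rw [Real.norm_of_nonneg (mul_nonneg (le_max_right _ _) (hζ.nonneg z))]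
      calc max (k - u z) 0 * ζ z ≤ (k - c) * 1 :=
            mul_le_mul (hz hzs) (hζ.le_one z) (hζ.nonneg z) hL
        _ = k - c := mul_one _
    · rw [image_eq_zero_of_notMem_tsupport hzs, mul_zero, norm_zero]; exact hL
  have hKA : Integrable (A.indicator fun _ => K) :=
    IntegrableOn.integrable_indicator₀ (integrableOn_const hAfin) hA'
  have hpt : ∀ᵐ z, 1 / 3 * max (k - u z) 0 ^ 3 * partialTime ζ z +
        ∑ i, flux p v i z * (max (k - u z) 0 ^ 2 * partialSpace i ζ z -
          2 * max (k - u z) 0 * ζ z * v i z) ≤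
      A.indicator (fun _ => K) z - ∑ i, max (k - u z) 0 * ζ z * |v i z| ^ p i := by
    filter_upwards [hbd] with z hz
    by_cases hzs : z ∈ tsupport ζ
    · by_cases huk : u z < k
      · rw [Set.indicator_of_mem (hζA z hzs huk), hK, energyConst, add_sub_assoc,
          ← Finset.sum_sub_distrib]
        have hθ := hz hzs
        have hθ0 : 0 ≤ max (k - u z) 0 := le_max_right _ _
        have hDn := hζ.bound_nonneg
        refine add_le_add ?_ (Finset.sum_le_sum fun i _ => ?_)
        · calc 1 / 3 * max (k - u z) 0 ^ 3 * partialTime ζ z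
                ≤ 1 / 3 * max (k - u z) 0 ^ 3 * D := by
                gcongr; exact (le_abs_self _).trans (hζ.abs_partialTime_le z)
            _ ≤ 1 / 3 * (k - c) ^ 3 * D := by gcongr
        · have h1 := flux_mul_le (hp i) hθ0 (hζ.nonneg z) hζ.bound_nonneg (abs_nonneg (v i z))
            (hζ.abs_partialSpace_le i z)
          have h2 : flux p v i z * (max (k - u z) 0 ^ 2 * partialSpace i ζ z) ≤
              |v i z| ^ (p i - 1) * (max (k - u z) 0 ^ 2 * |partialSpace i ζ z|) := by
            rw [← abs_flux v (hp i)]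
            refine (le_abs_self _).trans_eq ?_
            rw [abs_mul, abs_mul, abs_of_nonneg (by positivity : 0 ≤ max (k - u z) 0 ^ 2)]
          have h3 : max (k - u z) 0 * (max (k - u z) 0 * D) ^ p i ≤
              (k - c) * ((k - c) * D) ^ p i := by
            have := hp i
            refine mul_le_mul hθ (Real.rpow_le_rpow (by positivity) (by gcongr) (by linarith))
              (by positivity) hL
          have e : flux p v i z * (max (k - u z) 0 ^ 2 * partialSpace i ζ z -
              2 * max (k - u z) 0 * ζ z * v i z) =
              flux p v i z * (max (k - u z) 0 ^ 2 * partialSpace i ζ z) -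
              2 * (max (k - u z) 0 * ζ z * (flux p v i z * v i z)) := by ring
          rw [e, flux_mul_self v (hp i)]
          linarith
      · have h0 : max (k - u z) 0 = 0 := max_eq_right (by linarith [not_lt.1 huk])
        simp only [h0]
        simpa using Set.indicator_nonneg (s := A) (fun _ _ => hK0) z
    · simp only [image_eq_zero_of_notMem_tsupport hzs,
          partialTime_eq_zero_of_notMem_tsupport hzs, partialSpace_eq_zero_of_notMem_tsupport hzs]
      simpa using Set.indicator_nonneg (s := A) (fun _ _ => hK0) z
  have hint : Integrable fun z => 1 / 3 * max (k - u z) 0 ^ 3 * partialTime ζ z +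
        ∑ i, flux p v i z * (max (k - u z) 0 ^ 2 * partialSpace i ζ z -
          2 * max (k - u z) 0 * ζ z * v i z) := by
    have hb : Integrable fun z => 1 / 3 * (k - c) ^ 3 * |partialTime ζ z| +
        ∑ i, (|flux p v i z| * ((k - c) ^ 2 * D) + |flux p v i z * v i z| * (2 * (k - c))) := by
      refine Integrable.add ((hζ.continuous_partialTime.integrable_of_hasCompactSupport
        (hζ.hasCompactSupport.fderiv_apply ℝ _)).abs.const_mul _)
        (integrable_finsetSum _ fun i _ => ((hsup.integrable_flux (hp i)).abs.mul_const _).add ?_)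
      simp only [flux_mul_self v (hp i)]
      exact (hsup.integrable_rpow i).abs.mul_const _
    have hFm := fun i => (hsup.integrable_flux (hp i)).aestronglyMeasurable
    have hvm := hsup.aestronglyMeasurable
    have hζm := hζ.contDiff.continuous.aestronglyMeasurable (μ := volume)
    refine hb.mono' ?_ ?_
    · refine AEStronglyMeasurable.add (((hθm.pow 3).const_mul _).mul
        hζ.continuous_partialTime.aestronglyMeasurable)
        (Finset.aestronglyMeasurable_fun_sum _ fun i _ => (hFm i).mul
        (((hθm.pow 2).mul (hζ.continuous_partialSpace i).aestronglyMeasurable).sub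
          (((hθm.const_mul _).mul hζm).mul (hvm i))))
    · filter_upwards [hbd] with z hz
      rw [Real.norm_eq_abs]
      have hθ0 : 0 ≤ max (k - u z) 0 := le_max_right _ _
      have hD := hζ.bound_nonneg
      by_cases hzs : z ∈ tsupport ζ
      · have hθ := hz hzs
        refine (abs_add_le _ _).trans (add_le_add ?_ ((Finset.abs_sum_le_sum_abs _ _).trans
          (Finset.sum_le_sum fun i _ => abs_mul_sub_le hθ0 hθ (hζ.nonneg z) (hζ.le_one z)
            (hζ.abs_partialSpace_le' hp i z))))
        rw [abs_mul, abs_of_nonneg (by positivity : 0 ≤ 1 / 3 * max (k - u z) 0 ^ 3)]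
        gcongr
      · simp only [image_eq_zero_of_notMem_tsupport hzs,
          partialTime_eq_zero_of_notMem_tsupport hzs, partialSpace_eq_zero_of_notMem_tsupport hzs]
        simp only [mul_zero, zero_mul, sub_zero, Finset.sum_const_zero, add_zero, abs_zero]
        positivity
  -- Both conclusions come from this one inequality, by dropping one or the other nonnegative term.
  have hmain : ∀ᵐ τ : ℝ, 1 / 3 * (∫ x, max (k - u (x, τ)) 0 ^ 3 * ζ (x, τ)) +
      ∫ z in {z : SpaceTime N | z.2 ≤ τ}, ∑ i, max (k - u z) 0 * ζ z * |v i z| ^ p i ≤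
      K * volume.real A := by
    filter_upwards [h.energy hζ hp hck] with τ hτ
    have hKle : ∫ z in {z : SpaceTime N | z.2 ≤ τ}, A.indicator (fun _ => K) z ≤
        K * volume.real A := by
      refine (setIntegral_le_integral hKA
        (ae_of_all _ fun z => Set.indicator_nonneg (fun _ _ => hK0) z)).trans_eq ?_
      rw [integral_indicator₀ hA', setIntegral_const, smul_eq_mul, mul_comm]
    have hle : ∫ z in {z : SpaceTime N | z.2 ≤ τ},
        (1 / 3 * max (k - u z) 0 ^ 3 * partialTime ζ z +
        ∑ i, flux p v i z * (max (k - u z) 0 ^ 2 * partialSpace i ζ z -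
          2 * max (k - u z) 0 * ζ z * v i z)) ≤
        ∫ z in {z : SpaceTime N | z.2 ≤ τ},
          (A.indicator (fun _ => K) z - ∑ i, max (k - u z) 0 * ζ z * |v i z| ^ p i) := by
      exact integral_mono_ae hint.integrableOn (hKA.sub hg).integrableOn (ae_restrict_of_ae hpt)
    rw [integral_sub hKA.integrableOn hg.integrableOn] at hle
    linarith
  have hg0 : ∀ z, 0 ≤ ∑ i, max (k - u z) 0 * ζ z * |v i z| ^ p i := fun z =>
    Finset.sum_nonneg fun i _ => mul_nonneg (mul_nonneg (le_max_right _ _) (hζ.nonneg z))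
      (by positivity)
  refine ⟨?_, hg, ?_⟩
  · filter_upwards [hmain] with τ hτ
    have : 0 ≤ ∫ z in {z : SpaceTime N | z.2 ≤ τ}, ∑ i, max (k - u z) 0 * ζ z * |v i z| ^ p i :=
      integral_nonneg hg0
    linarith
  -- For `τ > 1` the slab contains the whole support of `ζ`. The inequality holds for some such `τ`,
  -- as the half-line has positive measure.
  · have : NeBot (ae (volume.restrict (Set.Ioi (1 : ℝ)))) := by
      rw [ae_neBot]
      exact fun h => by simpa using congrArg (fun μ => μ Set.univ) h
    obtain ⟨τ, hτ, hτ1⟩ := ((ae_restrict_of_ae hmain).and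
      (ae_restrict_mem (s := Set.Ioi (1 : ℝ)) measurableSet_Ioi)).exists
    rw [setIntegral_eq_integral_of_forall_compl_eq_zero] at hτ
    · have : 0 ≤ ∫ x, max (k - u (x, τ)) 0 ^ 3 * ζ (x, τ) :=
        integral_nonneg fun x => mul_nonneg (by positivity) (hζ.nonneg _)
      linarith
    · intro z hz
      refine Finset.sum_eq_zero fun i _ => ?_
      have : z ∉ tsupport ζ := fun hzs => hz ?_
      · rw [image_eq_zero_of_notMem_tsupport this]; ring
      · have h1 := (norm_snd_le z).trans (hζ.norm_le_of_mem_tsupport hzs)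
        have h2 := (le_abs_self z.2).trans h1
        have h3 : (1 : ℝ) < τ := hτ1
        have h4 := hζ.lt_one
        change z.2 ≤ τ
        linarith

end Energy

/-! ### Spatial translates of the truncation -/

section Translation

variable {N : ℕ} {p : Fin N → ℝ}

/-- The increment is the integral of the derivative along the segment. Tonelli and translation
invariance remove the position on the segment. -/
theorem lintegral_enorm_translate_sub_le {W : SpaceTime N → ℝ} (hW : ContDiff ℝ 1 W)
    (e : SpaceTime N) : ∫⁻ z, ‖W (z + e) - W z‖ₑ ≤ ∫⁻ z, ‖fderiv ℝ W z e‖ₑ := by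
  have hc : Continuous fun q : SpaceTime N × ℝ => fderiv ℝ W (q.1 + q.2 • e) e :=
    ((hW.continuous_fderiv one_ne_zero).comp (by fun_prop)).clm_apply continuous_const
  have hpt : ∀ z, ‖W (z + e) - W z‖ₑ ≤
      ∫⁻ s in Set.Ioc (0 : ℝ) 1, ‖fderiv ℝ W (z + s • e) e‖ₑ := by
    intro z
    have hd : ∀ s : ℝ, HasDerivAt (fun s : ℝ => W (z + s • e)) (fderiv ℝ W (z + s • e) e) s := by
      intro s
      have h1 := ((hW.differentiable one_ne_zero) (z + s • e)).hasFDerivAt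
      have h2 : HasDerivAt (fun s : ℝ => z + s • e) e s := by
        simpa using ((hasDerivAt_id s).smul_const e).const_add z
      exact h1.comp_hasDerivAt s h2
    have h3 := intervalIntegral.integral_eq_sub_of_hasDerivAt (a := 0) (b := 1)
      (fun s _ => hd s) (Continuous.intervalIntegrable
        (hc.comp (by fun_prop : Continuous fun s : ℝ => (z, s))) _ _)
    simp only [one_smul, zero_smul, add_zero] at h3
    rw [← h3, intervalIntegral.integral_of_le zero_le_one]
    exact enorm_integral_le_lintegral_enorm _
  calc ∫⁻ z, ‖W (z + e) - W z‖ₑ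
      ≤ ∫⁻ z, ∫⁻ s in Set.Ioc (0 : ℝ) 1, ‖fderiv ℝ W (z + s • e) e‖ₑ := lintegral_mono hpt
    _ = ∫⁻ s in Set.Ioc (0 : ℝ) 1, ∫⁻ z, ‖fderiv ℝ W (z + s • e) e‖ₑ :=
        lintegral_lintegral_swap hc.enorm.measurable.aemeasurable
    _ = ∫⁻ s in Set.Ioc (0 : ℝ) 1, ∫⁻ z, ‖fderiv ℝ W z e‖ₑ := by
        congr 1; ext s
        exact lintegral_add_right_eq_self (fun z => ‖fderiv ℝ W z e‖ₑ) (s • e)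
    _ = ∫⁻ z, ‖fderiv ℝ W z e‖ₑ := by simp

theorem fderiv_apply_prod_zero (W : SpaceTime N → ℝ) (z : SpaceTime N) (w : Fin N → ℝ) :
    fderiv ℝ W z (w, 0) = ∑ i, w i * partialSpace i W z := by
  have : ((w, 0) : SpaceTime N) = ∑ i, w i • ((Pi.single i 1, 0) : SpaceTime N) := by
    refine Prod.ext ?_ ?_
    · rw [Prod.fst_sum]
      ext j
      simp [Finset.sum_apply, Pi.single_apply]
    · rw [Prod.snd_sum]; simp
  rw [this, map_sum]
  exact Finset.sum_congr rfl fun i _ => by rw [map_smul, smul_eq_mul, partialSpace]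

variable {u ζ G : SpaceTime N → ℝ} {v : Fin N → SpaceTime N → ℝ} {c k r D : ℝ}
  {U : ℕ → SpaceTime N → ℝ} {V F : ℕ → Fin N → SpaceTime N → ℝ}

/-- The bound for the `i`-th weak derivative of `(k - u)₊² ζ`. -/
noncomputable def truncGradBound (k : ℝ) (ζ u w : SpaceTime N → ℝ) (i : Fin N)
    (z : SpaceTime N) : ℝ :=
  2 * max (k - u z) 0 * ζ z * |w z| + max (k - u z) 0 ^ 2 * |partialSpace i ζ z|

theorem truncGradBound_nonneg (hζ : ∀ z, 0 ≤ ζ z) (w : SpaceTime N → ℝ) (i : Fin N)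
    (z : SpaceTime N) : 0 ≤ truncGradBound k ζ u w i z := by
  have := hζ z
  unfold truncGradBound
  positivity

/-- Proved for the smooth approximations and passed to the limit, by Fatou on the left and dominated
convergence on the right. The weak differentiability of the truncation itself is never needed. -/
theorem IsSmoothApproximation.lintegral_translate_le (h : IsSmoothApproximation p u v c U V F G)
    (hζ : IsCutoff p ζ r D) (hck : c ≤ k) (w : Fin N → ℝ) :
    ∫⁻ z, ‖max (k - u (z + (w, 0))) 0 ^ 2 * ζ (z + (w, 0)) - max (k - u z) 0 ^ 2 * ζ z‖ₑ ≤
      ENNReal.ofReal (∫ z, ∑ i, |w i| * truncGradBound k ζ u (v i) i z) := by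
  have hL : 0 ≤ k - c := by linarith
  have hD := hζ.bound_nonneg
  have hUc := fun n => (h.contDiff_fun n).continuous
  have hVc := fun n i => (h.contDiff_grad n i).continuous
  have hζc := hζ.contDiff.continuous
  have hζx := hζ.continuous_partialSpace
  set W : ℕ → SpaceTime N → ℝ := fun n z => max (k - U n z) 0 ^ 2 * ζ z with hWdef
  have hUd : ∀ n, ContDiff ℝ 1 (U n) := fun n => (h.contDiff_fun n).of_le (by simp)
  have hW2 : ∀ n, ContDiff ℝ 1 fun z => max (k - U n z) 0 ^ 2 := fun n => by
    simpa using contDiff_max_sub_pow (hUd n) k 0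
  have hW : ∀ n, ContDiff ℝ 1 (W n) := fun n => (hW2 n).mul hζ.contDiff
  have hlimW : ∀ᵐ z, Tendsto (fun n => W n z) atTop (𝓝 (max (k - u z) 0 ^ 2 * ζ z)) := by
    filter_upwards [h.tendsto_fun] with z hz
    exact (((tendsto_const_nhds.sub hz).max tendsto_const_nhds).pow 2).mul tendsto_const_nhds
  have hlimWt : ∀ᵐ z, Tendsto (fun n => W n (z + (w, 0))) atTop
      (𝓝 (max (k - u (z + (w, 0))) 0 ^ 2 * ζ (z + (w, 0)))) :=
    (measurePreserving_add_right volume ((w, 0) : SpaceTime N)).quasiMeasurePreserving.ae hlimW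
  have hbd : ∀ᶠ n in atTop, ∀ᵐ z, ∀ i, truncGradBound k ζ (U n) (V n i) i z ≤
      (2 * (k - c)) * |G z| + (k - c) ^ 2 * |partialSpace i ζ z| := by
    filter_upwards [h.eventually_max_le hζ hck] with n hn
    filter_upwards [h.bound] with z hz i
    by_cases hzs : z ∈ tsupport ζ
    · have hθ := hn z hzs
      have hθ0 : 0 ≤ max (k - U n z) 0 := le_max_right _ _
      have h1 := (hz n i).1.trans (le_abs_self _)
      unfold truncGradBound
      refine add_le_add (mul_le_mul ?_ h1 (abs_nonneg _) (by positivity)) (by gcongr)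
      calc 2 * max (k - U n z) 0 * ζ z ≤ 2 * (k - c) * 1 :=
            mul_le_mul (by linarith) (hζ.le_one z) (hζ.nonneg z) (by linarith)
        _ = 2 * (k - c) := mul_one _
    · simp only [truncGradBound, image_eq_zero_of_notMem_tsupport hzs,
        partialSpace_eq_zero_of_notMem_tsupport hzs]
      simp only [mul_zero, zero_mul, abs_zero, add_zero]
      positivity
  have hgrad : ∀ᶠ n in atTop, ∫⁻ z, ‖W n (z + (w, 0)) - W n z‖ₑ ≤
      ENNReal.ofReal (∫ z, ∑ i, |w i| * truncGradBound k ζ (U n) (V n i) i z) := by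
    filter_upwards [h.pointwise r hζ.lt_one, hbd] with n hn hbd
    have hcont : ∀ i, Continuous (truncGradBound k ζ (U n) (V n i) i) := fun i => by
      have := hUc n
      have := hVc n i
      have := hζx i
      unfold truncGradBound
      fun_prop
    have hint : Integrable fun z => ∑ i, |w i| * truncGradBound k ζ (U n) (V n i) i z := by
      refine integrable_finsetSum _ fun i _ => Integrable.const_mul ?_ _
      refine ((h.integrable_bound.abs.const_mul (2 * (k - c))).add
        (((hζx i).integrable_of_hasCompactSupport
          (hζ.hasCompactSupport.fderiv_apply ℝ _)).abs.const_mul ((k - c) ^ 2))).mono'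
        (hcont i).aestronglyMeasurable ?_
      filter_upwards [hbd] with z hz
      rw [Real.norm_of_nonneg (truncGradBound_nonneg hζ.nonneg _ _ _)]
      exact hz i
    refine (lintegral_enorm_translate_sub_le (hW n) _).trans ?_
    rw [ofReal_integral_eq_lintegral_ofReal hint (ae_of_all _ fun z =>
      Finset.sum_nonneg fun i _ => mul_nonneg (abs_nonneg _)
        (truncGradBound_nonneg hζ.nonneg _ _ _))]
    refine lintegral_mono fun z => ?_
    rw [← ofReal_norm]
    refine ENNReal.ofReal_le_ofReal ?_
    rw [fderiv_apply_prod_zero, Real.norm_eq_abs]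
    refine (Finset.abs_sum_le_sum_abs _ _).trans (Finset.sum_le_sum fun i _ => ?_)
    rw [abs_mul]
    refine mul_le_mul_of_nonneg_left ?_ (abs_nonneg _)
    by_cases hzs : z ∈ tsupport ζ
    · have hd := hn z (hζ.norm_le_of_mem_tsupport hzs)
      have h1 := hζ.nonneg z
      have e : partialSpace i (W n) z =
          -(2 * max (k - U n z) 0 * ζ z * V n i z) + max (k - U n z) 0 ^ 2 * partialSpace i ζ z := by
        rw [hWdef, partialSpace_mul i ((hW2 n).differentiable one_ne_zero z)
          (hζ.contDiff.differentiable one_ne_zero z)]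
        have := (hasFDerivAt_max_sub_pow ((hUd n).differentiable one_ne_zero z) k 0).fderiv
        simp only [zero_add] at this
        rw [← hd.2.1 i]
        simp only [partialSpace, this, FunLike.coe_smul, FunLike.coe_neg, Pi.smul_apply,
          Pi.neg_apply, smul_eq_mul]
        push_cast
        ring
      rw [e]
      refine (abs_add_le _ _).trans (le_of_eq ?_)
      rw [abs_neg, abs_mul, abs_mul _ (partialSpace i ζ z),
        abs_of_nonneg (by positivity : 0 ≤ 2 * max (k - U n z) 0 * ζ z),
        abs_of_nonneg (by positivity : 0 ≤ max (k - U n z) 0 ^ 2)]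
      rfl
    · have : z ∉ tsupport (W n) := fun h' => hzs (tsupport_mul_subset_right h')
      rw [partialSpace_eq_zero_of_notMem_tsupport this, abs_zero]
      exact truncGradBound_nonneg hζ.nonneg _ _ _
  have hlimR : Tendsto (fun n => ∫ z, ∑ i, |w i| * truncGradBound k ζ (U n) (V n i) i z) atTop
      (𝓝 (∫ z, ∑ i, |w i| * truncGradBound k ζ u (v i) i z)) := by
    refine tendsto_integral_filter_of_dominated_convergence
      (fun z => ∑ i, |w i| * ((2 * (k - c)) * |G z| + (k - c) ^ 2 * |partialSpace i ζ z|))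
      ?_ ?_ ?_ ?_
    · refine Eventually.of_forall fun n => Continuous.aestronglyMeasurable ?_
      have := hUc n
      have := hVc n
      unfold truncGradBound
      fun_prop
    · filter_upwards [hbd] with n hn
      filter_upwards [hn] with z hz
      rw [Real.norm_of_nonneg (Finset.sum_nonneg fun i _ => mul_nonneg (abs_nonneg _)
        (truncGradBound_nonneg hζ.nonneg _ _ _))]
      exact Finset.sum_le_sum fun i _ => mul_le_mul_of_nonneg_left (hz i) (abs_nonneg _)
    · exact integrable_finsetSum _ fun i _ =>
        ((h.integrable_bound.abs.const_mul (2 * (k - c))).add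
        (((hζx i).integrable_of_hasCompactSupport
          (hζ.hasCompactSupport.fderiv_apply ℝ _)).abs.const_mul ((k - c) ^ 2))).const_mul _
    · filter_upwards [h.tendsto_fun, ae_all_iff.2 h.tendsto_grad] with z h1 h2
      have hθ := (tendsto_const_nhds (x := k)).sub h1 |>.max (tendsto_const_nhds (x := (0 : ℝ)))
      exact tendsto_finsetSum _ fun i _ => ((((hθ.const_mul 2).mul_const _).mul (h2 i).abs).add
        ((hθ.pow 2).mul_const _)).const_mul _
  calc ∫⁻ z, ‖max (k - u (z + (w, 0))) 0 ^ 2 * ζ (z + (w, 0)) - max (k - u z) 0 ^ 2 * ζ z‖ₑ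
      = ∫⁻ z, liminf (fun n => ‖W n (z + (w, 0)) - W n z‖ₑ) atTop := by
        refine lintegral_congr_ae ?_
        filter_upwards [hlimW, hlimWt] with z h1 h2
        exact ((h2.sub h1).enorm).liminf_eq.symm
    _ ≤ liminf (fun n => ∫⁻ z, ‖W n (z + (w, 0)) - W n z‖ₑ) atTop := by
        refine lintegral_liminf_le fun n => ?_
        have := (hW n).continuous
        exact Continuous.measurable (by fun_prop)
    _ ≤ liminf (fun n => ENNReal.ofReal
          (∫ z, ∑ i, |w i| * truncGradBound k ζ (U n) (V n i) i z)) atTop :=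
        liminf_le_liminf hgrad
    _ = _ := ((ENNReal.continuous_ofReal.tendsto _).comp hlimR).liminf_eq

end Translation

/-! ### From oscillation to the measure of level sets -/

section LevelSets

variable {N : ℕ}

/-- A superlevel set is small if the function is small in mean on every horizontal slice and
its horizontal translates are close in `L¹`. -/
theorem volume_superlevel_le {W : SpaceTime N → ℝ} (hW : Measurable W) {a ε g : ℝ} (ha : 0 ≤ a)
    (hε : 0 < ε)
    (hmean : ∀ᵐ t : ℝ, ∀ b : Fin N → ℝ, ∫⁻ w in Set.Icc 0 (fun _ => ε), ‖W (b + w, t)‖ₑ ≤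
      ENNReal.ofReal a * volume (Set.Icc (0 : Fin N → ℝ) fun _ => ε))
    (htrans : ∀ w ∈ Set.Icc (0 : Fin N → ℝ) (fun _ => ε),
      ∫⁻ z, ‖W (z + (w, 0)) - W z‖ₑ ≤ ENNReal.ofReal g) :
    ENNReal.ofReal a * volume {z | 2 * a ≤ W z} ≤ ENNReal.ofReal g := by
  set Q := Set.Icc (0 : Fin N → ℝ) (fun _ => ε) with hQ
  have hQv : volume Q = ENNReal.ofReal ε ^ N := by
    rw [hQ, Real.volume_Icc_pi]; simp
  have hQ0 : volume Q ≠ 0 := by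
    rw [hQv]; exact pow_ne_zero _ (by simpa using hε)
  have hQt : volume Q ≠ ⊤ := by
    rw [hQv]; exact ENNReal.pow_ne_top ENNReal.ofReal_ne_top
  have hm : Measurable fun q : SpaceTime N × (Fin N → ℝ) => ‖W (q.1 + (q.2, 0)) - W q.1‖ₑ :=
    ((hW.comp (by fun_prop)).sub (hW.comp measurable_fst)).enorm
  -- Where `W ≥ 2a` although its mean over the cube at `z` is at most `a`, the mean of `|W (z + w) -
  -- W z|` over the cube is at least `a`. Integrating over all such `z` and exchanging integrals
  -- gives the claim.
  have hpt : ∀ᵐ z, z ∈ {z | 2 * a ≤ W z} →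
      ENNReal.ofReal a * volume Q ≤ ∫⁻ w in Q, ‖W (z + (w, 0)) - W z‖ₑ := by
    have hmean' : ∀ᵐ z : SpaceTime N, ∀ b : Fin N → ℝ, ∫⁻ w in Q, ‖W (b + w, z.2)‖ₑ ≤
      ENNReal.ofReal a * volume Q := Measure.quasiMeasurePreserving_snd.ae hmean
    filter_upwards [hmean'] with z hz hza
    have h1 : ENNReal.ofReal (2 * a) * volume Q ≤ (∫⁻ w in Q, ‖W (z + (w, 0)) - W z‖ₑ) +
        ENNReal.ofReal a * volume Q := by
      calc ENNReal.ofReal (2 * a) * volume Q = ∫⁻ _ in Q, ENNReal.ofReal (2 * a) := by simp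
        _ ≤ ∫⁻ w in Q, (‖W (z + (w, 0)) - W z‖ₑ + ‖W (z + (w, 0))‖ₑ) := by
            refine lintegral_mono fun w => ?_
            have e : W z = W (z + (w, 0)) - (W (z + (w, 0)) - W z) := by ring
            calc ENNReal.ofReal (2 * a) ≤ ‖W z‖ₑ := by
                  rw [← ofReal_norm]
                  exact ENNReal.ofReal_le_ofReal ((le_abs_self _).trans' hza)
              _ ≤ ‖W (z + (w, 0))‖ₑ + ‖W (z + (w, 0)) - W z‖ₑ := by
                  conv_lhs => rw [e]
                  exact enorm_sub_le
              _ = _ := add_comm _ _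
        _ = (∫⁻ w in Q, ‖W (z + (w, 0)) - W z‖ₑ) + ∫⁻ w in Q, ‖W (z + (w, 0))‖ₑ :=
            lintegral_add_left (f := fun w => ‖W (z + (w, 0)) - W z‖ₑ)
              (hm.comp (measurable_prodMk_left (x := z))) _
        _ ≤ _ := by
            gcongr
            refine le_trans (le_of_eq ?_) (hz z.1)
            congr 1; ext w
            congr 2
            exact Prod.ext rfl (add_zero _)
    rw [two_mul, ENNReal.ofReal_add ha ha, add_mul] at h1
    exact (ENNReal.add_le_add_iff_right (ENNReal.mul_ne_top ENNReal.ofReal_ne_top hQt)).1 h1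
  have hS : MeasurableSet {z | 2 * a ≤ W z} := measurableSet_le measurable_const hW
  have hmain : ENNReal.ofReal a * volume {z | 2 * a ≤ W z} * volume Q ≤
      ENNReal.ofReal g * volume Q := by
    calc ENNReal.ofReal a * volume {z | 2 * a ≤ W z} * volume Q
        = ∫⁻ z in {z | 2 * a ≤ W z}, ENNReal.ofReal a * volume Q := by
          rw [setLIntegral_const]; ring
      _ ≤ ∫⁻ z in {z | 2 * a ≤ W z}, ∫⁻ w in Q, ‖W (z + (w, 0)) - W z‖ₑ :=
          lintegral_mono_ae ((ae_restrict_iff' hS).2 hpt)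
      _ ≤ ∫⁻ z, ∫⁻ w in Q, ‖W (z + (w, 0)) - W z‖ₑ := setLIntegral_le_lintegral _ _
      _ = ∫⁻ w in Q, ∫⁻ z, ‖W (z + (w, 0)) - W z‖ₑ := lintegral_lintegral_swap hm.aemeasurable
      _ ≤ ∫⁻ w in Q, ENNReal.ofReal g := setLIntegral_mono measurable_const htrans
      _ = ENNReal.ofReal g * volume Q := by simp
  exact (ENNReal.mul_le_mul_iff_left hQ0 hQt).1 hmain

end LevelSets

/-! ### One step of De Giorgi's iteration -/

section DeGiorgiStep

variable {N : ℕ} {p : Fin N → ℝ} {u ζ : SpaceTime N → ℝ} {v : Fin N → SpaceTime N → ℝ}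
  {k L r D : ℝ}

/-- The constant in the `L¹` estimate for the spatial gradient of the truncation. -/
noncomputable def gradConst (p : Fin N → ℝ) (L D : ℝ) : ℝ :=
  2 * energyConst p L D + N * (2 * L + L ^ 2 * D)

theorem gradConst_nonneg (hL : 0 ≤ L) (hD : 0 ≤ D) : 0 ≤ gradConst p L D := by
  have := energyConst_nonneg (p := p) hL hD
  unfold gradConst
  positivity

/-- Distinguish `θ ≤ μ` from `θ ≥ μ`. This turns the cubic bound on time slices into a bound for the
mean of the quadratic `W`. -/
theorem sq_mul_le {θ μ ζ : ℝ} (hθ : 0 ≤ θ) (hμ : 0 < μ) (hζ : 0 ≤ ζ) (hζ1 : ζ ≤ 1) :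
    θ ^ 2 * ζ ≤ μ ^ 2 + θ ^ 3 * ζ / μ := by
  rcases le_total θ μ with h | h
  · have : 0 ≤ θ ^ 3 * ζ / μ := by positivity
    have : θ ^ 2 * ζ ≤ μ ^ 2 * 1 := by gcongr
    linarith
  · have h1 : θ ^ 2 * ζ ≤ θ ^ 3 * ζ / μ := by
      rw [le_div_iff₀ hμ]
      nlinarith [mul_nonneg (sq_nonneg θ) hζ, mul_le_mul_of_nonneg_left h
        (mul_nonneg (sq_nonneg θ) hζ)]
    have := sq_nonneg μ
    linarith

/-- On cubes of side `ε`, with `ε^N` proportional to `y`, the slice bound gives mean of `W` at most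
`2 μ²`, whereas `W ≥ 4 μ²` on the set to be measured. Translating by at most `ε` costs a multiple of
`ε y` in `L¹`, so the bound is of order `y^{1 + 1/N}`. -/
theorem IsUnitSuperSolution.volume_le_of_cutoff (hN : N ≠ 0) (hsup : IsUnitSuperSolution p u v)
    (hum : Measurable u) (hp : ∀ i, 2 < p i) (hL : 0 ≤ L)
    (hc : ∀ᵐ z, z ∈ Metric.ball (0 : SpaceTime N) 1 → k - L ≤ u z)
    (hζ : IsCutoff p ζ r D) {μ y : ℝ} (hμ : 0 < μ) (hy : 0 < y)
    (hA : volume {z | z ∈ tsupport ζ ∧ u z < k} ≤ ENNReal.ofReal y) :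
    volume {z | ζ z = 1 ∧ u z ≤ k - 2 * μ} ≤
      ENNReal.ofReal (((3 * energyConst p L D + 1) * y / μ ^ 3) ^ (1 / (N : ℝ)) *
        (gradConst p L D * y) / (2 * μ ^ 2)) := by
  obtain ⟨U, V, F, G, h⟩ := hsup.exists_isSmoothApproximation hp hc
  have hck : k - L ≤ k := by linarith
  have hD := hζ.bound_nonneg
  set A : Set (SpaceTime N) := {z | z ∈ tsupport ζ ∧ u z < k} with hAdef
  have hAm : MeasurableSet A :=
    (isClosed_tsupport ζ).measurableSet.inter (measurableSet_lt hum measurable_const)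
  have hAt : volume A ≠ ⊤ := ne_top_of_le_ne_top ENNReal.ofReal_ne_top hA
  have hAy : volume.real A ≤ y := ENNReal.toReal_le_of_le_ofReal hy.le hA
  obtain ⟨hslice, hgi, hgrad⟩ := h.caccioppoli hsup hc hζ hp hck hAm.nullMeasurableSet hAt
    fun z hz hzk => ⟨hz, hzk⟩
  rw [sub_sub_cancel] at hgrad
  simp only [sub_sub_cancel] at hslice
  set K := energyConst p L D with hK
  have hK0 : 0 ≤ K := energyConst_nonneg hL hD
  -- With this side, the slice integral `3 K y` divided by `μ` is at most `μ² ε^N`. The added `1`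
  -- keeps `ε` positive even if `K = 0`.
  set ε := ((3 * K + 1) * y / μ ^ 3) ^ (1 / (N : ℝ)) with hε
  have hε0 : 0 < ε := by positivity
  have hεN : ε ^ N = (3 * K + 1) * y / μ ^ 3 := by
    rw [hε, one_div]; exact Real.rpow_inv_natCast_pow (by positivity) hN
  have hbd : ∀ᵐ z, z ∈ tsupport ζ → max (k - u z) 0 ≤ L := by
    filter_upwards [hc] with z hz hzs
    have := hz (mem_ball_zero_iff.2 ((hζ.norm_le_of_mem_tsupport hzs).trans_lt hζ.lt_one))
    exact max_le (by linarith) hL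
  have hζm := hζ.contDiff.continuous.measurable
  have hθm : Measurable fun z => max (k - u z) 0 := (measurable_const.sub hum).max measurable_const
  have hWm : Measurable fun z => max (k - u z) 0 ^ 2 * ζ z := (hθm.pow_const 2).mul hζm
  have hQv : volume (Set.Icc (0 : Fin N → ℝ) fun _ => ε) = ENNReal.ofReal (ε ^ N) := by
    rw [Real.volume_Icc_pi, ENNReal.ofReal_pow hε0.le]; simp
  have key := volume_superlevel_le hWm (a := 2 * μ ^ 2) (ε := ε)
    (g := ε * (gradConst p L D * y)) (by positivity) hε0 ?_ ?_
  · have hsub : {z | ζ z = 1 ∧ u z ≤ k - 2 * μ} ⊆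
        {z | 2 * (2 * μ ^ 2) ≤ max (k - u z) 0 ^ 2 * ζ z} := by
      rintro z ⟨h1, h2⟩
      change 2 * (2 * μ ^ 2) ≤ max (k - u z) 0 ^ 2 * ζ z
      rw [h1, mul_one]
      have : 2 * μ ≤ max (k - u z) 0 := le_max_of_le_left (by linarith)
      calc 2 * (2 * μ ^ 2) = (2 * μ) ^ 2 := by ring
        _ ≤ _ := by gcongr
    refine (measure_mono hsub).trans ?_
    rw [ENNReal.ofReal_div_of_pos (by positivity)]
    rw [ENNReal.le_div_iff_mul_le (by left; simpa using hμ.ne') (by simp), mul_comm]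
    exact key
  · filter_upwards [hslice, ae_ae_slice hbd] with t ht hbt b
    have hint : Integrable fun x => max (k - u (x, t)) 0 ^ 3 * ζ (x, t) := by
      have hb : Integrable fun x : Fin N → ℝ =>
          L ^ 3 * (Metric.closedBall (0 : Fin N → ℝ) r).indicator (fun _ => 1) x :=
        ((integrable_indicator_iff Metric.isClosed_closedBall.measurableSet).2
        (integrableOn_const (isCompact_closedBall _ _).measure_ne_top)).const_mul _
      refine hb.mono' (((hθm.pow_const 3).mul hζm).comp
        measurable_prodMk_right).aestronglyMeasurable ?_
      filter_upwards [hbt] with x hx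
      rw [Real.norm_of_nonneg (mul_nonneg (by positivity) (hζ.nonneg _))]
      by_cases hxs : ((x, t) : SpaceTime N) ∈ tsupport ζ
      · have hx1 : x ∈ Metric.closedBall (0 : Fin N → ℝ) r := by
          rw [mem_closedBall_zero_iff]
          exact (norm_fst_le ((x, t) : SpaceTime N)).trans (hζ.norm_le_of_mem_tsupport hxs)
        rw [Set.indicator_of_mem hx1]
        exact mul_le_mul (pow_le_pow_left₀ (le_max_right _ _) (hx hxs) 3) (hζ.le_one _)
          (hζ.nonneg _) (by positivity)
      · rw [image_eq_zero_of_notMem_tsupport hxs, mul_zero]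
        exact mul_nonneg (by positivity) (Set.indicator_nonneg (fun _ _ => zero_le_one) _)
    have hnn : ∀ x, 0 ≤ max (k - u (x, t)) 0 ^ 3 * ζ (x, t) / μ := fun x =>
      div_nonneg (mul_nonneg (by positivity) (hζ.nonneg _)) hμ.le
    calc ∫⁻ w in Set.Icc 0 (fun _ => ε), ‖max (k - u (b + w, t)) 0 ^ 2 * ζ (b + w, t)‖ₑ
        ≤ ∫⁻ w in Set.Icc 0 (fun _ => ε), (ENNReal.ofReal (μ ^ 2) +
            ENNReal.ofReal (max (k - u (b + w, t)) 0 ^ 3 * ζ (b + w, t) / μ)) := by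
          refine lintegral_mono fun w => ?_
          rw [← ofReal_norm, ← ENNReal.ofReal_add (by positivity) (hnn _)]
          refine ENNReal.ofReal_le_ofReal ?_
          rw [Real.norm_of_nonneg (mul_nonneg (by positivity) (hζ.nonneg _))]
          exact sq_mul_le (le_max_right _ _) hμ (hζ.nonneg _) (hζ.le_one _)
      _ = ENNReal.ofReal (μ ^ 2) * volume (Set.Icc (0 : Fin N → ℝ) fun _ => ε) +
            ∫⁻ w in Set.Icc 0 (fun _ => ε),
              ENNReal.ofReal (max (k - u (b + w, t)) 0 ^ 3 * ζ (b + w, t) / μ) := by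
          rw [lintegral_add_left measurable_const, setLIntegral_const]
      _ ≤ ENNReal.ofReal (μ ^ 2) * volume (Set.Icc (0 : Fin N → ℝ) fun _ => ε) +
            ∫⁻ x, ENNReal.ofReal (max (k - u (x, t)) 0 ^ 3 * ζ (x, t) / μ) := by
          refine add_le_add le_rfl ((setLIntegral_le_lintegral _ _).trans_eq ?_)
          exact lintegral_add_left_eq_self
            (fun x => ENNReal.ofReal (max (k - u (x, t)) 0 ^ 3 * ζ (x, t) / μ)) b
      _ ≤ ENNReal.ofReal (μ ^ 2) * volume (Set.Icc (0 : Fin N → ℝ) fun _ => ε) +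
            ENNReal.ofReal (μ ^ 2) * volume (Set.Icc (0 : Fin N → ℝ) fun _ => ε) := by
          gcongr
          rw [← ofReal_integral_eq_lintegral_ofReal (hint.div_const μ) (ae_of_all _ hnn), hQv,
            ← ENNReal.ofReal_mul (by positivity), integral_div]
          refine ENNReal.ofReal_le_ofReal ?_
          rw [hεN, div_le_iff₀ hμ]
          calc ∫ x, max (k - u (x, t)) 0 ^ 3 * ζ (x, t) ≤ 3 * K * volume.real A := ht
            _ ≤ 3 * K * y := by gcongr
            _ ≤ (3 * K + 1) * y := by nlinarith
            _ = μ ^ 2 * ((3 * K + 1) * y / μ ^ 3) * μ := by field_simp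
      _ = ENNReal.ofReal (2 * μ ^ 2) * volume (Set.Icc (0 : Fin N → ℝ) fun _ => ε) := by
          rw [two_mul (μ ^ 2), ENNReal.ofReal_add (by positivity) (by positivity), add_mul]
  · intro w hw
    refine (h.lintegral_translate_le hζ hck w).trans (ENNReal.ofReal_le_ofReal ?_)
    have hAi : Integrable (A.indicator fun _ => (1 : ℝ)) :=
      IntegrableOn.integrable_indicator (integrableOn_const hAt) hAm
    have hAint : ∫ z, A.indicator (fun _ => (1 : ℝ)) z = volume.real A := by
      rw [integral_indicator hAm, setIntegral_const, smul_eq_mul, mul_one]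
    calc ∫ z, ∑ i, |w i| * truncGradBound k ζ u (v i) i z
        ≤ ∫ z, ε * (2 * ∑ i, max (k - u z) 0 * ζ z * |v i z| ^ p i +
            N * (2 * L + L ^ 2 * D) * A.indicator (fun _ => (1 : ℝ)) z) := by
          refine integral_mono_of_nonneg (ae_of_all _ fun z => Finset.sum_nonneg fun i _ =>
            mul_nonneg (abs_nonneg _) (truncGradBound_nonneg hζ.nonneg _ _ _))
            (((hgi.const_mul 2).add (hAi.const_mul _)).const_mul _) ?_
          filter_upwards [hbd] with z hz
          have hterm : ∀ i, truncGradBound k ζ u (v i) i z ≤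
              2 * (max (k - u z) 0 * ζ z * |v i z| ^ p i) +
                (2 * L + L ^ 2 * D) * A.indicator (fun _ => (1 : ℝ)) z := by
            intro i
            have hζz := hζ.nonneg z
            have hθ0 : 0 ≤ max (k - u z) 0 := le_max_right _ _
            unfold truncGradBound
            by_cases hzA : z ∈ A
            · rw [Set.indicator_of_mem hzA]
              have hθ := hz hzA.1
              -- Only the `L¹` norm of the gradient of `W` is needed, so all exponents are reduced
              -- to the first power.
              have h1 : |v i z| ≤ 1 + |v i z| ^ p i := by
                have := rpow_le_one_add_rpow (abs_nonneg (v i z)) zero_le_one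
                  (by linarith [hp i] : 1 ≤ p i)
                rwa [Real.rpow_one] at this
              have h2 : 2 * max (k - u z) 0 * ζ z * |v i z| ≤
                  2 * max (k - u z) 0 * ζ z * (1 + |v i z| ^ p i) := by gcongr
              have h3 : max (k - u z) 0 * ζ z ≤ L * 1 :=
                mul_le_mul hθ (hζ.le_one z) hζz hL
              have h4 : max (k - u z) 0 ^ 2 * |partialSpace i ζ z| ≤ L ^ 2 * D := by
                have := hζ.abs_partialSpace_le' hp i z
                gcongr
              linarith
            · rw [Set.indicator_of_notMem hzA]
              by_cases hzs : z ∈ tsupport ζ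
              · have h0 : max (k - u z) 0 = 0 := by
                  refine max_eq_right ?_
                  by_contra hlt
                  exact hzA ⟨hzs, by linarith [not_le.1 hlt]⟩
                simp [h0]
              · simp [image_eq_zero_of_notMem_tsupport hzs,
                  partialSpace_eq_zero_of_notMem_tsupport hzs]
          calc ∑ i, |w i| * truncGradBound k ζ u (v i) i z
              ≤ ∑ i, ε * (2 * (max (k - u z) 0 * ζ z * |v i z| ^ p i) +
                (2 * L + L ^ 2 * D) * A.indicator (fun _ => (1 : ℝ)) z) := by
                refine Finset.sum_le_sum fun i _ => mul_le_mul ?_ (hterm i)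
                  (truncGradBound_nonneg hζ.nonneg _ _ _) hε0.le
                rw [abs_of_nonneg (hw.1 i)]
                exact hw.2 i
            _ = _ := by
                rw [← Finset.mul_sum, Finset.sum_add_distrib, ← Finset.mul_sum, Finset.sum_const,
                  Finset.card_univ, Fintype.card_fin, nsmul_eq_mul, mul_assoc (N : ℝ)]
      _ = ε * (2 * (∫ z, ∑ i, max (k - u z) 0 * ζ z * |v i z| ^ p i) +
            N * (2 * L + L ^ 2 * D) * volume.real A) := by
          rw [integral_const_mul, integral_add (hgi.const_mul 2) (hAi.const_mul _),
            integral_const_mul, integral_const_mul, hAint]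
      _ ≤ ε * (2 * (K * y) + N * (2 * L + L ^ 2 * D) * y) := by
          have : K * volume.real A ≤ K * y := by gcongr
          gcongr
          linarith
      _ = ε * (gradConst p L D * y) := by rw [gradConst, ← hK]; ring

end DeGiorgiStep

/-! ### Cutoff functions -/

section Cutoff

variable {N : ℕ} {p : Fin N → ℝ}

/-- The squared Euclidean norm of a point of space-time. -/
noncomputable def sqNorm (z : SpaceTime N) : ℝ := ∑ i, z.1 i ^ 2 + z.2 ^ 2

theorem contDiff_sqNorm : ContDiff ℝ ∞ (sqNorm (N := N)) := by
  unfold sqNorm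
  fun_prop

theorem sq_fst_le_sqNorm (z : SpaceTime N) (i : Fin N) : z.1 i ^ 2 ≤ sqNorm z := by
  have := Finset.single_le_sum (f := fun i => z.1 i ^ 2) (fun i _ => sq_nonneg _)
    (Finset.mem_univ i)
  have := sq_nonneg z.2
  unfold sqNorm
  linarith

theorem sq_snd_le_sqNorm (z : SpaceTime N) : z.2 ^ 2 ≤ sqNorm z := by
  have := Finset.sum_nonneg (s := Finset.univ) fun i _ => sq_nonneg (z.1 i)
  unfold sqNorm
  linarith

theorem norm_le_of_sqNorm_le {z : SpaceTime N} {r : ℝ} (hr : 0 ≤ r) (h : sqNorm z ≤ r ^ 2) :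
    ‖z‖ ≤ r := by
  rw [Prod.norm_def, max_le_iff]
  refine ⟨(pi_norm_le_iff_of_nonneg hr).2 fun i => ?_, ?_⟩
  · exact abs_le_of_sq_le_sq ((sq_fst_le_sqNorm z i).trans h) hr
  · exact abs_le_of_sq_le_sq ((sq_snd_le_sqNorm z).trans h) hr

theorem hasFDerivAt_sqNorm (z : SpaceTime N) :
    HasFDerivAt sqNorm (∑ j, (2 * z.1 j) • ((ContinuousLinearMap.proj j).comp
        (ContinuousLinearMap.fst ℝ (Fin N → ℝ) ℝ)) +
      (2 * z.2) • ContinuousLinearMap.snd ℝ (Fin N → ℝ) ℝ) z := by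
  have h1 : ∀ j : Fin N, HasFDerivAt (fun z : SpaceTime N => z.1 j ^ 2)
      ((2 * z.1 j) • ((ContinuousLinearMap.proj j).comp
        (ContinuousLinearMap.fst ℝ (Fin N → ℝ) ℝ))) z := fun j => by
    have := ((ContinuousLinearMap.proj (R := ℝ) (φ := fun _ : Fin N => ℝ) j).comp
        (ContinuousLinearMap.fst ℝ (Fin N → ℝ) ℝ)).hasFDerivAt (x := z)
    simpa using this.pow 2
  have h2 : HasFDerivAt (fun z : SpaceTime N => z.2 ^ 2)
      ((2 * z.2) • ContinuousLinearMap.snd ℝ (Fin N → ℝ) ℝ) z := by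
    simpa using ((ContinuousLinearMap.snd ℝ (Fin N → ℝ) ℝ).hasFDerivAt (x := z)).pow 2
  exact (HasFDerivAt.fun_sum (u := Finset.univ) fun j _ => h1 j).add h2

theorem partialSpace_sqNorm (z : SpaceTime N) (i : Fin N) :
    partialSpace i sqNorm z = 2 * z.1 i := by
  rw [partialSpace, (hasFDerivAt_sqNorm z).fderiv]
  simp [Pi.single_apply]

theorem partialTime_sqNorm (z : SpaceTime N) : partialTime sqNorm z = 2 * z.2 := by
  rw [partialTime, (hasFDerivAt_sqNorm z).fderiv]
  simp

theorem exists_abs_deriv_smoothTransition_le :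
    ∃ C : ℝ, 0 < C ∧ ∀ s, |deriv Real.smoothTransition s| ≤ C := by
  have hs : HasCompactSupport (deriv Real.smoothTransition) := by
    refine HasCompactSupport.intro (K := Set.Icc 0 1) isCompact_Icc fun s hs => ?_
    rw [Set.mem_Icc, not_and_or, not_le, not_le] at hs
    rcases hs with h | h
    · have : Real.smoothTransition =ᶠ[𝓝 s] fun _ => 0 := by
        filter_upwards [gt_mem_nhds h] with t ht using Real.smoothTransition.zero_of_nonpos ht.le
      rw [this.deriv_eq, deriv_const]
    · have : Real.smoothTransition =ᶠ[𝓝 s] fun _ => 1 := by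
        filter_upwards [lt_mem_nhds h] with t ht using Real.smoothTransition.one_of_one_le ht.le
      rw [this.deriv_eq, deriv_const]
  have hc : ContDiff ℝ 1 Real.smoothTransition := Real.smoothTransition.contDiff (n := 1)
  obtain ⟨C, hC⟩ := hs.exists_bound_of_continuous (hc.continuous_deriv le_rfl)
  exact ⟨max C 1, by positivity, fun s => (hC s).trans (le_max_left _ _)⟩

/-- Take `ζ = σ^{m+1}` for a smooth step `σ` of the squared norm. Its derivatives are `O(σ^m)`, and
`σ^m ≤ ζ^{(p_i - 1)/p_i}` as soon as `p_i ≤ m + 1`. The radius `3/4` works because `1/2 ≤ (3/4)²`.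
-/
theorem exists_isCutoff (hp : ∀ i, 2 < p i) : ∃ C : ℝ, 0 < C ∧ ∀ s₀ s₁ : ℝ, s₀ < s₁ → s₁ ≤ 1 / 2 →
    ∃ ζ : SpaceTime N → ℝ, IsCutoff p ζ (3 / 4) (C / (s₁ - s₀)) ∧
      (∀ z, sqNorm z ≤ s₀ → ζ z = 1) ∧ ∀ z ∈ tsupport ζ, sqNorm z ≤ s₁ := by
  obtain ⟨C₀, hC₀, hC⟩ := exists_abs_deriv_smoothTransition_le
  obtain ⟨m, hm⟩ : ∃ m : ℕ, ∀ i, p i ≤ m := by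
    obtain ⟨m, hm⟩ := exists_nat_ge (∑ i, p i)
    exact ⟨m, fun i => (Finset.single_le_sum (f := p) (fun i _ => by linarith [hp i])
      (Finset.mem_univ i)).trans hm⟩
  refine ⟨(m + 1) * C₀ * 2, by positivity, fun s₀ s₁ hs hs₁ => ?_⟩
  have hd : 0 < s₁ - s₀ := by linarith
  set σ : SpaceTime N → ℝ := fun z => Real.smoothTransition ((s₁ - sqNorm z) / (s₁ - s₀)) with hσ
  have hq : ContDiff ℝ 1 (sqNorm (N := N)) := contDiff_sqNorm.of_le (by simp)
  have hσ0 : ∀ z, 0 ≤ σ z := fun z => Real.smoothTransition.nonneg _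
  have hσ1 : ∀ z, σ z ≤ 1 := fun z => Real.smoothTransition.le_one _
  have hσs : ContDiff ℝ 1 σ := (Real.smoothTransition.contDiff (n := 1)).comp
    ((contDiff_const.sub hq).div_const _)
  have hsupp : tsupport (fun z => σ z ^ (m + 1)) ⊆ {z | sqNorm z ≤ s₁} := by
    refine closure_minimal (fun z hz => ?_) (isClosed_le hq.continuous continuous_const)
    by_contra h
    refine hz ?_
    have h' : ¬sqNorm z ≤ s₁ := h
    have : σ z = 0 := Real.smoothTransition.zero_of_nonpos
      (div_nonpos_of_nonpos_of_nonneg (by linarith [not_le.1 h']) hd.le)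
    simp [this]
  have hsq : ∀ z ∈ tsupport (fun z => σ z ^ (m + 1)), sqNorm z ≤ 1 := fun z hz => by
    have : sqNorm z ≤ s₁ := hsupp hz
    linarith
  have hfd : ∀ z e, fderiv ℝ (fun z => σ z ^ (m + 1)) z e =
      (m + 1) * σ z ^ m * (deriv Real.smoothTransition ((s₁ - sqNorm z) / (s₁ - s₀)) *
        (-(fderiv ℝ sqNorm z e) / (s₁ - s₀))) := by
    intro z e
    have h1 : HasFDerivAt (fun z => (s₁ - sqNorm z) / (s₁ - s₀))
        ((s₁ - s₀)⁻¹ • -fderiv ℝ sqNorm z) z := by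
      simp only [div_eq_inv_mul]
      exact (((hq.differentiable one_ne_zero z).hasFDerivAt.const_sub s₁).const_mul _)
    have h2 : HasDerivAt Real.smoothTransition
        (deriv Real.smoothTransition ((s₁ - sqNorm z) / (s₁ - s₀)))
        ((s₁ - sqNorm z) / (s₁ - s₀)) :=
      ((Real.smoothTransition.contDiff (n := 1)).differentiable one_ne_zero _).hasDerivAt
    have h3 := h2.comp_hasFDerivAt (f := fun z => (s₁ - sqNorm z) / (s₁ - s₀)) z h1
    have h4 := HasFDerivAt.pow (n := m + 1) h3
    have h5 : fderiv ℝ (fun z => σ z ^ (m + 1)) z = _ := h4.fderiv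
    rw [h5]
    simp only [FunLike.coe_smul, FunLike.coe_neg, Pi.smul_apply,
          Pi.neg_apply, smul_eq_mul, nsmul_eq_mul, Function.comp_apply, hσ]
    simp only [add_tsub_cancel_right]
    push_cast
    ring
  have hbase : ∀ z e (a : ℝ), fderiv ℝ sqNorm z e = 2 * a → |a| ≤ 1 →
      |fderiv ℝ (fun z => σ z ^ (m + 1)) z e| ≤ (m + 1) * C₀ * 2 / (s₁ - s₀) * σ z ^ m := by
    intro z e a he ha
    rw [hfd, he, abs_mul, abs_of_nonneg (mul_nonneg (by positivity) (pow_nonneg (hσ0 z) m)),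
      abs_mul, abs_div, abs_neg, abs_mul, abs_two, abs_of_pos hd]
    have h1 := hC ((s₁ - sqNorm z) / (s₁ - s₀))
    calc (m + 1) * σ z ^ m * (|deriv Real.smoothTransition ((s₁ - sqNorm z) / (s₁ - s₀))| *
          (2 * |a| / (s₁ - s₀)))
        ≤ (m + 1) * σ z ^ m * (C₀ * (2 * 1 / (s₁ - s₀))) := by
          have := hσ0 z
          gcongr
      _ = _ := by ring
  refine ⟨fun z => σ z ^ (m + 1), ⟨by norm_num, hσs.pow _, fun z hz => ?_,
    fun z => pow_nonneg (hσ0 z) _, fun z => pow_le_one₀ (hσ0 z) (hσ1 z), by positivity,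
    fun z => ?_, fun i z => ?_⟩, fun z hz => ?_, hsupp⟩
  · rw [mem_closedBall_zero_iff]
    have : sqNorm z ≤ s₁ := hsupp hz
    exact norm_le_of_sqNorm_le (by norm_num) (by linarith)
  · by_cases hz : z ∈ tsupport (fun z => σ z ^ (m + 1))
    · refine (hbase z _ z.2 (partialTime_sqNorm z) ?_).trans
        (mul_le_of_le_one_right (by positivity) (pow_le_one₀ (hσ0 z) (hσ1 z)))
      exact abs_le_of_sq_le_sq (by simpa using (sq_snd_le_sqNorm z).trans (hsq z hz)) zero_le_one
    · rw [partialTime_eq_zero_of_notMem_tsupport hz, abs_zero]; positivity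
  · have hσz := hσ0 z
    by_cases hz : z ∈ tsupport (fun z => σ z ^ (m + 1))
    · refine (hbase z _ (z.1 i) (partialSpace_sqNorm z i) ?_).trans
        (mul_le_mul_of_nonneg_left ?_ (by positivity))
      · exact abs_le_of_sq_le_sq (by simpa using (sq_fst_le_sqNorm z i).trans (hsq z hz))
          zero_le_one
      · have hpi := hp i
        have hmi := hm i
        rcases (hσ0 z).eq_or_lt with h0 | h0
        · rw [← h0, zero_pow (by rintro rfl; norm_num at hmi; linarith)]
          positivity
        · rw [← Real.rpow_natCast, ← Real.rpow_natCast, ← Real.rpow_mul hσz]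
          refine Real.rpow_le_rpow_of_exponent_ge h0 (hσ1 z) ?_
          rw [← mul_div_assoc, div_le_iff₀ (by linarith)]
          push_cast
          nlinarith
    · rw [partialSpace_eq_zero_of_notMem_tsupport hz, abs_zero]
      positivity
  · have : σ z = 1 := Real.smoothTransition.one_of_one_le (by rw [le_div_iff₀ hd]; linarith)
    simp [this]

end Cutoff

/-! ### Fast geometric convergence -/

section Iteration

variable {N : ℕ} {p : Fin N → ℝ}

theorem exists_fast_convergence (hN : N ≠ 0) {C b : ℝ} (hC : 0 < C) (hb : 1 < b) :
    ∃ ν ρ : ℝ, 0 < ν ∧ 0 < ρ ∧ ρ < 1 ∧ ∀ n : ℕ,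
      C * b ^ n * (ν * ρ ^ n) ^ (1 / (N : ℝ)) * (ν * ρ ^ n) ≤ ν * ρ ^ (n + 1) := by
  have hb0 : 0 < b := by linarith
  -- With `ρ = b^{-N}` the root `ρ^{n/N}` cancels `b^n`; then `ν^{1/N} = ρ / C` gives equality.
  refine ⟨(b⁻¹ ^ N / C) ^ N, b⁻¹ ^ N, by positivity, by positivity,
    pow_lt_one₀ (by positivity) (inv_lt_one_of_one_lt₀ hb) hN, fun n => ?_⟩
  have e : ((b⁻¹ ^ N / C) ^ N * (b⁻¹ ^ N) ^ n) ^ (1 / (N : ℝ)) = b⁻¹ ^ N / C * b⁻¹ ^ n := by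
    rw [← pow_mul, mul_comm N n, pow_mul, ← mul_pow, one_div,
      Real.pow_rpow_inv_natCast (by positivity) hN]
  rw [e]
  refine le_of_eq ?_
  have : b ^ n * b⁻¹ ^ n = 1 := by rw [← mul_pow, mul_inv_cancel₀ hb0.ne', one_pow]
  calc C * b ^ n * (b⁻¹ ^ N / C * b⁻¹ ^ n) * ((b⁻¹ ^ N / C) ^ N * (b⁻¹ ^ N) ^ n)
      = (b ^ n * b⁻¹ ^ n) * (C / C) * ((b⁻¹ ^ N / C) ^ N * (b⁻¹ ^ N) ^ (n + 1)) := by ring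
    _ = _ := by rw [this, div_self hC.ne']; ring

end Iteration

/-! ### De Giorgi's lemma at unit scale -/

section DeGiorgiIteration

variable {N : ℕ} {p : Fin N → ℝ} {L D x : ℝ} {m : ℕ}

theorem energyConst_mul_le (hL : 0 ≤ L) (hD : 0 ≤ D) (hx : 1 ≤ x)
    (hm : m ≠ 0) (hpm : ∀ i, p i ≤ m) :
    energyConst p L (D * x) ≤ energyConst p L D * x ^ m := by
  have hx0 : 0 ≤ x := by linarith
  have hxm : x ≤ x ^ m := le_self_pow₀ hx hm
  unfold energyConst
  rw [add_mul, Finset.sum_mul]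
  refine add_le_add ?_ (Finset.sum_le_sum fun i _ => ?_)
  · rw [← mul_assoc]
    gcongr
  · rw [← mul_assoc, Real.mul_rpow (by positivity) hx0, ← mul_assoc]
    refine mul_le_mul_of_nonneg_left ?_ (by positivity)
    rw [← Real.rpow_natCast]
    exact Real.rpow_le_rpow_of_exponent_le hx (hpm i)

theorem gradConst_mul_le (hL : 0 ≤ L) (hD : 0 ≤ D) (hx : 1 ≤ x)
    (hm : m ≠ 0) (hpm : ∀ i, p i ≤ m) :
    gradConst p L (D * x) ≤ gradConst p L D * x ^ m := by
  have hx0 : 0 ≤ x := by linarith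
  have hxm : x ≤ x ^ m := le_self_pow₀ hx hm
  have h1 := energyConst_mul_le hL hD hx hm hpm
  have h2 : 2 * L + L ^ 2 * (D * x) ≤ (2 * L + L ^ 2 * D) * x ^ m := by
    have e1 : 2 * L * 1 ≤ 2 * L * x ^ m := by gcongr; exact one_le_pow₀ hx
    have e2 : L ^ 2 * D * x ≤ L ^ 2 * D * x ^ m := by gcongr
    nlinarith
  have h3 : (N : ℝ) * (2 * L + L ^ 2 * (D * x)) ≤ N * ((2 * L + L ^ 2 * D) * x ^ m) := by gcongr
  unfold gradConst
  nlinarith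

/-- Isolates the dependence on the step, where `x = 2^n`. The power `2m + 5` is `m + 3` from the
energy constant and `μ^{-3}` (their `N`-th root is simply dropped), `m` from the gradient constant
and `2` from `μ^{-2}`. -/
theorem step_bound (hN : N ≠ 0) (hL : 0 ≤ L) (hD : 0 ≤ D) (hx : 1 ≤ x)
    (hm : m ≠ 0) (hpm : ∀ i, p i ≤ m) {η y : ℝ} (hη : 0 < η) (hy : 0 < y) :
    ((3 * energyConst p L (D * x) + 1) * y / (η / (4 * x)) ^ 3) ^ (1 / (N : ℝ)) *
        (gradConst p L (D * x) * y) / (2 * (η / (4 * x)) ^ 2) ≤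
      (64 * (3 * energyConst p L D + 1) / η ^ 3) ^ (1 / (N : ℝ)) *
        (8 * (gradConst p L D + 1) / η ^ 2) * x ^ (2 * m + 5) * y ^ (1 / (N : ℝ)) * y := by
  have hx0 : 0 < x := by linarith
  have hK := energyConst_nonneg (p := p) hL hD
  have hK' := energyConst_nonneg (p := p) hL (mul_nonneg hD hx0.le)
  have hG := gradConst_nonneg (p := p) hL hD
  have hG' := gradConst_nonneg (p := p) hL (mul_nonneg hD hx0.le)
  have hxm : 1 ≤ x ^ m := one_le_pow₀ hx
  have hN1 : (1 : ℝ) ≤ N := by exact_mod_cast Nat.one_le_iff_ne_zero.2 hN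
  have h1 : 3 * energyConst p L (D * x) + 1 ≤ (3 * energyConst p L D + 1) * x ^ m := by
    have := energyConst_mul_le hL hD hx hm hpm
    nlinarith
  have h2 : gradConst p L (D * x) ≤ (gradConst p L D + 1) * x ^ m := by
    have := gradConst_mul_le hL hD hx hm hpm
    nlinarith
  have h3 : ((3 * energyConst p L (D * x) + 1) * y / (η / (4 * x)) ^ 3) ^ (1 / (N : ℝ)) ≤
      (64 * (3 * energyConst p L D + 1) / η ^ 3) ^ (1 / (N : ℝ)) * x ^ (m + 3) *
        y ^ (1 / (N : ℝ)) := by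
    calc ((3 * energyConst p L (D * x) + 1) * y / (η / (4 * x)) ^ 3) ^ (1 / (N : ℝ))
        ≤ ((3 * energyConst p L D + 1) * x ^ m * y / (η / (4 * x)) ^ 3) ^ (1 / (N : ℝ)) := by
          gcongr
      _ = (64 * (3 * energyConst p L D + 1) / η ^ 3 * x ^ (m + 3) * y) ^ (1 / (N : ℝ)) := by
          congr 1; field_simp; ring
      _ = (64 * (3 * energyConst p L D + 1) / η ^ 3) ^ (1 / (N : ℝ)) *
          (x ^ (m + 3)) ^ (1 / (N : ℝ)) * y ^ (1 / (N : ℝ)) := by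
          rw [Real.mul_rpow (by positivity) hy.le, Real.mul_rpow (by positivity) (by positivity)]
      _ ≤ _ := by
          gcongr
          exact Real.rpow_le_self_of_one_le (one_le_pow₀ hx) (by rw [div_le_one] <;> linarith)
  calc ((3 * energyConst p L (D * x) + 1) * y / (η / (4 * x)) ^ 3) ^ (1 / (N : ℝ)) *
        (gradConst p L (D * x) * y) / (2 * (η / (4 * x)) ^ 2)
      ≤ ((64 * (3 * energyConst p L D + 1) / η ^ 3) ^ (1 / (N : ℝ)) * x ^ (m + 3) *
        y ^ (1 / (N : ℝ))) * ((gradConst p L D + 1) * x ^ m * y) /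
          (2 * (η / (4 * x)) ^ 2) := by gcongr
    _ = _ := by
      generalize (64 * (3 * energyConst p L D + 1) / η ^ 3) ^ (1 / (N : ℝ)) = a
      generalize y ^ (1 / (N : ℝ)) = b
      field_simp
      ring

/-- De Giorgi's lemma at unit scale: a super-solution which is bounded below and lies above the
level `l` outside a set of small measure lies above `l - η` near the centre. -/
theorem exists_deGiorgi (hN : N ≠ 0) (hp : ∀ i, 2 < p i) {η : ℝ} (hL : 0 ≤ L) (hη : 0 < η) :
    ∃ ν : ℝ, 0 < ν ∧ ∀ (u : SpaceTime N → ℝ) (v : Fin N → SpaceTime N → ℝ) (l : ℝ),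
      IsUnitSuperSolution p u v → Measurable u →
      (∀ᵐ z, z ∈ Metric.ball (0 : SpaceTime N) 1 → l - L ≤ u z) →
      volume {z | z ∈ Metric.ball (0 : SpaceTime N) 1 ∧ u z < l} ≤ ENNReal.ofReal ν →
      ∀ᵐ z, sqNorm z ≤ 1 / 4 → l - η ≤ u z := by
  obtain ⟨C, hC, hcut⟩ := exists_isCutoff hp
  obtain ⟨m, hm, hpm⟩ : ∃ m : ℕ, m ≠ 0 ∧ ∀ i, p i ≤ m := by
    obtain ⟨m, hm⟩ := exists_nat_ge (∑ i, p i)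
    refine ⟨m + 1, by omega, fun i => ?_⟩
    have := Finset.single_le_sum (f := p) (fun i _ => by linarith [hp i]) (Finset.mem_univ i)
    push_cast
    linarith
  have hD : 0 ≤ 8 * C := by positivity
  have hK := energyConst_nonneg (p := p) hL hD
  have hG := gradConst_nonneg (p := p) hL hD
  obtain ⟨ν, ρ, hν, hρ, hρ1, hfast⟩ := exists_fast_convergence hN
    (C := (64 * (3 * energyConst p L (8 * C) + 1) / η ^ 3) ^ (1 / (N : ℝ)) *
        (8 * (gradConst p L (8 * C) + 1) / η ^ 2)) (b := 2 ^ (2 * m + 5)) (by positivity)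
    (one_lt_pow₀ (by norm_num) (by omega))
  refine ⟨ν, hν, fun u v l hsup hum hlow hsmall => ?_⟩
  -- Squared radii decrease from `1/2` to `1/4` and levels from `l` to `l - η`. The `n`-th drop in
  -- level is `2 μ` with `μ = η / (4 · 2^n)`, and the cutoff slope is `8 C · 2^n`.
  set s : ℕ → ℝ := fun n => 1 / 4 + 1 / 4 * (1 / 2) ^ n with hs
  set k : ℕ → ℝ := fun n => l - η * (1 - (1 / 2) ^ n) with hk
  have hpow : ∀ n : ℕ, (0 : ℝ) < (1 / 2) ^ n ∧ (1 / 2 : ℝ) ^ n ≤ 1 := fun n =>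
    ⟨by positivity, pow_le_one₀ (by norm_num) (by norm_num)⟩
  have hinv : ∀ n : ℕ, (1 / 2 : ℝ) ^ n = 1 / 2 ^ n := fun n => by
    rw [div_pow, one_pow]
  have hY : ∀ n, volume {z : SpaceTime N | sqNorm z ≤ s n ∧ u z < k n} ≤
      ENNReal.ofReal (ν * ρ ^ n) := by
    intro n
    induction n with
    | zero =>
      refine (measure_mono fun z hz => ?_).trans (hsmall.trans (by simp))
      obtain ⟨h1, h2⟩ := hz
      refine ⟨mem_ball_zero_iff.2 ?_, ?_⟩
      · refine (norm_le_of_sqNorm_le (r := 3 / 4) (by norm_num) (h1.trans ?_)).trans_lt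
          (by norm_num)
        norm_num [hs]
      · simpa [hk] using h2
    | succ n ih =>
      have hlt : s (n + 1) < s n := by
        simp only [hs, pow_succ]; linarith [(hpow n).1]
      obtain ⟨ζ, hζ, hζ1, hζs⟩ := hcut (s (n + 1)) (s n) hlt (by
        simp only [hs]; linarith [(hpow n).2])
      have hDn : C / (s n - s (n + 1)) = 8 * C * 2 ^ n := by
        have : s n - s (n + 1) = 1 / (8 * 2 ^ n) := by
          simp only [hs, hinv, pow_succ]; field_simp; ring
        rw [this]; field_simp
      rw [hDn] at hζ
      have hkl : k n ≤ l := by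
        simp only [hk]; nlinarith [(hpow n).2]
      have hx : (1 : ℝ) ≤ 2 ^ n := one_le_pow₀ (by norm_num)
      have hy : 0 < ν * ρ ^ n := by positivity
      have hkk : k (n + 1) ≤ k n - 2 * (η / (4 * 2 ^ n)) := by
        refine le_of_eq ?_
        simp only [hk, hinv, pow_succ]; field_simp; ring
      have hstep := hsup.volume_le_of_cutoff hN hum hp (k := k n) hL
        (hlow.mono fun z hz hzb => by linarith [hz hzb]) hζ
        (μ := η / (4 * 2 ^ n)) (by positivity) hy
        (le_trans (measure_mono (t := {z | sqNorm z ≤ s n ∧ u z < k n})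
          fun z hz => ⟨hζs z hz.1, hz.2⟩) ih)
      calc volume {z : SpaceTime N | sqNorm z ≤ s (n + 1) ∧ u z < k (n + 1)}
          ≤ volume {z | ζ z = 1 ∧ u z ≤ k n - 2 * (η / (4 * 2 ^ n))} :=
            measure_mono fun z hz => ⟨hζ1 z hz.1, hz.2.le.trans hkk⟩
        _ ≤ _ := hstep
        _ ≤ ENNReal.ofReal (ν * ρ ^ (n + 1)) := by
          refine ENNReal.ofReal_le_ofReal ((step_bound hN hL hD hx hm hpm hη hy).trans ?_)
          refine le_trans (le_of_eq ?_) (hfast n)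
          rw [← pow_mul, ← pow_mul, mul_comm n]
  -- This set lies in every set of the iteration, whose measures tend to zero.
  have hzero : volume {z : SpaceTime N | sqNorm z ≤ 1 / 4 ∧ u z < l - η} = 0 := by
    have hlim : Tendsto (fun n => ENNReal.ofReal (ν * ρ ^ n)) atTop (𝓝 0) := by
      have := (tendsto_pow_atTop_nhds_zero_of_lt_one hρ.le hρ1).const_mul ν
      rw [mul_zero] at this
      simpa using ENNReal.tendsto_ofReal this
    refine le_antisymm (ge_of_tendsto' hlim fun n => (measure_mono fun z hz => ?_).trans (hY n))
      zero_le
    refine ⟨hz.1.trans ?_, hz.2.trans_le ?_⟩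
    · simp only [hs]; linarith [(hpow n).1]
    · simp only [hk]; nlinarith [(hpow n).1]
  rw [ae_iff]
  refine measure_mono_null (fun z hz => ?_) hzero
  have hz' : ¬(sqNorm z ≤ 1 / 4 → l - η ≤ u z) := hz
  push Not at hz'
  exact hz'

end DeGiorgiIteration

/-! ### Anisotropic dilations -/

section Scaling

variable {N : ℕ} {p : Fin N → ℝ} {τ : ℝ}

/-- The anisotropic dilation `(y, s) ↦ (τ^{1/p_i} y_i, τ s)`, under which the equation is
invariant. -/
noncomputable def dilation (p : Fin N → ℝ) (hτ : 0 < τ) : SpaceTime N ≃L[ℝ] SpaceTime N :=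
  (LinearEquiv.prodCongr
    (LinearEquiv.piCongrRight fun i =>
      LinearEquiv.smulOfNeZero ℝ ℝ (τ ^ (1 / p i)) (Real.rpow_pos_of_pos hτ _).ne')
    (LinearEquiv.smulOfNeZero ℝ ℝ τ hτ.ne')).toContinuousLinearEquiv

theorem dilation_apply (hτ : 0 < τ) (y : SpaceTime N) :
    dilation p hτ y = (fun i => τ ^ (1 / p i) * y.1 i, τ * y.2) := rfl

/-- The dilation followed by the translation by `z`. -/
noncomputable def rescaling (p : Fin N → ℝ) (hτ : 0 < τ) (z : SpaceTime N) :
    SpaceTime N ≃ₜ SpaceTime N :=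
  (dilation p hτ).toHomeomorph.trans (Homeomorph.addLeft z)

theorem rescaling_apply (hτ : 0 < τ) (z y : SpaceTime N) :
    rescaling p hτ z y = z + dilation p hτ y := rfl

theorem hasFDerivAt_rescaling (hτ : 0 < τ) (z y : SpaceTime N) :
    HasFDerivAt (rescaling p hτ z) (dilation p hτ : SpaceTime N →L[ℝ] SpaceTime N) y :=
  (dilation p hτ).hasFDerivAt.const_add z

theorem contDiff_rescaling_symm (hτ : 0 < τ) (z : SpaceTime N) :
    ContDiff ℝ ∞ (rescaling p hτ z).symm :=
  (dilation p hτ).symm.contDiff.comp (contDiff_const.add contDiff_id)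

/-- The explicit Jacobian is never used; it is enough that it is finite and nonzero. -/
theorem exists_map_rescaling (p : Fin N → ℝ) (hτ : 0 < τ) : ∃ c : ENNReal, c ≠ 0 ∧ c ≠ ⊤ ∧
    ∀ z, Measure.map (rescaling p hτ z) volume = c • (volume : Measure (SpaceTime N)) := by
  set f : SpaceTime N →ₗ[ℝ] SpaceTime N := (dilation p hτ).toLinearEquiv.toLinearMap with hf
  have hdet : LinearMap.det f ≠ 0 := (LinearEquiv.isUnit_det' (dilation p hτ).toLinearEquiv).ne_zero
  refine ⟨ENNReal.ofReal |(LinearMap.det f)⁻¹|, by simpa using hdet, ENNReal.ofReal_ne_top,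
    fun z => ?_⟩
  have h1 := Measure.map_linearMap_addHaar_eq_smul_addHaar (volume : Measure (SpaceTime N)) hdet
  have h2 : (rescaling p hτ z : SpaceTime N → SpaceTime N) = (fun y => z + y) ∘ f := rfl
  have hfm : Measurable f := (dilation p hτ).continuous.measurable
  rw [h2, ← Measure.map_map (measurable_const_add z) hfm, h1,
    Measure.map_smul, map_add_left_eq_self]

theorem ae_comp_rescaling_iff (hτ : 0 < τ) (z : SpaceTime N) {P : SpaceTime N → Prop} :
    (∀ᵐ y, P (rescaling p hτ z y)) ↔ ∀ᵐ w, P w := by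
  obtain ⟨c, hc0, -, hc⟩ := exists_map_rescaling p hτ
  rw [← (rescaling p hτ z).measurableEmbedding.ae_map_iff, hc,
    Measure.ae_ennreal_smul_measure_eq hc0]

theorem integrable_comp_rescaling (hτ : 0 < τ) (z : SpaceTime N) {f : SpaceTime N → ℝ}
    (hf : Integrable f) : Integrable fun y => f (rescaling p hτ z y) := by
  obtain ⟨c, -, hct, hc⟩ := exists_map_rescaling p hτ
  have h := (rescaling p hτ z).measurableEmbedding.integrable_map_iff (μ := volume) (g := f)
  rw [hc] at h
  exact h.1 (hf.smul_measure hct)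

theorem exists_integral_comp_rescaling (p : Fin N → ℝ) (hτ : 0 < τ) (z : SpaceTime N) :
    ∃ c : ℝ, 0 ≤ c ∧ ∀ f : SpaceTime N → ℝ, ∫ y, f (rescaling p hτ z y) = c * ∫ w, f w := by
  obtain ⟨c, -, -, hc⟩ := exists_map_rescaling p hτ
  refine ⟨c.toReal, ENNReal.toReal_nonneg, fun f => ?_⟩
  rw [← (rescaling p hτ z).measurableEmbedding.integral_map, hc, integral_smul_measure, smul_eq_mul]

theorem partialSpace_comp_rescaling (hτ : 0 < τ) (z : SpaceTime N) {Φ : SpaceTime N → ℝ}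
    (hΦ : Differentiable ℝ Φ) (i : Fin N) (y : SpaceTime N) :
    partialSpace i (fun y => Φ (rescaling p hτ z y)) y =
      τ ^ (1 / p i) * partialSpace i Φ (rescaling p hτ z y) := by
  have h := ((hΦ (rescaling p hτ z y)).hasFDerivAt.comp y (hasFDerivAt_rescaling hτ z y)).fderiv
  have e : (dilation p hτ) ((Pi.single i 1, 0) : SpaceTime N) =
      τ ^ (1 / p i) • ((Pi.single i 1, 0) : SpaceTime N) := by
    rw [dilation_apply]
    refine Prod.ext ?_ (by simp)
    ext j
    by_cases hj : j = i
    · subst hj; simp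
    · simp [hj]
  rw [partialSpace, show (fun y => Φ (rescaling p hτ z y)) = Φ ∘ rescaling p hτ z from rfl, h]
  change fderiv ℝ Φ _ (dilation p hτ _) = _
  rw [e, map_smul, smul_eq_mul, partialSpace]

theorem partialTime_comp_rescaling (hτ : 0 < τ) (z : SpaceTime N) {Φ : SpaceTime N → ℝ}
    (hΦ : Differentiable ℝ Φ) (y : SpaceTime N) :
    partialTime (fun y => Φ (rescaling p hτ z y)) y =
      τ * partialTime Φ (rescaling p hτ z y) := by
  have h := ((hΦ (rescaling p hτ z y)).hasFDerivAt.comp y (hasFDerivAt_rescaling hτ z y)).fderiv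
  have e : (dilation p hτ) ((0, 1) : SpaceTime N) = τ • ((0, 1) : SpaceTime N) := by
    rw [dilation_apply]
    refine Prod.ext ?_ (by simp)
    ext j
    simp
  rw [partialTime, show (fun y => Φ (rescaling p hτ z y)) = Φ ∘ rescaling p hτ z from rfl, h]
  change fderiv ℝ Φ _ (dilation p hτ _) = _
  rw [e, map_smul, smul_eq_mul, partialTime]

/-- The radius of a ball containing the image of the unit ball under the dilation. -/
noncomputable def dilationRadius (p : Fin N → ℝ) (τ : ℝ) : ℝ := ∑ i, τ ^ (1 / p i) + τ

theorem rpow_le_dilationRadius (hτ : 0 < τ) (i : Fin N) : τ ^ (1 / p i) ≤ dilationRadius p τ := by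
  have := Finset.single_le_sum (f := fun i => τ ^ (1 / p i)) (fun i _ => by positivity)
    (Finset.mem_univ i)
  unfold dilationRadius
  linarith

theorem le_dilationRadius (hτ : 0 < τ) : τ ≤ dilationRadius p τ := by
  have := Finset.sum_nonneg (s := Finset.univ)
    fun (i : Fin N) _ => (Real.rpow_pos_of_pos hτ (1 / p i)).le
  unfold dilationRadius
  linarith

theorem norm_dilation_le (hτ : 0 < τ) (y : SpaceTime N) :
    ‖dilation p hτ y‖ ≤ dilationRadius p τ * ‖y‖ := by
  have h0 : 0 ≤ dilationRadius p τ := hτ.le.trans (le_dilationRadius hτ)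
  rw [dilation_apply, Prod.norm_def, max_le_iff]
  refine ⟨(pi_norm_le_iff_of_nonneg (by positivity)).2 fun i => ?_, ?_⟩
  · simp only [norm_mul]
    rw [Real.norm_of_nonneg (by positivity)]
    exact mul_le_mul (rpow_le_dilationRadius hτ i)
      ((norm_le_pi_norm y.1 i).trans (norm_fst_le y)) (norm_nonneg _) h0
  · simp only [norm_mul]
    rw [Real.norm_of_nonneg hτ.le]
    exact mul_le_mul (le_dilationRadius hτ) (norm_snd_le y) (norm_nonneg _) h0

theorem tendsto_dilationRadius (hp : ∀ i, 2 < p i) :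
    Tendsto (dilationRadius p) (𝓝 0) (𝓝 0) := by
  have h1 : ∀ i, Tendsto (fun τ : ℝ => τ ^ (1 / p i)) (𝓝 0) (𝓝 0) := fun i => by
    have hpi : 0 < 1 / p i := by have := hp i; positivity
    have := (Real.continuousAt_rpow_const 0 (1 / p i) (Or.inr hpi.le)).tendsto
    rwa [Real.zero_rpow hpi.ne'] at this
  have := (tendsto_finsetSum Finset.univ fun i _ => h1 i).add (tendsto_id (x := 𝓝 (0 : ℝ)))
  change Tendsto (fun τ => ∑ i, τ ^ (1 / p i) + τ) _ _
  simpa using this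

end Scaling

/-! ### Rescaling super-solutions to the unit ball -/

section Localization

variable {N : ℕ} {p : Fin N → ℝ} {Ω : Set (Fin N → ℝ)} {T : ℝ} {u : SpaceTime N → ℝ}
  {v : Fin N → SpaceTime N → ℝ}

theorem integrable_mul_of_tsupport {f g : SpaceTime N → ℝ} {C : Set (SpaceTime N)}
    (hC : IsCompact C) (hf : IntegrableOn f C) (hg : Continuous g) (hgC : ∀ z ∉ C, g z = 0) :
    Integrable fun z => f z * g z := by
  have h1 : IntegrableOn (fun z => f z * g z) C :=
    hf.mul_continuousOn hg.continuousOn hC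
  exact (integrableOn_iff_integrable_of_support_subset fun z hz => by
    by_contra h
    exact hz (by simp [hgC z h])).1 h1

theorem HasParabolicWeakGradient.integrableOn_grad (h : HasParabolicWeakGradient p Ω T u v)
    (hp : ∀ i, 2 < p i) {C : Set (SpaceTime N)} (hC : IsCompact C) (hCΩ : C ⊆ omegaT Ω T)
    (i : Fin N) : IntegrableOn (v i) C := by
  have : IsFiniteMeasure (volume.restrict C) := ⟨by
    rw [Measure.restrict_apply_univ]; exact hC.measure_lt_top⟩
  refine (h.memLp i C hC hCΩ).integrable ?_
  rw [ENNReal.one_le_ofReal]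
  linarith [hp i]

/-- Time slices of `φ` are admissible for the slicewise weak derivative, and Fubini assembles them.
For times outside `(-T, T)` both sides vanish. -/
theorem HasParabolicWeakGradient.integral_mul_partialSpace
    (h : HasParabolicWeakGradient p Ω T u v) (hp : ∀ i, 2 < p i) {φ : SpaceTime N → ℝ}
    (hφ : ContDiff ℝ ∞ φ) (hc : HasCompactSupport φ) (hs : tsupport φ ⊆ omegaT Ω T) (i : Fin N) :
    ∫ z, u z * partialSpace i φ z = -∫ z, v i z * φ z := by
  have hd : Continuous (partialSpace i φ) :=
    (hφ.continuous_fderiv (by simp)).clm_apply continuous_const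
  have i1 : Integrable fun z => u z * partialSpace i φ z :=
    integrable_mul_of_tsupport hc.isCompact
      (h.locallyIntegrableOn.integrableOn_compact_subset hs hc.isCompact) hd
      fun z hz => partialSpace_eq_zero_of_notMem_tsupport hz i
  have i2 : Integrable fun z => v i z * φ z :=
    integrable_mul_of_tsupport hc.isCompact (h.integrableOn_grad hp hc.isCompact hs i)
      hφ.continuous fun z hz => image_eq_zero_of_notMem_tsupport hz
  rw [Measure.volume_eq_prod, integral_prod_symm _ (by rwa [← Measure.volume_eq_prod]),
    integral_prod_symm _ (by rwa [← Measure.volume_eq_prod]), ← integral_neg]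
  refine integral_congr_ae ?_
  filter_upwards [(ae_restrict_iff' measurableSet_Ioo).1 h.weakDeriv] with t ht
  have hzero : ∀ x, (x, t) ∉ tsupport φ → φ (x, t) = 0 ∧ partialSpace i φ (x, t) = 0 :=
    fun x hx => ⟨image_eq_zero_of_notMem_tsupport hx, partialSpace_eq_zero_of_notMem_tsupport hx i⟩
  by_cases htT : t ∈ Set.Ioo (-T) T
  · have hsl : ContDiff ℝ ∞ fun x => φ (x, t) := hφ.comp (contDiff_id.prodMk contDiff_const)
    have hK : IsCompact (Prod.fst '' tsupport φ) := hc.isCompact.image continuous_fst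
    have hsub : tsupport (fun x => φ (x, t)) ⊆ Prod.fst '' tsupport φ := by
      refine closure_minimal (fun x hx => ?_) hK.isClosed
      exact ⟨(x, t), subset_closure hx, rfl⟩
    have hcs : HasCompactSupport fun x => φ (x, t) :=
      hK.of_isClosed_subset (isClosed_tsupport _) hsub
    have hΩs : Prod.fst '' tsupport φ ⊆ Ω := by
      rintro _ ⟨z, hz, rfl⟩
      exact (hs hz).1
    have key := (ht htT i).integral_eq _ hsl hcs (hsub.trans hΩs)
    have hfd : ∀ x, fderiv ℝ (fun x => φ (x, t)) x (Pi.single i 1) = partialSpace i φ (x, t) := by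
      intro x
      have h1 := ((hφ.differentiable (by simp)) (x, t)).hasFDerivAt
      have h2 : HasFDerivAt (fun x : Fin N → ℝ => ((x, t) : SpaceTime N))
          ((ContinuousLinearMap.id ℝ _).prod 0) x :=
        (hasFDerivAt_id x).prodMk (hasFDerivAt_const t x)
      have h3 := (h1.comp x h2).fderiv
      rw [show (fun x => φ (x, t)) = φ ∘ fun x => (x, t) from rfl, h3]
      rfl
    simp only [hfd] at key
    rwa [setIntegral_eq_integral_of_forall_compl_eq_zero fun x hx => by
        rw [(hzero x fun h' => hx (hs h').1).2, mul_zero],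
      setIntegral_eq_integral_of_forall_compl_eq_zero fun x hx => by
        rw [(hzero x fun h' => hx (hs h').1).1, mul_zero]] at key
  · have hz : ∀ x, (x, t) ∉ tsupport φ := fun x h' => htT (hs h').2
    simp [(hzero _ (hz _)).1, (hzero _ (hz _)).2]

/-- Each spatial derivative gains `τ^{1/p_i}`, so the flux paired with `∂_i φ` gains
`(τ^{1/p_i})^{p_i} = τ`, the same factor as the time derivative. The equation is invariant and `u`
keeps its values. -/
theorem isUnitSuperSolution_rescaling (h : HasParabolicWeakGradient p Ω T u v)
    (hsup : ∀ t₁ t₂ : ℝ, -T < t₁ → t₁ < t₂ → t₂ < T →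
      ∀ K : Set (Fin N → ℝ), IsCompact K → K ⊆ Ω →
      ∀ φ : SpaceTime N → ℝ, ContDiff ℝ ∞ φ → (∀ z, 0 ≤ φ z) →
        (∀ x t, x ∉ K → φ (x, t) = 0) →
        0 ≤ ((∫ x in K, u (x, t₂) * φ (x, t₂)) - ∫ x in K, u (x, t₁) * φ (x, t₁)) +
          ∫ z in K ×ˢ Set.Ioc t₁ t₂,
            (- u z * partialTime φ z +
              ∑ i, |v i z| ^ (p i - 2) * v i z * partialSpace i φ z))
    (hp : ∀ i, 2 < p i) {τ : ℝ} (hτ : 0 < τ) (z : SpaceTime N)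
    (hbox : rescaling p hτ z '' Metric.closedBall 0 1 ⊆ omegaT Ω T) :
    IsUnitSuperSolution p
      ((Metric.ball 0 1).indicator fun y => u (rescaling p hτ z y))
      (fun i => (Metric.ball 0 1).indicator fun y => τ ^ (1 / p i) * v i (rescaling p hτ z y)) := by
  set S := rescaling p hτ z with hS
  set B := Metric.ball (0 : SpaceTime N) 1 with hB
  have hC : IsCompact (S '' Metric.closedBall 0 1) := (isCompact_closedBall _ _).image S.continuous
  have hsubC : S '' B ⊆ S '' Metric.closedBall 0 1 := Set.image_mono Metric.ball_subset_closedBall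
  have hBm : MeasurableSet (S '' B) := (S.isOpenMap _ Metric.isOpen_ball).measurableSet
  have hind : ∀ f : SpaceTime N → ℝ, B.indicator (fun y => f (S y)) =
      fun y => (S '' B).indicator f (S y) := by
    intro f
    ext y
    by_cases hy : y ∈ B
    · rw [Set.indicator_of_mem hy, Set.indicator_of_mem (Set.mem_image_of_mem _ hy)]
    · rw [Set.indicator_of_notMem hy, Set.indicator_of_notMem
        (fun h' => hy (S.injective.mem_set_image.1 h'))]
  have hintcomp : ∀ f : SpaceTime N → ℝ, IntegrableOn f (S '' Metric.closedBall 0 1) →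
      Integrable (B.indicator fun y => f (S y)) := by
    intro f hf
    rw [hind]
    exact integrable_comp_rescaling hτ z
      ((integrable_indicator_iff hBm).2 (hf.mono_set hsubC))
  have hr : ∀ i, 0 < τ ^ (1 / p i) := fun i => Real.rpow_pos_of_pos hτ _
  have htest : ∀ φ : SpaceTime N → ℝ, ContDiff ℝ ∞ φ → tsupport φ ⊆ B →
      ∃ Φ : SpaceTime N → ℝ, ContDiff ℝ ∞ Φ ∧ HasCompactSupport Φ ∧ tsupport Φ ⊆ S '' B ∧
        ∀ y, φ y = Φ (S y) := by
    intro φ hφ hs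
    have hcφ : HasCompactSupport φ := (isCompact_closedBall _ _).of_isClosed_subset
      (isClosed_tsupport φ) (hs.trans Metric.ball_subset_closedBall)
    refine ⟨φ ∘ S.symm, hφ.comp (contDiff_rescaling_symm hτ z),
      hcφ.comp_homeomorph S.symm, ?_, fun y => by simp⟩
    rw [tsupport_comp_eq_preimage φ S.symm]
    intro w hw
    exact ⟨S.symm w, hs hw, S.apply_symm_apply w⟩
  obtain ⟨c, hc0, hc⟩ := exists_integral_comp_rescaling p hτ z
  refine ⟨hintcomp u (h.locallyIntegrableOn.integrableOn_compact_subset hbox hC), fun i => ?_,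
    fun i => ?_, fun i y hy => Set.indicator_of_notMem hy _, fun φ hφ hs i => ?_,
    fun φ hφ hφ0 hs => ?_⟩
  · exact (hintcomp (fun w => τ ^ (1 / p i) * v i w)
      ((h.integrableOn_grad hp hC hbox i).const_mul _)).aestronglyMeasurable
  · have h1 : IntegrableOn (fun w => |τ ^ (1 / p i) * v i w| ^ p i)
        (S '' Metric.closedBall 0 1) := by
      have h2 := (h.memLp i _ hC hbox).integrable_norm_rpow (by
        simp only [ne_eq, ENNReal.ofReal_eq_zero, not_le]; linarith [hp i]) ENNReal.ofReal_ne_top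
      rw [ENNReal.toReal_ofReal (by linarith [hp i])] at h2
      refine (h2.const_mul ((τ ^ (1 / p i)) ^ p i)).congr (ae_of_all _ fun w => ?_)
      simp only
      rw [abs_mul, abs_of_pos (hr i), Real.mul_rpow (hr i).le (abs_nonneg _), Real.norm_eq_abs]
    refine (hintcomp _ h1).congr (ae_of_all _ fun y => ?_)
    by_cases hy : y ∈ B
    · simp only [Set.indicator_of_mem hy]
    · simp only [Set.indicator_of_notMem hy]
      rw [abs_zero, Real.zero_rpow (by linarith [hp i])]
  · obtain ⟨Φ, hΦ, hΦc, hΦs, hφΦ⟩ := htest φ hφ hs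
    have key := h.integral_mul_partialSpace hp hΦ hΦc (hΦs.trans (hsubC.trans hbox)) i
    have e1 : ∀ y, B.indicator (fun y => u (S y)) y * partialSpace i φ y =
        (fun w => τ ^ (1 / p i) * (u w * partialSpace i Φ w)) (S y) := by
      intro y
      have e : φ = fun y => Φ (S y) := funext hφΦ
      have e2 : partialSpace i φ y = τ ^ (1 / p i) * partialSpace i Φ (S y) := by
        rw [e]; exact partialSpace_comp_rescaling hτ z (hΦ.differentiable (by simp)) i y
      by_cases hy : y ∈ B
      · rw [Set.indicator_of_mem hy, e2]; ring
      · have h0 := partialSpace_eq_zero_of_notMem_tsupport (fun h' => hy (hs h')) (ζ := φ) i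
        have h0' : partialSpace i Φ (S y) = 0 := by
          rw [e2] at h0
          exact (mul_eq_zero.1 h0).resolve_left (hr i).ne'
        simp only [h0, h0', mul_zero]
    have e3 : ∀ y, B.indicator (fun y => τ ^ (1 / p i) * v i (S y)) y * φ y =
        (fun w => τ ^ (1 / p i) * (v i w * Φ w)) (S y) := by
      intro y
      by_cases hy : y ∈ B
      · rw [Set.indicator_of_mem hy, hφΦ]; ring
      · have h0 : φ y = 0 := image_eq_zero_of_notMem_tsupport (fun h' => hy (hs h'))
        simp only [← hφΦ, h0, mul_zero]
    rw [(integral_congr_ae (ae_of_all _ e1)).trans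
        (hc fun w => τ ^ (1 / p i) * (u w * partialSpace i Φ w)),
      (integral_congr_ae (ae_of_all _ e3)).trans
        (hc fun w => τ ^ (1 / p i) * (v i w * Φ w)), integral_const_mul, integral_const_mul, key]
    ring
  · obtain ⟨Φ, hΦ, hΦc, hΦs, hφΦ⟩ := htest φ hφ hs
    have hΦ0 : ∀ w, 0 ≤ Φ w := fun w => by
      have := hφΦ (S.symm w)
      rw [S.apply_symm_apply] at this
      rw [← this]; exact hφ0 _
    have hS2 : ∀ y, (S y).2 = z.2 + τ * y.2 := fun y => rfl
    have hin : ∀ s : ℝ, |s| ≤ 1 → z.2 + τ * s ∈ Set.Ioo (-T) T := by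
      intro s hs1
      have : S (0, s) ∈ omegaT Ω T := hbox ⟨(0, s), by
        rw [mem_closedBall_zero_iff, Prod.norm_def]; simpa using hs1, rfl⟩
      exact this.2
    have h1 := hin (-1) (by simp)
    have h2 := hin 1 (by simp)
    have hK : IsCompact (Prod.fst '' (S '' Metric.closedBall 0 1)) := hC.image continuous_fst
    have hKΩ : Prod.fst '' (S '' Metric.closedBall 0 1) ⊆ Ω := by
      rintro _ ⟨w, hw, rfl⟩
      exact (hbox hw).1
    have hoff : ∀ w, w ∉ S '' B → w ∉ tsupport Φ := fun w hw h' => hw (hΦs h')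
    have hmem : ∀ w, w ∈ S '' B → w.1 ∈ Prod.fst '' (S '' Metric.closedBall 0 1) ∧
        z.2 + τ * (-1) < w.2 ∧ w.2 < z.2 + τ * 1 := by
      rintro w ⟨y, hy, rfl⟩
      refine ⟨⟨_, hsubC ⟨y, hy, rfl⟩, rfl⟩, ?_⟩
      have : |y.2| < 1 := (norm_snd_le y).trans_lt (mem_ball_zero_iff.1 hy)
      rw [abs_lt] at this
      rw [hS2]
      constructor <;> nlinarith [this.1, this.2]
    have key := hsup _ _ h1.1 (by linarith) h2.2 _ hK hKΩ Φ hΦ hΦ0 fun x t hx =>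
      image_eq_zero_of_notMem_tsupport (hoff _ fun h' => hx (hmem _ h').1)
    -- The transported test function vanishes at both end times of the rescaled box, so the boundary
    -- terms disappear.
    have z1 : ∀ x, Φ (x, z.2 + τ * 1) = 0 := fun x =>
      image_eq_zero_of_notMem_tsupport (hoff _ fun h' => lt_irrefl _ (hmem _ h').2.2)
    have z2 : ∀ x, Φ (x, z.2 + τ * (-1)) = 0 := fun x =>
      image_eq_zero_of_notMem_tsupport (hoff _ fun h' => lt_irrefl _ (hmem _ h').2.1)
    simp only [z1, z2, mul_zero, integral_zero, sub_zero, zero_add] at key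
    rw [setIntegral_eq_integral_of_forall_compl_eq_zero] at key
    swap
    · intro w hw
      have hw' : w ∉ tsupport Φ := hoff w fun h' =>
        hw ⟨(hmem w h').1, (hmem w h').2.1, (hmem w h').2.2.le⟩
      simp [partialTime_eq_zero_of_notMem_tsupport hw',
        partialSpace_eq_zero_of_notMem_tsupport hw']
    have e1 : ∀ y, (-B.indicator (fun y => u (S y)) y * partialTime φ y +
        ∑ i, flux p (fun i => B.indicator fun y => τ ^ (1 / p i) * v i (S y)) i y *
          partialSpace i φ y) =
        (fun w => τ * (-u w * partialTime Φ w +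
          ∑ i, |v i w| ^ (p i - 2) * v i w * partialSpace i Φ w)) (S y) := by
      intro y
      have e : φ = fun y => Φ (S y) := funext hφΦ
      by_cases hy : y ∈ B
      · have e2 : ∀ i, partialSpace i φ y = τ ^ (1 / p i) * partialSpace i Φ (S y) := fun i => by
          rw [e]; exact partialSpace_comp_rescaling hτ z (hΦ.differentiable (by simp)) i y
        have e3 : partialTime φ y = τ * partialTime Φ (S y) := by
          rw [e]; exact partialTime_comp_rescaling hτ z (hΦ.differentiable (by simp)) y
        simp only [Set.indicator_of_mem hy, flux, e2, e3]
        rw [mul_add, Finset.mul_sum]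
        refine congrArg₂ _ (by ring) (Finset.sum_congr rfl fun i _ => ?_)
        have hpi := hp i
        have e4 : (τ ^ (1 / p i)) ^ (p i - 2) * τ ^ (1 / p i) * τ ^ (1 / p i) = τ := by
          rw [← Real.rpow_add_one (hr i).ne', ← Real.rpow_add_one (hr i).ne', ← Real.rpow_mul hτ.le]
          have : 1 / p i * (p i - 2 + 1 + 1) = 1 := by field_simp; ring
          rw [this, Real.rpow_one]
        rw [abs_mul, abs_of_pos (hr i), Real.mul_rpow (hr i).le (abs_nonneg _)]
        calc _ = ((τ ^ (1 / p i)) ^ (p i - 2) * τ ^ (1 / p i) * τ ^ (1 / p i)) *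
              (|v i (S y)| ^ (p i - 2) * v i (S y) * partialSpace i Φ (S y)) := by ring
          _ = _ := by rw [e4]
      · have hy1 : y ∉ tsupport φ := fun h' => hy (hs h')
        have hy2 : S y ∉ tsupport Φ := hoff _ fun h' => hy (S.injective.mem_set_image.1 h')
        simp [partialTime_eq_zero_of_notMem_tsupport hy1,
          partialSpace_eq_zero_of_notMem_tsupport hy1, partialTime_eq_zero_of_notMem_tsupport hy2,
          partialSpace_eq_zero_of_notMem_tsupport hy2]
    rw [(integral_congr_ae (ae_of_all _ e1)).trans (hc fun w => τ *
      (-u w * partialTime Φ w + ∑ i, |v i w| ^ (p i - 2) * v i w * partialSpace i Φ w)),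
      integral_const_mul]
    positivity

end Localization

/-! ### Density points and the interior lower bound -/

section Density

variable {N : ℕ} {p : Fin N → ℝ} {Ω : Set (Fin N → ℝ)} {T : ℝ} {u : SpaceTime N → ℝ}
  {v : Fin N → SpaceTime N → ℝ}

theorem volume_real_unitBall_pos : 0 < volume.real (Metric.ball (0 : SpaceTime N) 1) :=
  ENNReal.toReal_pos (Metric.measure_ball_pos _ _ one_pos).ne' measure_ball_lt_top.ne

/-- The kernel is the normalised indicator of the dilated unit ball, so the portion of the rescaled
ball lying in `A` is a convolution. Almost everywhere convergence of averages along a subsequence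
then acts as a density theorem for these anisotropic sets. -/
theorem exists_isAveragingKernel_rescaling (p : Fin N → ℝ) {τ : ℝ} (hτ : 0 < τ) :
    ∃ η : SpaceTime N → ℝ, IsAveragingKernel η (dilationRadius p τ) ∧
      ∀ A : Set (SpaceTime N), MeasurableSet A → ∀ z,
        volume {y | y ∈ Metric.ball (0 : SpaceTime N) 1 ∧ rescaling p hτ z y ∈ A} =
          ENNReal.ofReal (volume.real (Metric.ball (0 : SpaceTime N) 1) *
            average η (A.indicator fun _ => 1) z) := by
  set B := Metric.ball (0 : SpaceTime N) 1 with hB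
  have hBm : MeasurableSet B := Metric.isOpen_ball.measurableSet
  set g : SpaceTime N → ℝ := fun w => B.indicator (fun _ => (1 : ℝ)) ((dilation p hτ).symm w)
    with hg
  have hg0 : ∀ w, 0 ≤ g w := fun w => Set.indicator_nonneg (fun _ _ => zero_le_one) _
  have hreal : ∀ C : Set (SpaceTime N), MeasurableSet C →
      ∫ y, C.indicator (fun _ => (1 : ℝ)) y = volume.real C := fun C hC => by
    rw [integral_indicator hC]; simp
  have hβ := volume_real_unitBall_pos (N := N)
  obtain ⟨c, hc0, hc⟩ := exists_integral_comp_rescaling p hτ 0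
  have hgS : ∀ y, g (rescaling p hτ 0 y) = B.indicator (fun _ => (1 : ℝ)) y := fun y => by
    rw [hg, rescaling_apply, zero_add]
    simp only [ContinuousLinearEquiv.symm_apply_apply]
  have hcI : c * ∫ w, g w = volume.real B := by
    rw [← hc, ← hreal B hBm]
    exact integral_congr_ae (ae_of_all _ hgS)
  have hI : 0 < ∫ w, g w := by
    refine lt_of_le_of_ne (integral_nonneg hg0) fun h => ?_
    rw [← h, mul_zero] at hcI
    exact hβ.ne hcI
  -- A nonzero Bochner integral forces integrability.
  have hgi : Integrable g := by
    by_contra h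
    rw [integral_undef h] at hI
    exact lt_irrefl _ hI
  -- The ball is symmetric, so the reflection built into the convolution is harmless.
  have hneg : ∀ z w : SpaceTime N,
      g (z - w) = B.indicator (fun _ => (1 : ℝ)) ((rescaling p hτ z).symm w) := fun z w => by
    have e : (dilation p hτ).symm (z - w) = -(rescaling p hτ z).symm w := by
      have : (rescaling p hτ z).symm w = (dilation p hτ).symm (-z + w) := rfl
      rw [this, ← map_neg]
      congr 1
      abel
    have hmem : ∀ y : SpaceTime N, -y ∈ B ↔ y ∈ B := fun y => by simp [hB]
    simp only [hg, e]
    by_cases h : (rescaling p hτ z).symm w ∈ B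
    · rw [Set.indicator_of_mem h, Set.indicator_of_mem ((hmem _).2 h)]
    · rw [Set.indicator_of_notMem h, Set.indicator_of_notMem (mt (hmem _).1 h)]
  refine ⟨fun w => (∫ w, g w)⁻¹ * g w, ⟨fun w => mul_nonneg (inv_nonneg.2 hI.le) (hg0 w),
    hgi.const_mul _, ?_, fun w hw => ?_⟩, fun A hA z => ?_⟩
  · rw [integral_const_mul, inv_mul_cancel₀ hI.ne']
  · have : (dilation p hτ).symm w ∉ B := fun h => by
      have h1 := norm_dilation_le hτ (p := p) ((dilation p hτ).symm w)
      rw [ContinuousLinearEquiv.apply_symm_apply] at h1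
      have h2 := mem_ball_zero_iff.1 h
      have h3 : 0 < dilationRadius p τ := hτ.trans_le (le_dilationRadius hτ)
      nlinarith
    simp only [hg, Set.indicator_of_notMem this, mul_zero]
  · obtain ⟨d, hd0, hd⟩ := exists_integral_comp_rescaling p hτ z
    have hSy : ∀ y, g (z - rescaling p hτ z y) = B.indicator (fun _ => (1 : ℝ)) y := fun y => by
      rw [hneg, Homeomorph.symm_apply_apply]
    have hdI : d * ∫ w, g w = volume.real B := by
      rw [← hreal B hBm, ← integral_sub_left_eq_self g volume z, ← hd fun w => g (z - w)]
      exact integral_congr_ae (ae_of_all _ hSy)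
    have hset : MeasurableSet {y | y ∈ B ∧ rescaling p hτ z y ∈ A} :=
      hBm.inter ((rescaling p hτ z).continuous.measurable hA)
    have h1 : ∫ y, A.indicator (fun _ => (1 : ℝ)) (rescaling p hτ z y) *
        g (z - rescaling p hτ z y) = volume.real {y | y ∈ B ∧ rescaling p hτ z y ∈ A} := by
      rw [← hreal _ hset]
      refine integral_congr_ae (ae_of_all _ fun y => ?_)
      simp only [hSy]
      by_cases h1 : y ∈ B <;> by_cases h2 : rescaling p hτ z y ∈ A <;> simp [h1, h2]
    have h2 : average (fun w => (∫ w, g w)⁻¹ * g w) (A.indicator fun _ => 1) z =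
        (∫ w, g w)⁻¹ * ∫ w, A.indicator (fun _ => (1 : ℝ)) w * g (z - w) := by
      rw [average_apply, ← integral_const_mul]
      exact integral_congr_ae (ae_of_all _ fun w => by ring)
    have h3 : d * (∫ w, g w) * ((∫ w, g w)⁻¹ *
        ∫ w, A.indicator (fun _ => (1 : ℝ)) w * g (z - w)) =
        d * ∫ w, A.indicator (fun _ => (1 : ℝ)) w * g (z - w) := by field_simp
    have hne : volume {y | y ∈ B ∧ rescaling p hτ z y ∈ A} ≠ ⊤ :=
      ((measure_mono fun y hy => hy.1).trans_lt measure_ball_lt_top).ne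
    rw [h2, ← hdI, h3, ← hd fun w => A.indicator (fun _ => (1 : ℝ)) w * g (z - w), h1,
      ofReal_measureReal hne]

/-- Allows passing to a measurable representative, as the De Giorgi lemma requires. -/
theorem IsUnitSuperSolution.congr_ae {u' : SpaceTime N → ℝ} (h : IsUnitSuperSolution p u v)
    (hu : u =ᵐ[volume] u') : IsUnitSuperSolution p u' v where
  integrable_fun := h.integrable_fun.congr hu
  aestronglyMeasurable := h.aestronglyMeasurable
  integrable_rpow := h.integrable_rpow
  eq_zero := h.eq_zero
  weakDeriv φ hφ hs i := by
    rw [← h.weakDeriv φ hφ hs i]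
    exact integral_congr_ae (hu.mono fun y hy => by simp only [hy])
  superSolution φ hφ h0 hs := by
    refine (h.superSolution φ hφ h0 hs).trans_eq ?_
    exact integral_congr_ae (hu.mono fun y hy => by simp only [hy])

theorem isOpen_omegaT (hΩ : IsOpen Ω) : IsOpen (omegaT Ω T) := hΩ.prod isOpen_Ioo

theorem rescaling_image_closedBall_subset {τ : ℝ} (hτ : 0 < τ) (z : SpaceTime N) :
    rescaling p hτ z '' Metric.closedBall 0 1 ⊆ Metric.closedBall z (dilationRadius p τ) := by
  rintro _ ⟨y, hy, rfl⟩
  rw [rescaling_apply, mem_closedBall_iff_norm, add_sub_cancel_left]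
  have h3 : 0 ≤ dilationRadius p τ := hτ.le.trans (le_dilationRadius hτ)
  exact (norm_dilation_le hτ y).trans
    (mul_le_of_le_one_right h3 (mem_closedBall_zero_iff.1 hy))

/-- At almost every point of `{u ≥ l}` the set `{u < l}` has vanishing density along a sequence of
dilates, so the De Giorgi lemma applies at a small enough scale. The exceptional null set depends on
`l` only, not on `ε`. -/
theorem ae_exists_nhds_ae_le (hN : N ≠ 0) (hp : ∀ i, 2 < p i) (hΩ : IsOpen Ω)
    (hΩb : Bornology.IsBounded Ω) (hu : IsLocalWeakSuperSolution p Ω T u)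
    (hbelow : LocallyBoundedBelow Ω T u) (l : ℝ) :
    ∀ᵐ z, z ∈ omegaT Ω T → l ≤ u z → ∀ ε : ℝ, 0 < ε →
      ∃ U ∈ 𝓝 z, ∀ᵐ w, w ∈ U → l - ε ≤ u w := by
  obtain ⟨-, v, hv, hsup⟩ := hu
  have hO := isOpen_omegaT (T := T) hΩ
  have hmeas := hv.locallyIntegrableOn.aestronglyMeasurable
  set u₁ := hmeas.mk u with hu₁
  have hu₁m : Measurable u₁ := hmeas.stronglyMeasurable_mk.measurable
  have heq : ∀ᵐ z, z ∈ omegaT Ω T → u z = u₁ z :=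
    (ae_restrict_iff' hO.measurableSet).1 hmeas.ae_eq_mk
  set A := {z | z ∈ omegaT Ω T ∧ u₁ z < l} with hA
  have hAm : MeasurableSet A := hO.measurableSet.inter (hu₁m measurableSet_Iio)
  have hAfin : volume A ≠ ⊤ := by
    have : Bornology.IsBounded A :=
      (hΩb.prod (Metric.isBounded_Ioo (-T) T)).subset fun z hz => hz.1
    exact this.measure_lt_top.ne
  have hτ : ∀ n : ℕ, (0 : ℝ) < 1 / (n + 1) := fun n => Nat.one_div_pos_of_nat
  choose η hη hηA using fun n : ℕ => exists_isAveragingKernel_rescaling p (hτ n)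
  have hδ : Tendsto (fun n : ℕ => dilationRadius p (1 / (n + 1))) atTop (𝓝 0) :=
    (tendsto_dilationRadius hp).comp tendsto_one_div_add_atTop_nhds_zero_nat
  obtain ⟨φ, hφ, hconv⟩ := exists_subseq_average_tendsto (ι := Unit)
    (f := fun _ => A.indicator fun _ => (1 : ℝ))
    (fun _ => (integrable_indicator_iff hAm).2 (integrableOn_const hAfin)) hη hδ
  filter_upwards [(hconv ()).1, heq] with z hz hzeq hzO hlz ε hε
  have hzA : z ∉ A := fun h => by
    have := h.2
    rw [← hzeq hzO] at this
    linarith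
  rw [Set.indicator_of_notMem hzA] at hz
  obtain ⟨r, hr, hrO⟩ := Metric.nhds_basis_closedBall.mem_iff.1 (hO.mem_nhds hzO)
  obtain ⟨m, hm⟩ := hbelow _ (isCompact_closedBall z r) hrO
  rw [ae_restrict_iff' Metric.isClosed_closedBall.measurableSet] at hm
  -- The bound `m` holds on a fixed ball about `z` and rescaling leaves it unchanged. So `ν` is
  -- fixed before the scale is chosen.
  obtain ⟨ν, hν, hDG⟩ := exists_deGiorgi hN hp (le_max_right (l - m) 0) hε
  have hβ := volume_real_unitBall_pos (N := N)
  obtain ⟨n, hn1, hn2⟩ := ((hz.eventually (gt_mem_nhds (div_pos hν hβ))).and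
    ((hδ.comp hφ.tendsto_atTop).eventually (gt_mem_nhds hr))).exists
  set S := rescaling p (hτ (φ n)) z with hS
  have hball : S '' Metric.closedBall 0 1 ⊆ Metric.closedBall z r :=
    (rescaling_image_closedBall_subset _ z).trans (Metric.closedBall_subset_closedBall hn2.le)
  have hmem : ∀ y ∈ Metric.ball (0 : SpaceTime N) 1, S y ∈ Metric.closedBall z r := fun y hy =>
    hball ⟨y, Metric.ball_subset_closedBall hy, rfl⟩
  have heqS : ∀ᵐ y, S y ∈ omegaT Ω T → u (S y) = u₁ (S y) :=
    (ae_comp_rescaling_iff (hτ (φ n)) z (P := fun w => w ∈ omegaT Ω T → u w = u₁ w)).2 heq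
  have hmS : ∀ᵐ y, S y ∈ Metric.closedBall z r → m ≤ u (S y) :=
    (ae_comp_rescaling_iff (hτ (φ n)) z (P := fun w => w ∈ Metric.closedBall z r → m ≤ u w)).2 hm
  have hsol := (isUnitSuperSolution_rescaling hv hsup hp (hτ (φ n)) z (hball.trans hrO)).congr_ae
    (u' := (Metric.ball 0 1).indicator fun y => u₁ (S y)) (by
      filter_upwards [heqS] with y hy
      by_cases hyB : y ∈ Metric.ball (0 : SpaceTime N) 1
      · rw [Set.indicator_of_mem hyB, Set.indicator_of_mem hyB]
        exact hy (hrO (hmem y hyB))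
      · rw [Set.indicator_of_notMem hyB, Set.indicator_of_notMem hyB])
  have hfin := hDG _ _ l hsol
    ((hu₁m.comp S.continuous.measurable).indicator Metric.isOpen_ball.measurableSet) (by
      filter_upwards [heqS, hmS] with y h1 h2 hyB
      rw [Set.indicator_of_mem hyB, ← h1 (hrO (hmem y hyB))]
      have := h2 (hmem y hyB)
      have := le_max_left (l - m) 0
      linarith) (by
      refine (measure_mono fun y hy => ?_).trans ((hηA (φ n) A hAm z).trans_le
        (ENNReal.ofReal_le_ofReal ((lt_div_iff₀' hβ).1 hn1).le))
      have h2 := hy.2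
      rw [Set.indicator_of_mem hy.1] at h2
      exact ⟨hy.1, hrO (hmem y hy.1), h2⟩)
  have hV : IsOpen {y : SpaceTime N | sqNorm y < 1 / 4} :=
    isOpen_lt contDiff_sqNorm.continuous continuous_const
  refine ⟨S '' {y | sqNorm y < 1 / 4}, (S.isOpenMap _ hV).mem_nhds ⟨0, ?_, ?_⟩, ?_⟩
  · simp [sqNorm]
  · rw [hS, rescaling_apply, map_zero, add_zero]
  · rw [← ae_comp_rescaling_iff (hτ (φ n)) z]
    filter_upwards [heqS, hfin] with y h1 h2 hy
    have hy' : sqNorm y < 1 / 4 := S.injective.mem_set_image.1 hy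
    have hyB : y ∈ Metric.ball (0 : SpaceTime N) 1 := by
      rw [mem_ball_zero_iff]
      have := norm_le_of_sqNorm_le (z := y) (r := 1 / 2) (by norm_num) (by linarith)
      linarith
    have h3 := h2 hy'.le
    rw [Set.indicator_of_mem hyB, ← h1 (hrO (hmem y hyB))] at h3
    exact h3

end Density

end Anisotropic

/-! ### The main theorem -/

theorem theorem4p1 {N : ℕ} (hN : 1 < N)
    (p : Fin N → ℝ) (hp2 : ∀ i, 2 < p i)
    (hpBar : Anisotropic.pBar p < (N : ℝ)) (hpStar : ∀ i, p i < Anisotropic.pBarStar p)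
    (Ω : Set (Fin N → ℝ)) (hΩ : IsOpen Ω) (hΩb : Bornology.IsBounded Ω)
    (T : ℝ) (hT : 0 < T)
    (u : Anisotropic.SpaceTime N → ℝ)
    (hu : Anisotropic.IsLocalWeakSuperSolution p Ω T u)
    (hbelow : Anisotropic.LocallyBoundedBelow Ω T u) :
    (∀ z ∈ Anisotropic.omegaT Ω T,
      Tendsto (Anisotropic.cylinderEssInf p u z) (𝓝[>] (0 : ℝ))
        (𝓝 (Anisotropic.lscRegularization p u z)) ∧
      Anisotropic.lscRegularization p u z ≠ ⊥) ∧
    LowerSemicontinuousOn (Anisotropic.lscRegularization p u) (Anisotropic.omegaT Ω T) ∧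
    (∀ᵐ z ∂(volume.restrict (Anisotropic.omegaT Ω T)),
      (u z : EReal) = Anisotropic.lscRegularization p u z) := by
  have hp : ∀ i, 0 < p i := fun i => two_pos.trans (hp2 i)
  have hP : 0 < Anisotropic.pBar p := Anisotropic.pBar_pos (zero_lt_one.trans hN) hp
  have hO := Anisotropic.isOpen_omegaT (T := T) hΩ
  refine ⟨fun z hz => ⟨Anisotropic.tendsto_cylinderEssInf hp hP z, fun h => ?_⟩,
    (Anisotropic.lowerSemicontinuous_lscRegularization hp hP).lowerSemicontinuousOn _, ?_⟩
  -- The lower bound on a ball about `z` passes to `u_*` and excludes `-∞`.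
  · obtain ⟨r, hr, hrO⟩ := Metric.nhds_basis_closedBall.mem_iff.1 (hO.mem_nhds hz)
    obtain ⟨m, hm⟩ := hbelow _ (isCompact_closedBall z r) hrO
    rw [ae_restrict_iff' Metric.isClosed_closedBall.measurableSet] at hm
    have := Anisotropic.le_lscRegularization_of_nhds hp hP (c := (m : EReal))
      (Metric.closedBall_mem_nhds z hr) (hm.mono fun w h1 h2 => EReal.coe_le_coe_iff.2 (h1 h2))
    rw [h] at this
    exact EReal.coe_ne_bot m (le_bot_iff.1 this)
  · rw [ae_restrict_iff' hO.measurableSet]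
    filter_upwards [Anisotropic.lscRegularization_le_ae (u := u) hp hP,
      Anisotropic.ae_le_lscRegularization (O := Anisotropic.omegaT Ω T) hp hP fun l : ℚ =>
        Anisotropic.ae_exists_nhds_ae_le (zero_lt_one.trans hN).ne' hp2 hΩ hΩb hu hbelow l]
      with z h1 h2 hz
    exact le_antisymm (h2 hz) h1
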